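/- Let $k_0,k_1\in\mathbb{R}$ satisfy $-\frac12<k_0+k_1<\frac12$ and $-\frac12<k_0-k_1<\frac12$. **Dunkl operators and the form $\langle\cdot,\cdot\rangle_S$.** Let $W$ be the symmetry group of the square ($B_2$), acting on row vectors $x=(x_1,x_2)$, with positive roots $(1,-1),(1,1)$ (multiplicity $\kappa=k_0$) and $(1,0),(0,1)$ (multiplicity $\kappa=k_1$) and reflections $\sigma_v$. Let $\mathcal P_V$ be the space of polynomials $p(x,t)=f_1(x)t_1+f_2(x)t_2$, with $f_1,f_2\in\mathbb R[x_1,x_2]$, also written as row vectors $(f_1,f_2)$. For $i=1,2$ set $$\mathcal D_i p(x,t)=\frac{\partial p}{\partial x_i}(x,t)+\sum_{v}\kappa(v)\,v_i\,\frac{p(x,t\sigma_v)-p(x\sigma_v,t\sigma_v)}{\langle x,v\rangle},\qquad \Delta_\kappa=\mathcal D_1^2+\mathcal D_2^2 ,$$ the sum being over the four positive roots. With $t_1,t_2$ orthonormal put $\langle f,g\rangle_\tau=\sum_{i=1}^2\langle t_i,f_i(\mathcal D_1,\mathcal D_2)g\rangle|_{x=0}$ and $\langle f,g\rangle_G=\langle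 e^{\Delta_\kappa/2}f,e^{\Delta_\kappa/2}g\rangle_\tau$. For $f,g\in\mathcal P_V$ homogeneous of degrees $a,b$ in $x$ put $\langle f,g\rangle_S=\frac{1}{2^\ell\ell!}\langle f,g\rangle_G$ with $\ell=\frac{a+b}2$ if $a\equiv b\bmod 2$, and $\langle f,g\rangle_S=0$ otherwise; extend bilinearly. Let $\phi=x_1^2-x_2^2$ and $p_{1,2}=-x_2t_1+x_1t_2=(-x_2,x_1)$. **The matrix weight.** Let $F={}_2F_1$. For $0<u<1$ let $L(u)$ be the $2\times2$ matrix with entries $$L_{11}=u^{k_1}(1-u^2)^{-k_0}F\left(-k_0,\tfrac12-k_0+k_1;k_1+\tfrac12;u^2\right),$$ $$L_{12}=-\tfrac{k_0}{k_1+1/2}\,u^{k_1+1}(1-u^2)^{-k_0}F\left(1-k_0,\tfrac12-k_0+k_1;k_1+\tfrac32;u^2\right),$$ $$L_{21}=-\tfrac{k_0}{1/2-k_1}\,u^{1-k_1}(1-u^2)^{-k_0}F\left(1-k_0,\tfrac12-k_0-k_1;\tfrac32-k_1;u^2\right),$$ $$L_{22}=u^{-k_1}(1-u^2)^{-k_0}F\left(-k_0,\tfrac12-k_0-k_1;\tfrac12-k_1;u^2\right).$$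 For $0<x_2<x_1$ let $K(x)=L(u)^T\operatorname{diag}(d_1,d_2)L(u)$ with $u=x_2/x_1$ and $$d_1=\frac{c\,\Gamma(\frac12-k_1)^2}{\cos\pi k_0\,\Gamma(\frac12+k_0-k_1)\Gamma(\frac12-k_0-k_1)},\qquad d_2=\frac{c\,\Gamma(\frac12+k_1)^2}{\cos\pi k_0\,\Gamma(\frac12+k_0+k_1)\Gamma(\frac12-k_0+k_1)},$$ and extend $K$ to almost all of $\mathbb R^2$ by $K(xw)=w^{-1}K(x)w$ for $w\in W$. Here $c=c(k_0,k_1)$ is the normalization constant, determined by $$\int_{\mathbb R^2}(1,0)\,K(x)\,(1,0)^T e^{-|x|^2/2}\,dx=1 .$$ **Claim.** The normalizing integral converges absolutely (and $c(k_0,k_1)$ is thus well defined). With $x_\theta=(\cos\theta,\sin\theta)$, for every $n\ge0$ the following integral converges absolutely and $$\left\langle\phi^{2n}p_{1,2},p_{1,2}\right\rangle_S=8\int_0^{\pi/4}\phi(x_\theta)^{2n}\,p_{1,2}(x_\theta)K(x_\theta)p_{1,2}(x_\theta)^T\,d\theta .$$ Moreover, as $n\to\infty$, $$\left\langle\phi^{2n}p_{1,2},p_{1,2}\right\rangle_S\sim\frac{2\pi\,c(k_0,k_1)}{\cos\pi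 k_0\,\cos\pi k_1}\cdot\frac{2^{2k_1}\,n^{k_1-1/2}\,\Gamma(\frac12+k_1)}{\Gamma(\frac12+k_0+k_1)\,\Gamma(\frac12-k_0+k_1)},$$ where $a(n)\sim b(n)$ means $\lim_{n\to\infty}a(n)/b(n)=1$. -/

import Mathlib

namespace B2

open MvPolynomial

noncomputable section

/-! ## Vector-valued polynomials and Dunkl operators -/

/-- Scalar polynomials in `x₁ = X 0`, `x₂ = X 1`. -/
abbrev Poly := MvPolynomial (Fin 2) ℝ

/-- `f₁(x) t₁ + f₂(x) t₂`, stored as the row vector `(f₁, f₂)`. -/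
abbrev PV := Fin 2 → Poly

/-- The four positive roots of `B₂`. -/
def root : Fin 4 → Fin 2 → ℝ := ![![1, -1], ![1, 1], ![1, 0], ![0, 1]]

/-- The multiplicity function: `k₀` on `(1, ∓1)`, `k₁` on the coordinate vectors. -/
def mult (k₀ k₁ : ℝ) : Fin 4 → ℝ := ![k₀, k₀, k₁, k₁]

/-- The reflection `σ_v : x ↦ x - 2 ⟨x, v⟩ / ⟨v, v⟩ v`, as a (symmetric) matrix. -/
def refl (v : Fin 2 → ℝ) : Matrix (Fin 2) (Fin 2) ℝ :=
  1 - (2 / (v ⬝ᵥ v)) • Matrix.vecMulVec v v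

/-- The linear form `⟨x, v⟩`. -/
def linForm (v : Fin 2 → ℝ) : Poly := ∑ i, C (v i) * X i

/-- `p(x) ↦ p(x w)`. -/
def subst (w : Matrix (Fin 2) (Fin 2) ℝ) (p : Poly) : Poly :=
  aeval (fun j => ∑ i, C (w i j) * (X i : Poly)) p

/-- `p(x) - p(x σ_v)` is divisible by `⟨x, v⟩`. -/
theorem linForm_dvd (v : Fin 2 → ℝ) (p : Poly) : linForm v ∣ p - subst (refl v) p := by
  induction p using MvPolynomial.induction_on with
  | C a => simp [subst]
  | add p q hp hq =>
    have h : p + q - subst (refl v) (p + q)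
        = (p - subst (refl v) p) + (q - subst (refl v) q) := by
      simp only [subst, map_add]; ring
    rw [h]; exact dvd_add hp hq
  | mul_X p j hp =>
    have hX : linForm v ∣ (X j : Poly) - subst (refl v) (X j) := by
      refine ⟨C (2 / (v ⬝ᵥ v) * v j), ?_⟩
      fin_cases j <;>
        simp [subst, refl, linForm, Fin.sum_univ_two, Matrix.vecMulVec_apply] <;> ring
    have h : p * X j - subst (refl v) (p * X j)
        = (p - subst (refl v) p) * X j + subst (refl v) p * (X j - subst (refl v) (X j)) := by
      simp only [subst, map_mul]; ring
    rw [h]; exact dvd_add (hp.mul_right _) (hX.mul_left _)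

/-- The divided difference `(p(x) - p(x σ_v)) / ⟨x, v⟩`, a polynomial. -/
def divDiff (v : Fin 2 → ℝ) (p : Poly) : Poly := (linForm_dvd v p).choose

/-- The Dunkl operators on `p(x, t) = f₁(x) t₁ + f₂(x) t₂`:
`𝒟ᵢ p(x,t) = ∂ᵢ p(x,t) + ∑_v κ(v) vᵢ (p(x, t σ_v) - p(x σ_v, t σ_v)) / ⟨x, v⟩`. -/
def dunkl (k₀ k₁ : ℝ) (i : Fin 2) (f : PV) : PV := fun j =>
  pderiv i (f j) +
    ∑ r, C (mult k₀ k₁ r * root r i) * ∑ l, C (refl (root r) l j) * divDiff (root r) (f l)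

/-- `Δ_κ = 𝒟₁² + 𝒟₂²`. -/
def lap (k₀ k₁ : ℝ) (f : PV) : PV := ∑ i, dunkl k₀ k₁ i (dunkl k₀ k₁ i f)

/-- `p(𝒟₁, 𝒟₂) g`. -/
def polyDunkl (k₀ k₁ : ℝ) (p : Poly) (g : PV) : PV :=
  ∑ m ∈ p.support, p.coeff m • (dunkl k₀ k₁ 0)^[m 0] ((dunkl k₀ k₁ 1)^[m 1] g)

/-- `⟨f, g⟩_τ = ∑ᵢ ⟨tᵢ, fᵢ(𝒟) g⟩_τ |_{x = 0}`, where `t₁, t₂` are orthonormal. -/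
def formTau (k₀ k₁ : ℝ) (f g : PV) : ℝ := ∑ i, eval 0 (polyDunkl k₀ k₁ (f i) g i)

/-- The largest degree of a component. -/
def deg (f : PV) : ℕ := Finset.univ.sup fun i => (f i).totalDegree

/-- `e^{Δ_κ/2} f`; the series stops because `Δ_κ` lowers degrees by two. -/
def expLap (k₀ k₁ : ℝ) (f : PV) : PV :=
  ∑ j ∈ Finset.range (deg f + 1), (1 / (2 ^ j * (j.factorial : ℝ))) • (lap k₀ k₁)^[j] f

/-- `⟨f, g⟩_G = ⟨e^{Δ_κ/2} f, e^{Δ_κ/2} g⟩_τ`. -/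
def formG (k₀ k₁ : ℝ) (f g : PV) : ℝ := formTau k₀ k₁ (expLap k₀ k₁ f) (expLap k₀ k₁ g)

/-- The homogeneous component of degree `m`. -/
def hcomp (m : ℕ) (f : PV) : PV := fun i => homogeneousComponent m (f i)

/-- `⟨f, g⟩_S`: for `f`, `g` homogeneous of degrees `a`, `b` it is
`⟨f, g⟩_G / (2^ℓ ℓ!)` with `ℓ = (a + b) / 2` if `a ≡ b mod 2`, and `0` otherwise;
extended bilinearly. -/
def formS (k₀ k₁ : ℝ) (f g : PV) : ℝ :=
  ∑ a ∈ Finset.range (deg f + 1), ∑ b ∈ Finset.range (deg g + 1),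
    if a % 2 = b % 2 then
      1 / (2 ^ ((a + b) / 2) * (((a + b) / 2).factorial : ℝ)) *
        formG k₀ k₁ (hcomp a f) (hcomp b g)
    else 0

/-- `φ = x₁² - x₂²`. -/
def phi : Poly := X 0 ^ 2 - X 1 ^ 2

/-- `p_{1,2} = -x₂ t₁ + x₁ t₂`. -/
def p12 : PV := ![-X 1, X 0]

/-- The value `f(x)` of a vector-valued polynomial. -/
def evalPV (x : Fin 2 → ℝ) (f : PV) : Fin 2 → ℝ := fun i => eval x (f i)

/-! ## The matrix weight function -/

/-- The matrix `L(u)`, `0 < u < 1`. -/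
def matL (k₀ k₁ u : ℝ) : Matrix (Fin 2) (Fin 2) ℝ :=
  !![|u| ^ k₁ * (1 - u ^ 2) ^ (-k₀) *
        ordinaryHypergeometric (-k₀) (1 / 2 - k₀ + k₁) (k₁ + 1 / 2) (u ^ 2),
     -(k₀ / (k₁ + 1 / 2)) * |u| ^ k₁ * (1 - u ^ 2) ^ (-k₀) * u *
        ordinaryHypergeometric (1 - k₀) (1 / 2 - k₀ + k₁) (k₁ + 3 / 2) (u ^ 2);
     -(k₀ / (1 / 2 - k₁)) * |u| ^ (-k₁) * (1 - u ^ 2) ^ (-k₀) * u *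
        ordinaryHypergeometric (1 - k₀) (1 / 2 - k₀ - k₁) (3 / 2 - k₁) (u ^ 2),
     |u| ^ (-k₁) * (1 - u ^ 2) ^ (-k₀) *
        ordinaryHypergeometric (-k₀) (1 / 2 - k₀ - k₁) (1 / 2 - k₁) (u ^ 2)]

/-- `d₁` with the scalar `c` left free. -/
def d1 (c k₀ k₁ : ℝ) : ℝ :=
  c * (Real.Gamma (1 / 2 - k₁) ^ 2 /
    (Real.cos (Real.pi * k₀) * Real.Gamma (1 / 2 + k₀ - k₁) * Real.Gamma (1 / 2 - k₀ - k₁)))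

/-- `d₂` with the scalar `c` left free. -/
def d2 (c k₀ k₁ : ℝ) : ℝ :=
  c * (Real.Gamma (1 / 2 + k₁) ^ 2 /
    (Real.cos (Real.pi * k₀) * Real.Gamma (1 / 2 + k₀ + k₁) * Real.Gamma (1 / 2 - k₀ + k₁)))

/-- `L(u)ᵀ diag(d₁, d₂) L(u)` with `u = x₂ / x₁`, on the chamber `0 < x₂ < x₁`. -/
def chamberK (c k₀ k₁ : ℝ) (x : Fin 2 → ℝ) : Matrix (Fin 2) (Fin 2) ℝ :=
  (matL k₀ k₁ (x 1 / x 0)).transpose * Matrix.diagonal ![d1 c k₀ k₁, d2 c k₀ k₁] *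
    matL k₀ k₁ (x 1 / x 0)

/-- For `x` off the reflection lines, the signed permutation matrix `w` with `x = y w`,
`0 < y₂ < y₁`. -/
def chamberElt (x : Fin 2 → ℝ) : Matrix (Fin 2) (Fin 2) ℝ :=
  (if |x 1| < |x 0| then 1 else !![0, 1; 1, 0]) *
    Matrix.diagonal ![Real.sign (x 0), Real.sign (x 1)]

/-- The extension to the plane by `K(y w) = w⁻¹ K(y) w` for `0 < y₂ < y₁` and `w` in the
reflection group (`w⁻¹ = wᵀ`). The values on the reflection lines, a null set, are
immaterial. -/
def weightK (c k₀ k₁ : ℝ) (x : Fin 2 → ℝ) : Matrix (Fin 2) (Fin 2) ℝ :=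
  (chamberElt x).transpose *
    chamberK c k₀ k₁ ![max |x 0| |x 1|, min |x 0| |x 1|] * chamberElt x

/-- The normalization constant `c(k₀, k₁)`: the scalar for which
`∫_{ℝ²} (1,0) K(x) (1,0)ᵀ e^{-|x|²/2} dx = 1` (the integral is linear in the scalar). -/
def normConst (k₀ k₁ : ℝ) : ℝ :=
  (∫ x : ℝ × ℝ, weightK 1 k₀ k₁ ![x.1, x.2] 0 0 * Real.exp (-(x.1 ^ 2 + x.2 ^ 2) / 2))⁻¹

/-- The normalized matrix weight function `K`. -/
def K (k₀ k₁ : ℝ) (x : Fin 2 → ℝ) : Matrix (Fin 2) (Fin 2) ℝ :=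
  weightK (normConst k₀ k₁) k₀ k₁ x

/-- The point `x_θ` of the unit circle. -/
def circ (θ : ℝ) : Fin 2 → ℝ := ![Real.cos θ, Real.sin θ]

/-- `φ(x_θ)^{2n} p_{1,2}(x_θ) K(x_θ) p_{1,2}(x_θ)ᵀ`. -/
def integrand (k₀ k₁ : ℝ) (n : ℕ) (θ : ℝ) : ℝ :=
  eval (circ θ) phi ^ (2 * n) *
    (evalPV (circ θ) p12 ⬝ᵥ (K k₀ k₁ (circ θ)).mulVec (evalPV (circ θ) p12))

end

end B2

namespace B2

open Filter Topology MeasureTheory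

noncomputable section

/-! ## The hypergeometric series -/

/-! The value of the form and the circle integral are shown to satisfy the same recurrence with the
same initial value; no adjointness of the Dunkl operators with respect to `K` is ever proved.

Analytic side. On the arc `0 < θ < π/4` write `K` as the symmetric matrix with diagonal `α + γ`, `α
- γ` and off-diagonal entry `β`. Contiguous relations show that both rows of `L` solve one linear
system `L' = L M` with `M` symmetric of trace zero (`hasDerivAt_rowA`, `hasDerivAt_rowB`), so `α, β,
γ` solve a closed linear system in `θ`. Integrating the derivatives of `cos(2θ)^(m+1) β`, `cos(2θ)^m
sin(2θ) γ` and `cos(2θ)^(m+1) sin(2θ) α` over the arc relates their moments. The weight is at worst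
of order `θ^(-2|k₁|)` at `0` and `(π/4 - θ)^(-2|k₀|)` at `π/4`, with exponents above `-1`, so most
boundary terms vanish by size alone. The exception is `sin(2θ) γ` at `π/4`: it needs `γ → 0` there,
which is what the ratio `d₁ : d₂` achieves (`tendsto_kGamma_end`, from Gauss's summation at `u =
1`). The moments combine into two sequences `sInt`, `tInt` with a closed recurrence, and the
Gaussian normalization, which in polar coordinates reads `8 ∫ α = 1`, gives `sInt = 1 + 2k₀ + 2k₁`
at `n = 0`.

Algebraic side. The polynomials `|x|^(2j) φ^(2m) p₁₂` and `|x|^(2j) φ^(2m+1) (x₂, x₁)` span a space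
stable under `Δ_κ`, with explicit coefficients (`lap_vPoly_succ`, `lap_uPoly`). Since `Δ_κ p₁₂ = 0`
and the first Dunkl derivatives of `p₁₂` are constant, pairing with `p₁₂` is `1 + 2k₀ + 2k₁` times
the curl at the origin. Hence the form on `φ^(2n) p₁₂` comes from the curl of `Δ_κ^(2n)` alone, and
`curl_lapL_pow` computes it from any pair of sequences satisfying the recurrence.

Asymptotics. Near `θ = 0` the quadratic form of `K` at `(-sin θ, cos θ)` behaves like `d₂ θ^(-2k₁)`,
and `cos(2θ)^(2n)` concentrates at the scale `θ = y/√n`, where it tends to `exp(-4y²)`. Laplace's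
method leaves a Gamma integral, and the reflection formula brings the constant to the stated form.
-/

/-- The Taylor coefficients of `₂F₁`. -/
def hgCoeff (a b c : ℝ) (n : ℕ) : ℝ := ordinaryHypergeometricCoefficient a b c n

theorem hgCoeff_zero (a b c : ℝ) : hgCoeff a b c 0 = 1 := by
  simp [hgCoeff, ordinaryHypergeometricCoefficient]

theorem ascPochhammer_eval_pos {c : ℝ} (hc : 0 < c) (n : ℕ) : 0 < (ascPochhammer ℝ n).eval c :=
  ascPochhammer_pos n c hc

theorem hgCoeff_succ (a b : ℝ) {c : ℝ} (hc : 0 < c) (n : ℕ) :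
    hgCoeff a b c (n + 1) * ((c + n) * (n + 1)) = hgCoeff a b c n * ((a + n) * (b + n)) := by
  have h1 : c + n ≠ 0 := by positivity
  have h2 : (n : ℝ) + 1 ≠ 0 := by positivity
  have h3 := (ascPochhammer_eval_pos hc n).ne'
  have h4 : (n.factorial : ℝ) ≠ 0 := by positivity
  simp only [hgCoeff, ordinaryHypergeometricCoefficient, ascPochhammer_succ_eval,
    Nat.factorial_succ, Nat.cast_mul, Nat.cast_succ]
  field_simp

theorem hgCoeff_pos {a b c : ℝ} (ha : 0 < a) (hb : 0 < b) (hc : 0 < c) (n : ℕ) :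
    0 < hgCoeff a b c n := by
  have h1 := ascPochhammer_eval_pos ha n
  have h2 := ascPochhammer_eval_pos hb n
  have h3 := ascPochhammer_eval_pos hc n
  simp only [hgCoeff, ordinaryHypergeometricCoefficient]
  positivity

/-- Raising the first parameter. -/
theorem hgCoeff_shift_left (a b : ℝ) {c : ℝ} (n : ℕ) :
    a * hgCoeff (a + 1) b c n = (a + n) * hgCoeff a b c n := by
  have key : a * (ascPochhammer ℝ n).eval (a + 1) = (a + n) * (ascPochhammer ℝ n).eval a := by
    have h1 := ascPochhammer_succ_eval n a
    have h2 : (ascPochhammer ℝ (n + 1)).eval a = a * (ascPochhammer ℝ n).eval (a + 1) := by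
      rw [ascPochhammer_succ_left]; simp
    rw [← h2, h1]; ring
  simp only [hgCoeff, ordinaryHypergeometricCoefficient]
  linear_combination (n.factorial : ℝ)⁻¹ * (ascPochhammer ℝ n).eval b *
    ((ascPochhammer ℝ n).eval c)⁻¹ * key

/-- Raising the last parameter. -/
theorem hgCoeff_shift_right (a b : ℝ) {c : ℝ} (hc : 0 < c) (n : ℕ) :
    (c + n) * hgCoeff a b (c + 1) n = c * hgCoeff a b c n := by
  have key : c * (ascPochhammer ℝ n).eval (c + 1) = (c + n) * (ascPochhammer ℝ n).eval c := by
    have h1 := ascPochhammer_succ_eval n c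
    have h2 : (ascPochhammer ℝ (n + 1)).eval c = c * (ascPochhammer ℝ n).eval (c + 1) := by
      rw [ascPochhammer_succ_left]; simp
    rw [← h2, h1]; ring
  have h1 := (ascPochhammer_eval_pos hc n).ne'
  have h2 := (ascPochhammer_eval_pos (add_pos hc one_pos) n).ne'
  simp only [hgCoeff, ordinaryHypergeometricCoefficient]
  field_simp
  linear_combination -(ascPochhammer ℝ n).eval a * (ascPochhammer ℝ n).eval b * key

/-- Only a lower bound is claimed, because the series terminates, with infinite radius, when `a` or
`b` is a nonpositive integer. This does occur: `a = -k₀` at `k₀ = 0`. -/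
theorem one_le_radius (a b : ℝ) {c : ℝ} (hc : 0 < c) :
    1 ≤ (ordinaryHypergeometricSeries ℝ a b c).radius := by
  by_cases h1 : ∃ k : ℕ, (k : ℝ) = -a
  · obtain ⟨k, hk⟩ := h1
    obtain rfl : a = -(k : ℝ) := by linarith
    rw [ordinaryHypergeometric_radius_top_of_neg_nat₁]; exact le_top
  by_cases h2 : ∃ k : ℕ, (k : ℝ) = -b
  · obtain ⟨k, hk⟩ := h2
    obtain rfl : b = -(k : ℝ) := by linarith
    rw [ordinaryHypergeometric_radius_top_of_neg_nat₂]; exact le_top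
  push Not at h1 h2
  rw [ordinaryHypergeometricSeries_radius_eq_one]
  intro k
  refine ⟨h1 k, h2 k, fun h => ?_⟩
  have : (0 : ℝ) ≤ k := k.cast_nonneg
  linarith

theorem summable_hgCoeff_abs_mul_pow (a b : ℝ) {c : ℝ} (hc : 0 < c) {r : ℝ} (h0 : 0 ≤ r)
    (h1 : r < 1) : Summable fun n => |hgCoeff a b c n| * r ^ n := by
  lift r to NNReal using h0
  have h2 : (r : ENNReal) < (ordinaryHypergeometricSeries ℝ a b c).radius :=
    lt_of_lt_of_le (by exact_mod_cast h1) (one_le_radius a b hc)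
  have h3 := (ordinaryHypergeometricSeries ℝ a b c).summable_norm_mul_pow h2
  simpa [ordinaryHypergeometricSeries, FormalMultilinearSeries.ofScalars_norm, hgCoeff] using h3

theorem ordinaryHypergeometric_eq (a b c z : ℝ) :
    ordinaryHypergeometric a b c z = ∑' n, hgCoeff a b c n * z ^ n := by
  rw [ordinaryHypergeometric_eq_tsum]
  rfl

/-! ## Power series on the unit interval -/

theorem summable_mul_pow {T : ℕ → ℝ} (hT : ∀ r : ℝ, 0 ≤ r → r < 1 → Summable fun n => |T n| * r ^ n)
    {z : ℝ} (hz : |z| < 1) : Summable fun n => T n * z ^ n := by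
  refine Summable.of_norm ?_
  simpa [abs_mul, abs_pow] using hT |z| (abs_nonneg z) hz

/-- For `r < s < 1` the terms `|T n| s^n` are bounded, so the differentiated series is dominated by
a multiple of `(n + 1) (r/s)^n`. -/
theorem summable_natCast_mul_pow {T : ℕ → ℝ}
    (hT : ∀ r : ℝ, 0 ≤ r → r < 1 → Summable fun n => |T n| * r ^ n)
    {r : ℝ} (h0 : 0 ≤ r) (h1 : r < 1) : Summable fun n : ℕ => (n + 1) * |T (n + 1)| * r ^ n := by
  obtain ⟨s, hs, hs1⟩ := exists_between h1
  have hs0 : 0 < s := lt_of_le_of_lt h0 hs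
  obtain ⟨M, hM⟩ := (hT s hs0.le hs1).tendsto_atTop_zero.bddAbove_range
  have hM' : ∀ n, |T n| * s ^ n ≤ M := fun n => hM ⟨n, rfl⟩
  have hq : ‖r / s‖ < 1 := by
    rw [Real.norm_of_nonneg (by positivity), div_lt_one hs0]; exact hs
  have hg : Summable fun n : ℕ => (M / s) * ((n : ℝ) ^ 1 * (r / s) ^ n + (r / s) ^ n) :=
    ((summable_pow_mul_geometric_of_norm_lt_one 1 hq).add
      (summable_geometric_of_norm_lt_one hq)).mul_left _
  refine Summable.of_nonneg_of_le (fun n => by positivity) (fun n => ?_) hg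
  have h := hM' (n + 1)
  rw [← le_div_iff₀ (by positivity)] at h
  calc (n + 1) * |T (n + 1)| * r ^ n ≤ (n + 1) * (M / s ^ (n + 1)) * r ^ n := by gcongr
    _ = _ := by rw [div_pow, pow_succ]; field_simp

theorem hasDerivAt_tsum_mul_pow {T : ℕ → ℝ}
    (hT : ∀ r : ℝ, 0 ≤ r → r < 1 → Summable fun n => |T n| * r ^ n) {z : ℝ} (hz : |z| < 1) :
    HasDerivAt (fun z => ∑' n, T n * z ^ n) (∑' n : ℕ, (n + 1) * T (n + 1) * z ^ n) z := by
  obtain ⟨r, hr, hr1⟩ := exists_between hz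
  have hr0 : 0 ≤ r := (abs_nonneg z).trans hr.le
  have hu : Summable fun n : ℕ => n * |T n| * r ^ (n - 1) := by
    rw [← summable_nat_add_iff 1]
    simpa using summable_natCast_mul_pow hT hr0 hr1
  have hd := hasDerivAt_tsum_of_isPreconnected (𝕜 := ℝ) (g := fun n z => T n * z ^ n)
    (g' := fun n z => T n * (n * z ^ (n - 1))) (t := Metric.ball 0 r) (y := z) (y₀ := z) hu
    Metric.isOpen_ball (convex_ball _ _).isPreconnected
    (fun n y _ => (hasDerivAt_pow n y).const_mul _) ?_ (by simpa using hr)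
    (summable_mul_pow hT hz) (by simpa using hr)
  · convert! hd using 1
    have hs : Summable fun n : ℕ => T n * (n * z ^ (n - 1)) := by
      refine Summable.of_norm_bounded hu fun n => ?_
      rw [Real.norm_eq_abs, abs_mul, abs_mul, abs_pow, Nat.abs_cast]
      calc |T n| * (n * |z| ^ (n - 1)) = n * |T n| * |z| ^ (n - 1) := by ring
        _ ≤ _ := by gcongr
    rw [hs.tsum_eq_zero_add]
    simp only [Nat.cast_zero, zero_mul, mul_zero, zero_add, Nat.add_sub_cancel]
    exact tsum_congr fun n => by push_cast; ring
  · intro n y hy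
    have hy' : |y| ≤ r := by simpa using (Metric.mem_ball.1 hy).le
    rw [Real.norm_eq_abs, abs_mul, abs_mul, abs_pow, Nat.abs_cast]
    calc |T n| * (n * |y| ^ (n - 1)) = n * |T n| * |y| ^ (n - 1) := by ring
      _ ≤ _ := by gcongr

/-- A power series with absolutely summable coefficients is left continuous at `1`. -/
theorem tendsto_tsum_mul_pow {T : ℕ → ℝ} (hT : Summable fun n => |T n|) {g : ℝ → ℝ}
    (hg : Tendsto g (𝓝[<] 1) (𝓝 1)) (hg0 : ∀ᶠ u in 𝓝[<] 1, |g u| ≤ 1) :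
    Tendsto (fun u => ∑' n, T n * g u ^ n) (𝓝[<] 1) (𝓝 (∑' n, T n)) := by
  refine tendsto_tsum_of_dominated_convergence (bound := fun n => |T n|) hT (fun n => ?_) ?_
  · simpa using (hg.pow n).const_mul (T n)
  · filter_upwards [hg0] with u hu n
    rw [Real.norm_eq_abs, abs_mul, abs_pow]
    exact mul_le_of_le_one_right (abs_nonneg _) (pow_le_one₀ (abs_nonneg _) hu)

theorem abs_tsum_mul_pow_le {T : ℕ → ℝ} (hT : Summable fun n => |T n|) {z : ℝ} (hz : |z| ≤ 1) :
    |∑' n, T n * z ^ n| ≤ ∑' n, |T n| := by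
  have hb : ∀ n, |T n * z ^ n| ≤ |T n| := fun n => by
    rw [abs_mul, abs_pow]
    exact mul_le_of_le_one_right (abs_nonneg _) (pow_le_one₀ (abs_nonneg _) hz)
  have hs : Summable fun n => |T n * z ^ n| := Summable.of_nonneg_of_le (fun _ => abs_nonneg _) hb hT
  have h1 : |∑' n, T n * z ^ n| ≤ ∑' n, |T n * z ^ n| := by
    simpa using norm_tsum_le_tsum_norm (f := fun n => T n * z ^ n) (by simpa using hs)
  exact h1.trans (hs.tsum_le_tsum hb hT)

/-! ## Gauss's summation -/

theorem hasSum_one_sub_rpow {a t : ℝ} (h0 : 0 ≤ t) (h1 : t < 1) :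
    HasSum (fun n : ℕ => (ascPochhammer ℝ n).eval a / n.factorial * t ^ n) ((1 - t) ^ (-a)) := by
  have h := (Real.one_div_one_sub_rpow_hasFPowerSeriesOnBall_zero a).hasSum (y := t)
    (by simpa [abs_of_nonneg h0, ← ofReal_norm, h0] using h1)
  simp only [zero_add, FormalMultilinearSeries.ofScalars_apply_eq, smul_eq_mul] at h
  rw [one_div, ← Real.rpow_neg (by linarith)] at h
  convert! h using 3 with n
  have := Ring.factorial_nsmul_multichoose_eq_ascPochhammer a n
  rw [Ring.multichoose_eq] at this
  rw [← Polynomial.ascPochhammer_smeval_eq_eval, ← this]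
  have : (n.factorial : ℝ) ≠ 0 := by positivity
  simp
  field_simp

theorem integrableOn_beta {x y : ℝ} (hx : 0 < x) (hy : 0 < y) :
    IntegrableOn (fun t : ℝ => t ^ (x - 1) * (1 - t) ^ (y - 1)) (Set.Ioo 0 1) := by
  have h := Complex.betaIntegral_convergent (u := x) (v := y) (by simpa) (by simpa)
  rw [intervalIntegrable_iff_integrableOn_Ioo_of_le zero_le_one] at h
  have h' : IntegrableOn (fun t : ℝ => RCLike.re ((t : ℂ) ^ ((x : ℂ) - 1) *
      (1 - (t : ℂ)) ^ ((y : ℂ) - 1))) (Set.Ioo 0 1) := Integrable.re h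
  refine h'.congr_fun (fun t ht => ?_) measurableSet_Ioo
  have e1 : ((t : ℂ)) ^ ((x : ℂ) - 1) = ((t ^ (x - 1) : ℝ) : ℂ) := by
    rw [Complex.ofReal_cpow ht.1.le]; push_cast; ring_nf
  have e2 : (1 - (t : ℂ)) ^ ((y : ℂ) - 1) = (((1 - t) ^ (y - 1) : ℝ) : ℂ) := by
    rw [Complex.ofReal_cpow (by linarith [ht.2])]; push_cast; ring_nf
  simp only [e1, e2, ← Complex.ofReal_mul]
  simp

theorem integral_beta {x y : ℝ} (hx : 0 < x) (hy : 0 < y) :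
    ∫ t in Set.Ioo (0 : ℝ) 1, t ^ (x - 1) * (1 - t) ^ (y - 1)
      = Real.Gamma x * Real.Gamma y / Real.Gamma (x + y) := by
  have h := Complex.betaIntegral_eq_Gamma_mul_div (u := x) (v := y) (by simpa) (by simpa)
  rw [Complex.betaIntegral, intervalIntegral.integral_of_le zero_le_one,
    integral_Ioc_eq_integral_Ioo] at h
  have e : ∫ t in Set.Ioo (0 : ℝ) 1, (t : ℂ) ^ ((x : ℂ) - 1) * (1 - (t : ℂ)) ^ ((y : ℂ) - 1)
      = ∫ t in Set.Ioo (0 : ℝ) 1, ((t ^ (x - 1) * (1 - t) ^ (y - 1) : ℝ) : ℂ) := by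
    refine setIntegral_congr_fun measurableSet_Ioo fun t ht => ?_
    have e1 : ((t : ℂ)) ^ ((x : ℂ) - 1) = ((t ^ (x - 1) : ℝ) : ℂ) := by
      rw [Complex.ofReal_cpow ht.1.le]; push_cast; ring_nf
    have e2 : (1 - (t : ℂ)) ^ ((y : ℂ) - 1) = (((1 - t) ^ (y - 1) : ℝ) : ℂ) := by
      rw [Complex.ofReal_cpow (by linarith [ht.2])]; push_cast; ring_nf
    simp only [e1, e2, ← Complex.ofReal_mul]
  rw [e, integral_complex_ofReal, ← Complex.ofReal_add, Complex.Gamma_ofReal, Complex.Gamma_ofReal,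
    Complex.Gamma_ofReal] at h
  exact_mod_cast h

theorem Gamma_add_nat {b : ℝ} (hb : 0 < b) (n : ℕ) :
    Real.Gamma (b + n) = (ascPochhammer ℝ n).eval b * Real.Gamma b := by
  induction n with
  | zero => simp
  | succ n ih =>
    rw [Nat.cast_succ, ← add_assoc, Real.Gamma_add_one (by positivity), ih, ascPochhammer_succ_eval]
    ring

/-- Gauss's theorem: expand `(1 - t)^(-a)` inside Euler's beta integral and integrate term by term.
-/
theorem hasSum_hgCoeff {a b c : ℝ} (ha : 0 < a) (hb : 0 < b) (habc : 0 < c - a - b) :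
    HasSum (hgCoeff a b c)
      (Real.Gamma c * Real.Gamma (c - a - b) / (Real.Gamma (c - a) * Real.Gamma (c - b))) := by
  have hcb : 0 < c - b := by linarith
  have hc : 0 < c := by linarith
  set F : ℕ → ℝ → ℝ := fun n t =>
    (ascPochhammer ℝ n).eval a / n.factorial * t ^ n * (t ^ (b - 1) * (1 - t) ^ (c - b - 1))
  have hF0 : ∀ n t, t ∈ Set.Ioo (0 : ℝ) 1 → 0 ≤ F n t := fun n t ht => by
    have h1 := ascPochhammer_eval_pos ha n
    have h2 : 0 < 1 - t := by linarith [ht.2]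
    have h3 := ht.1
    simp only [F]; positivity
  have hFs : ∀ t, t ∈ Set.Ioo (0 : ℝ) 1 →
      HasSum (fun n => F n t) (t ^ (b - 1) * (1 - t) ^ (c - a - b - 1)) := fun t ht => by
    have h := (hasSum_one_sub_rpow (a := a) ht.1.le ht.2).mul_right
      (t ^ (b - 1) * (1 - t) ^ (c - b - 1))
    convert! h using 1
    rw [mul_left_comm, ← Real.rpow_add (by linarith [ht.2])]
    ring_nf
  have hmem : ∀ᵐ t ∂(volume.restrict (Set.Ioo (0 : ℝ) 1)), t ∈ Set.Ioo (0 : ℝ) 1 :=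
    ae_restrict_mem measurableSet_Ioo
  -- Because `a > 0` every term is nonnegative, so the terms serve as their own dominating
  -- functions; their sum is an integrable beta density.
  have key := hasSum_integral_of_dominated_convergence (μ := volume.restrict (Set.Ioo (0 : ℝ) 1))
    (F := F) (f := fun t => t ^ (b - 1) * (1 - t) ^ (c - a - b - 1)) F
    (fun n => by
      have : Measurable (F n) := by fun_prop
      exact this.aestronglyMeasurable)
    (fun n => by
      filter_upwards [hmem] with t ht
      rw [Real.norm_of_nonneg (hF0 n t ht)])
    (by filter_upwards [hmem] with t ht using (hFs t ht).summable)
    ((integrableOn_beta hb habc).congr (by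
      filter_upwards [hmem] with t ht using (hFs t ht).tsum_eq.symm))
    (by filter_upwards [hmem] with t ht using hFs t ht)
  rw [integral_beta hb habc] at key
  have hFn : ∀ n, ∫ t in Set.Ioo (0 : ℝ) 1, F n t
      = hgCoeff a b c n * (Real.Gamma b * Real.Gamma (c - b) / Real.Gamma c) := fun n => by
    have e : ∫ t in Set.Ioo (0 : ℝ) 1, F n t = (ascPochhammer ℝ n).eval a / n.factorial *
        ∫ t in Set.Ioo (0 : ℝ) 1, t ^ (b + n - 1) * (1 - t) ^ (c - b - 1) := by
      rw [← integral_const_mul]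
      refine setIntegral_congr_fun measurableSet_Ioo fun t ht => ?_
      have : t ^ (b + n - 1) = t ^ n * t ^ (b - 1) := by
        rw [← Real.rpow_natCast t n, ← Real.rpow_add ht.1]; ring_nf
      simp only [F, this]; ring
    rw [e, integral_beta (by positivity) hcb, show b + n + (c - b) = c + n by ring,
      Gamma_add_nat hb, Gamma_add_nat hc]
    have h1 := (ascPochhammer_eval_pos hc n).ne'
    have h2 := (Real.Gamma_pos_of_pos hc).ne'
    simp only [hgCoeff, ordinaryHypergeometricCoefficient]
    field_simp
  simp only [hFn] at key
  have hG1 := (Real.Gamma_pos_of_pos hb).ne'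
  have hG2 := (Real.Gamma_pos_of_pos hc).ne'
  have hG3 := (Real.Gamma_pos_of_pos hcb).ne'
  have hG4 := (Real.Gamma_pos_of_pos (show 0 < c - a by linarith)).ne'
  have key2 := key.mul_right (Real.Gamma b * Real.Gamma (c - b) / Real.Gamma c)⁻¹
  convert! key2 using 1
  · ext n; field_simp
  · rw [show b + (c - a - b) = c - a by ring]; field_simp

end

end B2

namespace B2

open Filter Topology MeasureTheory

noncomputable section

/-! ## The contiguous pair solving the first-order system -/

theorem tsum_natCast_mul_pow {T : ℕ → ℝ}
    (hT : ∀ r : ℝ, 0 ≤ r → r < 1 → Summable fun n => |T n| * r ^ n) {z : ℝ} (hz : |z| < 1) :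
    HasSum (fun n : ℕ => n * T n * z ^ n) (z * ∑' n : ℕ, (n + 1) * T (n + 1) * z ^ n) := by
  have hs : Summable fun n : ℕ => ((n : ℝ) + 1) * T (n + 1) * z ^ n := by
    refine Summable.of_norm ?_
    have := summable_natCast_mul_pow hT (abs_nonneg z) hz
    convert this using 2 with n
    rw [Real.norm_eq_abs, abs_mul, abs_mul, abs_pow, abs_of_nonneg (by positivity : (0 : ℝ) ≤ n + 1)]
  rw [← hasSum_nat_add_iff' 1]
  have h := hs.hasSum.mul_left z
  convert! h using 1
  · ext n; push_cast; ring
  · simp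

variable {a c : ℝ}

/-- The relation `b = a + c` splits `(b + n)/(c + n)` as `1 + a/(c + n)`. In the recursion for the
coefficients the first part reproduces the series itself, and the second is the series with `a` and
`c` raised by one. -/
theorem hasDerivAt_hyp_fst (hc : 0 < c) {z : ℝ} (hz : |z| < 1) :
    HasDerivAt (ordinaryHypergeometric a (a + c) c)
      ((a * ordinaryHypergeometric a (a + c) c z
        + a ^ 2 / c * ordinaryHypergeometric (a + 1) (a + c) (c + 1) z) / (1 - z)) z := by
  have hT : ∀ r : ℝ, 0 ≤ r → r < 1 → Summable fun n => |hgCoeff a (a + c) c n| * r ^ n :=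
    fun r h0 h1 => summable_hgCoeff_abs_mul_pow a (a + c) hc h0 h1
  have hT2 : ∀ r : ℝ, 0 ≤ r → r < 1 →
      Summable fun n => |hgCoeff (a + 1) (a + c) (c + 1) n| * r ^ n :=
    fun r h0 h1 => summable_hgCoeff_abs_mul_pow _ _ (by positivity) h0 h1
  have hd := hasDerivAt_tsum_mul_pow hT hz
  have e : (fun z => ∑' n, hgCoeff a (a + c) c n * z ^ n) = ordinaryHypergeometric a (a + c) c := by
    ext z; rw [ordinaryHypergeometric_eq]
  rw [e] at hd
  convert! hd using 1
  have h1 := tsum_natCast_mul_pow hT hz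
  have h2 := (summable_mul_pow hT hz).hasSum.mul_left a
  have h3 := (summable_mul_pow hT2 hz).hasSum.mul_left (a ^ 2 / c)
  have hz1 : 1 - z ≠ 0 := by linarith [(abs_lt.1 hz).2]
  rw [div_eq_iff hz1, ordinaryHypergeometric_eq, ordinaryHypergeometric_eq]
  have h4 := (h1.add h2).add h3
  have h5 : HasSum (fun n : ℕ => ((n : ℝ) + 1) * hgCoeff a (a + c) c (n + 1) * z ^ n)
      (z * ∑' n : ℕ, ((n : ℝ) + 1) * hgCoeff a (a + c) c (n + 1) * z ^ n
        + a * ∑' n, hgCoeff a (a + c) c n * z ^ n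
        + a ^ 2 / c * ∑' n, hgCoeff (a + 1) (a + c) (c + 1) n * z ^ n) := by
    convert! h4 using 1
    ext n
    have hcn : c + (n : ℝ) ≠ 0 := by positivity
    have g1 := hgCoeff_succ a (a + c) hc n
    have g2 : a * (c + n) * hgCoeff (a + 1) (a + c) (c + 1) n
        = c * (a + n) * hgCoeff a (a + c) c n := by
      have := hgCoeff_shift_left a (a + c) (c := c) n
      have := hgCoeff_shift_right (a + 1) (a + c) hc n
      grind
    have g3 : ((n : ℝ) + 1) * hgCoeff a (a + c) c (n + 1) = n * hgCoeff a (a + c) c n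
        + a * hgCoeff a (a + c) c n + a ^ 2 / c * hgCoeff (a + 1) (a + c) (c + 1) n := by
      have hq : a ^ 2 / c * c = a ^ 2 := by field_simp
      apply mul_left_cancel₀ (mul_ne_zero hc.ne' hcn)
      linear_combination c * g1 - a * g2 - (c + n) * hgCoeff (a + 1) (a + c) (c + 1) n * hq
    rw [g3]; ring
  have h6 := h5.tsum_eq
  linarith

/-- Companion of `hasDerivAt_hyp_fst`, closing the pair into a first-order system. The bound `-1 <
a` keeps `a + n + 1` nonzero, so that it can be cancelled from the coefficient identity. -/
theorem hasDerivAt_hyp_snd (ha : -1 < a) (hc : 0 < c) {z : ℝ} (hz : |z| < 1) (hz0 : z ≠ 0) :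
    HasDerivAt (ordinaryHypergeometric (a + 1) (a + c) (c + 1))
      (((c * ordinaryHypergeometric a (a + c) c z
        + a * z * ordinaryHypergeometric (a + 1) (a + c) (c + 1) z) / (1 - z)
        - c * ordinaryHypergeometric (a + 1) (a + c) (c + 1) z) / z) z := by
  have hT : ∀ r : ℝ, 0 ≤ r → r < 1 → Summable fun n => |hgCoeff a (a + c) c n| * r ^ n :=
    fun r h0 h1 => summable_hgCoeff_abs_mul_pow a (a + c) hc h0 h1
  have hT2 : ∀ r : ℝ, 0 ≤ r → r < 1 →
      Summable fun n => |hgCoeff (a + 1) (a + c) (c + 1) n| * r ^ n :=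
    fun r h0 h1 => summable_hgCoeff_abs_mul_pow _ _ (by positivity) h0 h1
  have hd := hasDerivAt_tsum_mul_pow hT2 hz
  have e : (fun z => ∑' n, hgCoeff (a + 1) (a + c) (c + 1) n * z ^ n)
      = ordinaryHypergeometric (a + 1) (a + c) (c + 1) := by
    ext z; rw [ordinaryHypergeometric_eq]
  rw [e] at hd
  convert! hd using 1
  have h1 := tsum_natCast_mul_pow hT2 hz
  have h2 := (summable_mul_pow hT2 hz).hasSum
  have h3 := (summable_mul_pow hT hz).hasSum.mul_left c
  have hz1 : 1 - z ≠ 0 := by linarith [(abs_lt.1 hz).2]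
  rw [div_eq_iff hz0, sub_eq_iff_eq_add, div_eq_iff hz1, ordinaryHypergeometric_eq,
    ordinaryHypergeometric_eq]
  have h4 := (h1.add (h2.mul_left c)).sub h3
  -- The constant terms cancel, both series starting with `1`, so the combination is divisible by
  -- `z`.
  rw [← hasSum_nat_add_iff' 1] at h4
  have h5 := (h1.add (h2.mul_left (c + a))).mul_left z
  have h6 : ∀ n : ℕ, ((n : ℝ) + 1 + c) * hgCoeff (a + 1) (a + c) (c + 1) (n + 1)
      - c * hgCoeff a (a + c) c (n + 1) = (n + c + a) * hgCoeff (a + 1) (a + c) (c + 1) n := by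
    intro n
    have han : a + ((n + 1 : ℕ) : ℝ) ≠ 0 := by
      have : (0 : ℝ) ≤ n := n.cast_nonneg
      push_cast; linarith
    have g1 := hgCoeff_succ (a + 1) (a + c) (c := c + 1) (by positivity) n
    have g2 : a * (c + (n + 1 : ℕ)) * hgCoeff (a + 1) (a + c) (c + 1) (n + 1)
        = c * (a + (n + 1 : ℕ)) * hgCoeff a (a + c) c (n + 1) := by
      have := hgCoeff_shift_left a (a + c) (c := c) (n + 1)
      have := hgCoeff_shift_right (a + 1) (a + c) hc (n + 1)
      grind
    apply mul_left_cancel₀ han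
    push_cast at g2 ⊢
    linear_combination g1 + g2
  have h7 := h4.unique (by
    convert! h5 using 1
    ext n
    have := h6 n
    push_cast
    linear_combination z ^ (n + 1) * this)
  simp [hgCoeff_zero] at h7
  linear_combination -h7

end

end B2

namespace B2

open Filter Topology MeasureTheory

noncomputable section

/-! ## The rows of the matrix `L` -/

/-- The open square of admissible multiplicities. -/
def Adm (k₀ k₁ : ℝ) : Prop := |k₀| + |k₁| < 1 / 2

/-- The upper left entry of `L`. -/
def rowA (k₀ k₁ u : ℝ) : ℝ :=
  u ^ k₁ * (1 - u ^ 2) ^ (-k₀) *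
    ordinaryHypergeometric (-k₀) (1 / 2 - k₀ + k₁) (k₁ + 1 / 2) (u ^ 2)

/-- The upper right entry of `L`. -/
def rowB (k₀ k₁ u : ℝ) : ℝ :=
  -(k₀ / (k₁ + 1 / 2)) * u ^ k₁ * (1 - u ^ 2) ^ (-k₀) * u *
    ordinaryHypergeometric (1 - k₀) (1 / 2 - k₀ + k₁) (k₁ + 3 / 2) (u ^ 2)

variable {k₀ k₁ : ℝ}

theorem Adm.neg_left (h : Adm k₀ k₁) : Adm (-k₀) k₁ := by simpa [Adm] using h

theorem Adm.neg_right (h : Adm k₀ k₁) : Adm k₀ (-k₁) := by simpa [Adm] using h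

theorem Adm.bounds (h : Adm k₀ k₁) : -(1 / 2) < k₀ + k₁ ∧ k₀ + k₁ < 1 / 2 ∧
    -(1 / 2) < k₀ - k₁ ∧ k₀ - k₁ < 1 / 2 ∧ -(1 / 2) < k₀ ∧ k₀ < 1 / 2 ∧ -(1 / 2) < k₁ ∧
    k₁ < 1 / 2 := by
  unfold Adm at h
  have := neg_abs_le k₀
  have := neg_abs_le k₁
  have := le_abs_self k₀
  have := le_abs_self k₁
  have := abs_nonneg k₀
  have := abs_nonneg k₁
  refine ⟨?_, ?_, ?_, ?_, ?_, ?_, ?_, ?_⟩ <;> linarith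

theorem adm_of_bounds (h₁ : -(1 / 2) < k₀ + k₁) (h₂ : k₀ + k₁ < 1 / 2)
    (h₃ : -(1 / 2) < k₀ - k₁) (h₄ : k₀ - k₁ < 1 / 2) : Adm k₀ k₁ := by
  unfold Adm
  rcases abs_cases k₀ with ⟨h, _⟩ | ⟨h, _⟩ <;> rcases abs_cases k₁ with ⟨h', _⟩ | ⟨h', _⟩ <;>
    rw [h, h'] <;> linarith

/-- Exhibits the parameters in the form `b = a + c`, with `a = -k₀` and `c = k₁ + 1/2`. -/
theorem rowA_eq (k₀ k₁ u : ℝ) : rowA k₀ k₁ u = u ^ k₁ * (1 - u ^ 2) ^ (-k₀) *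
    ordinaryHypergeometric (-k₀) (-k₀ + (k₁ + 1 / 2)) (k₁ + 1 / 2) (u ^ 2) := by
  rw [rowA, show 1 / 2 - k₀ + k₁ = -k₀ + (k₁ + 1 / 2) by ring]

theorem rowB_eq (k₀ k₁ u : ℝ) : rowB k₀ k₁ u =
    -(k₀ / (k₁ + 1 / 2)) * (u ^ k₁ * (1 - u ^ 2) ^ (-k₀)) * (u *
    ordinaryHypergeometric (-k₀ + 1) (-k₀ + (k₁ + 1 / 2)) (k₁ + 1 / 2 + 1) (u ^ 2)) := by
  rw [rowB, show 1 / 2 - k₀ + k₁ = -k₀ + (k₁ + 1 / 2) by ring, show 1 - k₀ = -k₀ + 1 by ring,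
    show k₁ + 3 / 2 = k₁ + 1 / 2 + 1 by ring]
  ring

theorem sq_mem {u : ℝ} (h0 : 0 < u) (h1 : u < 1) : |u ^ 2| < 1 ∧ 0 < 1 - u ^ 2 ∧ 0 < u ^ 2 := by
  have : u ^ 2 < 1 := by nlinarith
  refine ⟨by rw [abs_of_pos (by positivity)]; exact this, by linarith, by positivity⟩

theorem hasDerivAt_prefactor (k₀ k₁ : ℝ) {u : ℝ} (h0 : 0 < u) (h1 : u < 1) :
    HasDerivAt (fun u : ℝ => u ^ k₁ * (1 - u ^ 2) ^ (-k₀))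
      ((k₁ / u + 2 * k₀ * u / (1 - u ^ 2)) * (u ^ k₁ * (1 - u ^ 2) ^ (-k₀))) u := by
  obtain ⟨-, h2, -⟩ := sq_mem h0 h1
  have e1 := Real.hasDerivAt_rpow_const (x := u) (p := k₁) (Or.inl h0.ne')
  have e2 : HasDerivAt (fun u : ℝ => 1 - u ^ 2) (-(2 * u)) u := by
    simpa using (hasDerivAt_pow 2 u).const_sub 1
  have e3 := e1.mul (e2.rpow_const (p := -k₀) (Or.inl h2.ne'))
  convert! e3 using 1
  rw [Real.rpow_sub_one h0.ne', Real.rpow_sub_one h2.ne']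
  field_simp

/-- The factor `(1 - u²)^(-k₀)` contributes `2k₀u/(1 - u²)` to the logarithmic derivative, which
cancels the diagonal term in the derivative of the series. What remains of that derivative is a
multiple of `rowB`. -/
theorem hasDerivAt_rowA (h : Adm k₀ k₁) {u : ℝ} (h0 : 0 < u) (h1 : u < 1) :
    HasDerivAt (rowA k₀ k₁) (k₁ / u * rowA k₀ k₁ u - 2 * k₀ / (1 - u ^ 2) * rowB k₀ k₁ u) u := by
  obtain ⟨h3, h2, -⟩ := sq_mem h0 h1
  have hc : 0 < k₁ + 1 / 2 := by linarith [h.bounds.2.2.2.2.2.2.1]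
  have e1 := hasDerivAt_prefactor k₀ k₁ h0 h1
  have e2 := HasDerivAt.comp (h := fun u : ℝ => u ^ 2) u (hasDerivAt_hyp_fst (a := -k₀) hc h3)
    (hasDerivAt_pow 2 u)
  have e3 := e1.mul e2
  rw [rowA_eq, rowB_eq]
  convert! e3 using 1
  · ext u; rw [rowA_eq]; rfl
  · simp only [Function.comp]
    field_simp
    push_cast
    ring

theorem hasDerivAt_rowB (h : Adm k₀ k₁) {u : ℝ} (h0 : 0 < u) (h1 : u < 1) :
    HasDerivAt (rowB k₀ k₁)
      (-(2 * k₀ / (1 - u ^ 2)) * rowA k₀ k₁ u - k₁ / u * rowB k₀ k₁ u) u := by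
  obtain ⟨h3, h2, h4⟩ := sq_mem h0 h1
  have hc : 0 < k₁ + 1 / 2 := by linarith [h.bounds.2.2.2.2.2.2.1]
  have ha : -1 < -k₀ := by linarith [h.bounds.2.2.2.2.2.1]
  have e1 := hasDerivAt_prefactor k₀ k₁ h0 h1
  have e2 := HasDerivAt.comp (h := fun u : ℝ => u ^ 2) u (hasDerivAt_hyp_snd ha hc h3 h4.ne')
    (hasDerivAt_pow 2 u)
  have e3 := (e1.const_mul (-(k₀ / (k₁ + 1 / 2)))).mul ((hasDerivAt_id u).mul e2)
  rw [rowA_eq, rowB_eq]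
  convert! e3 using 1
  · ext u; rw [rowB_eq]; rfl
  · simp only [Function.comp, id, Pi.mul_apply]
    generalize ordinaryHypergeometric (-k₀) (-k₀ + (k₁ + 1 / 2)) (k₁ + 1 / 2) (u ^ 2) = f₁
    generalize ordinaryHypergeometric (-k₀ + 1) (-k₀ + (k₁ + 1 / 2)) (k₁ + 1 / 2 + 1) (u ^ 2) = f₂
    generalize u ^ k₁ * (1 - u ^ 2) ^ (-k₀) = w
    generalize hC : k₁ + 1 / 2 = C at *
    obtain rfl : k₁ = C - 1 / 2 := by linarith
    push_cast
    field_simp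
    ring

/-! ### Behaviour of the rows at `u = 0` and the symmetry `k₀ ↦ -k₀`. -/

theorem eq_of_deriv_eq_zero_of_tendsto {f : ℝ → ℝ} {l : ℝ}
    (hf : ∀ u, 0 < u → u < 1 → HasDerivAt f 0 u) (hl : Tendsto f (𝓝[>] 0) (𝓝 l)) {u : ℝ}
    (h0 : 0 < u) (h1 : u < 1) : f u = l := by
  have hc : ∀ v ∈ Set.Ioo (0 : ℝ) 1, f v = f u := fun v hv =>
    isOpen_Ioo.is_const_of_deriv_eq_zero isPreconnected_Ioo
      (fun x hx => (hf x hx.1 hx.2).differentiableAt.differentiableWithinAt)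
      (fun x hx => (hf x hx.1 hx.2).deriv) hv ⟨h0, h1⟩
  refine tendsto_nhds_unique (tendsto_const_nhds.congr' ?_) hl
  filter_upwards [Ioo_mem_nhdsGT one_pos] with v hv using (hc v hv).symm

theorem continuousAt_hyp_zero (a b : ℝ) {c : ℝ} (hc : 0 < c) :
    Tendsto (fun u : ℝ => ordinaryHypergeometric a b c (u ^ 2)) (𝓝[>] 0) (𝓝 1) := by
  have hd := (hasDerivAt_tsum_mul_pow
    (fun r h0 h1 => summable_hgCoeff_abs_mul_pow a b hc h0 h1) (z := 0) (by simp)).continuousAt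
  have e : (fun z => ∑' n, hgCoeff a b c n * z ^ n) = ordinaryHypergeometric a b c := by
    ext z; rw [ordinaryHypergeometric_eq]
  rw [e] at hd
  have h1 := hd.tendsto
  rw [ordinaryHypergeometric_zero] at h1
  refine h1.comp (Tendsto.mono_left ?_ nhdsWithin_le_nhds)
  have := (continuous_pow (M := ℝ) 2).tendsto 0
  simpa using this

theorem tendsto_one_sub_sq_rpow (p : ℝ) :
    Tendsto (fun u : ℝ => (1 - u ^ 2) ^ p) (𝓝[>] 0) (𝓝 1) := by
  have h : ContinuousAt (fun u : ℝ => (1 - u ^ 2) ^ p) 0 :=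
    ContinuousAt.rpow_const (by fun_prop) (Or.inl (by norm_num))
  have := h.tendsto
  simp only [ne_eq, OfNat.ofNat_ne_zero, not_false_eq_true, zero_pow, sub_zero,
    Real.one_rpow] at this
  exact this.mono_left nhdsWithin_le_nhds

theorem tendsto_rowA_mul_rpow (h : Adm k₀ k₁) :
    Tendsto (fun u => rowA k₀ k₁ u * u ^ (-k₁)) (𝓝[>] 0) (𝓝 1) := by
  have hc : 0 < k₁ + 1 / 2 := by linarith [h.bounds.2.2.2.2.2.2.1]
  have h1 := (tendsto_one_sub_sq_rpow (-k₀)).mul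
    (continuousAt_hyp_zero (-k₀) (1 / 2 - k₀ + k₁) hc)
  rw [one_mul] at h1
  refine h1.congr' ?_
  filter_upwards [self_mem_nhdsWithin] with u hu
  have : u ^ k₁ * u ^ (-k₁) = 1 := by
    rw [← Real.rpow_add hu, add_neg_cancel, Real.rpow_zero]
  rw [rowA]
  linear_combination -((1 - u ^ 2) ^ (-k₀) *
    ordinaryHypergeometric (-k₀) (1 / 2 - k₀ + k₁) (k₁ + 1 / 2) (u ^ 2)) * this

theorem tendsto_rowB_mul_rpow (h : Adm k₀ k₁) :
    Tendsto (fun u => rowB k₀ k₁ u * u ^ (-k₁) * u⁻¹) (𝓝[>] 0) (𝓝 (-(k₀ / (k₁ + 1 / 2)))) := by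
  have hc : 0 < k₁ + 3 / 2 := by linarith [h.bounds.2.2.2.2.2.2.1]
  have h1 := ((tendsto_one_sub_sq_rpow (-k₀)).mul
    (continuousAt_hyp_zero (1 - k₀) (1 / 2 - k₀ + k₁) hc)).const_mul (-(k₀ / (k₁ + 1 / 2)))
  rw [one_mul, mul_one] at h1
  refine h1.congr' ?_
  filter_upwards [self_mem_nhdsWithin] with u hu
  have h2 : u ^ k₁ * u ^ (-k₁) = 1 := by
    rw [← Real.rpow_add hu, add_neg_cancel, Real.rpow_zero]
  have h3 : u * u⁻¹ = 1 := mul_inv_cancel₀ (ne_of_gt hu)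
  rw [rowB]
  generalize ordinaryHypergeometric (1 - k₀) (1 / 2 - k₀ + k₁) (k₁ + 3 / 2) (u ^ 2) = f
  linear_combination (k₀ / (k₁ + 1 / 2) * (1 - u ^ 2) ^ (-k₀) * f) * (h2 * u * u⁻¹ + h3)

/-- For `k₀ < 0` all Taylor coefficients are positive; for `k₀ = 0` the series reduces to `1`. The
other sign of `k₀` follows from the symmetry below. -/
theorem rowA_pos_of_nonpos (h : Adm k₀ k₁) (hk : k₀ ≤ 0) {u : ℝ} (h0 : 0 < u) (h1 : u < 1) :
    0 < rowA k₀ k₁ u := by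
  obtain ⟨h3, h2, h4⟩ := sq_mem h0 h1
  obtain ⟨b1, b2, b3, b4, b5, b6, b7, b8⟩ := h.bounds
  have hc : 0 < k₁ + 1 / 2 := by linarith
  have hb : 0 < 1 / 2 - k₀ + k₁ := by linarith
  have hF : 0 < ordinaryHypergeometric (-k₀) (1 / 2 - k₀ + k₁) (k₁ + 1 / 2) (u ^ 2) := by
    rcases hk.eq_or_lt with rfl | hk
    · rw [ordinaryHypergeometric_eq, tsum_eq_single 0]
      · simp [hgCoeff_zero]
      · intro n hn
        simp [hgCoeff, ordinaryHypergeometricCoefficient, hn]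
    · rw [ordinaryHypergeometric_eq]
      have hs := summable_mul_pow (fun r h0 h1 => summable_hgCoeff_abs_mul_pow (-k₀)
        (1 / 2 - k₀ + k₁) hc h0 h1) h3
      refine hs.tsum_pos (fun n => ?_) 0 (by simp [hgCoeff_zero])
      have := hgCoeff_pos (neg_pos.2 hk) hb hc n
      positivity
  have := Real.rpow_pos_of_pos h0 k₁
  have := Real.rpow_pos_of_pos h2 (-k₀)
  unfold rowA
  positivity

/-- Euler's transformation, obtained from uniqueness for the system. Changing the signs of `k₀` and
`rowB` together preserves the equations, so the Wronskian of the two solutions is constant; it is of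
order `u^(2k₁+1)` at `0`, hence zero. The quotient of the two `rowA` is then constant and tends to
`1`. The sign condition makes the denominator positive. -/
theorem row_neg_left_of_nonpos (h : Adm k₀ k₁) (hk : k₀ ≤ 0) {u : ℝ} (h0 : 0 < u) (h1 : u < 1) :
    rowA (-k₀) k₁ u = rowA k₀ k₁ u ∧ rowB (-k₀) k₁ u = -rowB k₀ k₁ u := by
  have hW : ∀ u, 0 < u → u < 1 →
      rowA (-k₀) k₁ u * rowB k₀ k₁ u + rowB (-k₀) k₁ u * rowA k₀ k₁ u = 0 := by
    intro u h0 h1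
    refine eq_of_deriv_eq_zero_of_tendsto (f := fun u => rowA (-k₀) k₁ u * rowB k₀ k₁ u
      + rowB (-k₀) k₁ u * rowA k₀ k₁ u) (fun u h0 h1 => ?_) ?_ h0 h1
    · have := ((hasDerivAt_rowA h.neg_left h0 h1).mul (hasDerivAt_rowB h h0 h1)).add
        ((hasDerivAt_rowB h.neg_left h0 h1).mul (hasDerivAt_rowA h h0 h1))
      convert! this using 1
      ring
    · have hp : Tendsto (fun u : ℝ => u ^ (2 * k₁ + 1)) (𝓝[>] 0) (𝓝 0) := by
        have hk1 : 0 < 2 * k₁ + 1 := by linarith [h.bounds.2.2.2.2.2.2.1]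
        have := (Real.continuousAt_rpow_const 0 (2 * k₁ + 1) (Or.inr hk1.le)).tendsto
        rw [Real.zero_rpow hk1.ne'] at this
        exact this.mono_left nhdsWithin_le_nhds
      have hl := hp.mul (((tendsto_rowA_mul_rpow h.neg_left).mul (tendsto_rowB_mul_rpow h)).add
        ((tendsto_rowB_mul_rpow h.neg_left).mul (tendsto_rowA_mul_rpow h)))
      rw [zero_mul] at hl
      refine hl.congr' ?_
      filter_upwards [self_mem_nhdsWithin] with u hu
      have h2 : u ^ (2 * k₁ + 1) * (u ^ (-k₁) * u ^ (-k₁) * u⁻¹) = 1 := by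
        rw [← Real.rpow_neg_one u, ← Real.rpow_add hu, ← Real.rpow_add hu, ← Real.rpow_add hu]
        ring_nf
        exact Real.rpow_zero u
      linear_combination (rowA (-k₀) k₁ u * rowB k₀ k₁ u
        + rowB (-k₀) k₁ u * rowA k₀ k₁ u) * h2
  have hA : rowA (-k₀) k₁ u / rowA k₀ k₁ u = 1 := by
    refine eq_of_deriv_eq_zero_of_tendsto (f := fun u => rowA (-k₀) k₁ u / rowA k₀ k₁ u)
      (fun u h0 h1 => ?_) ?_ h0 h1
    · have hp := (rowA_pos_of_nonpos h hk h0 h1).ne'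
      have := (hasDerivAt_rowA h.neg_left h0 h1).div (hasDerivAt_rowA h h0 h1) hp
      convert! this using 1
      rw [eq_comm, div_eq_zero_iff]
      left
      linear_combination 2 * k₀ / (1 - u ^ 2) * hW u h0 h1
    · have hl := (tendsto_rowA_mul_rpow h.neg_left).div (tendsto_rowA_mul_rpow h) one_ne_zero
      rw [div_one] at hl
      refine hl.congr' ?_
      filter_upwards [self_mem_nhdsWithin] with u hu
      have : u ^ (-k₁) ≠ 0 := (Real.rpow_pos_of_pos hu _).ne'
      rw [Pi.div_apply, mul_div_mul_right _ _ this]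
  have hp := (rowA_pos_of_nonpos h hk h0 h1).ne'
  have hA' : rowA (-k₀) k₁ u = rowA k₀ k₁ u := by
    rw [div_eq_one_iff_eq hp] at hA; exact hA
  refine ⟨hA', ?_⟩
  have := hW u h0 h1
  rw [hA'] at this
  apply mul_left_cancel₀ hp
  linear_combination this

theorem row_neg_left (h : Adm k₀ k₁) {u : ℝ} (h0 : 0 < u) (h1 : u < 1) :
    rowA (-k₀) k₁ u = rowA k₀ k₁ u ∧ rowB (-k₀) k₁ u = -rowB k₀ k₁ u := by
  rcases le_total k₀ 0 with hk | hk
  · exact row_neg_left_of_nonpos h hk h0 h1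
  · have := row_neg_left_of_nonpos h.neg_left (by linarith) h0 h1
    rw [neg_neg] at this
    exact ⟨this.1.symm, by rw [this.2, neg_neg]⟩

theorem rowA_pos (h : Adm k₀ k₁) {u : ℝ} (h0 : 0 < u) (h1 : u < 1) : 0 < rowA k₀ k₁ u := by
  rcases le_total k₀ 0 with hk | hk
  · exact rowA_pos_of_nonpos h hk h0 h1
  · rw [← (row_neg_left h h0 h1).1]
    exact rowA_pos_of_nonpos h.neg_left (by linarith) h0 h1

/-! ### Growth of the rows at `u = 1`. -/

theorem summable_hyp_snd (h : Adm k₀ k₁) (hk : 0 < k₀) :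
    HasSum (hgCoeff (1 - k₀) (1 / 2 - k₀ + k₁) (k₁ + 3 / 2))
      (Real.Gamma (k₁ + 3 / 2) * Real.Gamma (2 * k₀) /
        (Real.Gamma (k₁ + 1 / 2 + k₀) * Real.Gamma (1 + k₀))) := by
  obtain ⟨b1, b2, b3, b4, b5, b6, b7, b8⟩ := h.bounds
  have := hasSum_hgCoeff (a := 1 - k₀) (b := 1 / 2 - k₀ + k₁) (c := k₁ + 3 / 2) (by linarith)
    (by linarith) (by linarith)
  convert! this using 3 <;> ring_nf

/-- Here `a = -k₀` is negative, so Gauss's theorem in the form above does not apply. The contiguous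
relation bounds each coefficient from index `1` on by a constant times the corresponding positive
coefficient of `summable_hyp_snd`. -/
theorem summable_abs_hyp_fst (h : Adm k₀ k₁) (hk : 0 < k₀) :
    Summable fun n => |hgCoeff (-k₀) (1 / 2 - k₀ + k₁) (k₁ + 1 / 2) n| := by
  obtain ⟨b1, b2, b3, b4, b5, b6, b7, b8⟩ := h.bounds
  have hc : 0 < k₁ + 1 / 2 := by linarith
  have h2 := (summable_hyp_snd h hk).summable
  rw [← summable_nat_add_iff 1] at h2 ⊢
  refine Summable.of_nonneg_of_le (fun _ => abs_nonneg _) (fun n => ?_)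
    (h2.mul_left (2 * (k₀ / (k₁ + 1 / 2) * (k₁ + 3 / 2))))
  set m : ℝ := ((n + 1 : ℕ) : ℝ) with hm
  have hm1 : 1 ≤ m := by rw [hm]; push_cast; linarith [(n.cast_nonneg : (0 : ℝ) ≤ n)]
  have g1 := hgCoeff_shift_left (-k₀) (1 / 2 - k₀ + k₁) (c := k₁ + 1 / 2) (n + 1)
  have g2 := hgCoeff_shift_right (-k₀ + 1) (1 / 2 - k₀ + k₁) hc (n + 1)
  rw [show -k₀ + 1 = 1 - k₀ by ring] at g1 g2
  rw [show k₁ + 1 / 2 + 1 = k₁ + 3 / 2 by ring] at g2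
  have hp := hgCoeff_pos (a := 1 - k₀) (b := 1 / 2 - k₀ + k₁) (c := k₁ + 3 / 2) (by linarith)
    (by linarith) (by linarith) (n + 1)
  rw [← hm] at g1 g2
  set T₁ := hgCoeff (-k₀) (1 / 2 - k₀ + k₁) (k₁ + 1 / 2) (n + 1)
  set T₂ := hgCoeff (1 - k₀) (1 / 2 - k₀ + k₁) (k₁ + 3 / 2) (n + 1)
  set S := hgCoeff (1 - k₀) (1 / 2 - k₀ + k₁) (k₁ + 1 / 2) (n + 1)
  have hmk : 0 < m - k₀ := by linarith
  have e : T₁ = -(k₀ / (k₁ + 1 / 2) * ((k₁ + 1 / 2 + m) / (m - k₀)) * T₂) := by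
    field_simp
    field_simp at g2
    grind
  -- For `m ≥ 1` one has `k₁ + 1/2 + m ≤ (k₁ + 3/2) m`, and `k₀ < 1/2` gives `m - k₀ ≥ m/2`.
  have hq : (k₁ + 1 / 2 + m) / (m - k₀) ≤ 2 * (k₁ + 3 / 2) := by
    rw [div_le_iff₀ hmk]; nlinarith
  rw [e, abs_neg, abs_of_nonneg (by positivity)]
  calc k₀ / (k₁ + 1 / 2) * ((k₁ + 1 / 2 + m) / (m - k₀)) * T₂
      ≤ k₀ / (k₁ + 1 / 2) * (2 * (k₁ + 3 / 2)) * T₂ := by gcongr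
    _ = _ := by ring

theorem exists_row_bound_of_pos (h : Adm k₀ k₁) (hk : 0 < k₀) : ∃ C, 0 ≤ C ∧ ∀ u, 0 < u → u < 1 →
    |rowA k₀ k₁ u| ≤ C * u ^ k₁ * (1 - u ^ 2) ^ (-k₀) ∧
    |rowB k₀ k₁ u| ≤ C * u ^ k₁ * u * (1 - u ^ 2) ^ (-k₀) := by
  have s1 := summable_abs_hyp_fst h hk
  have s2 := (summable_hyp_snd h hk).summable.abs
  set C₁ := ∑' n, |hgCoeff (-k₀) (1 / 2 - k₀ + k₁) (k₁ + 1 / 2) n|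
  set C₂ := ∑' n, |hgCoeff (1 - k₀) (1 / 2 - k₀ + k₁) (k₁ + 3 / 2) n|
  have hC₁ : 0 ≤ C₁ := tsum_nonneg fun _ => abs_nonneg _
  have hC₂ : 0 ≤ C₂ := tsum_nonneg fun _ => abs_nonneg _
  refine ⟨max C₁ (|k₀ / (k₁ + 1 / 2)| * C₂), le_max_of_le_left hC₁, fun u h0 h1 => ?_⟩
  obtain ⟨h3, h2, h4⟩ := sq_mem h0 h1
  have p1 := (Real.rpow_pos_of_pos h0 k₁).le
  have p2 := (Real.rpow_pos_of_pos h2 (-k₀)).le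
  have f1 := abs_tsum_mul_pow_le s1 h3.le
  have f2 := abs_tsum_mul_pow_le s2 h3.le
  constructor
  · rw [rowA, ordinaryHypergeometric_eq, abs_mul, abs_of_nonneg (by positivity)]
    calc u ^ k₁ * (1 - u ^ 2) ^ (-k₀) * _ ≤ u ^ k₁ * (1 - u ^ 2) ^ (-k₀) * C₁ := by gcongr
      _ ≤ u ^ k₁ * (1 - u ^ 2) ^ (-k₀) * max C₁ (|k₀ / (k₁ + 1 / 2)| * C₂) := by
        gcongr; exact le_max_left _ _
      _ = _ := by ring
  · rw [rowB, ordinaryHypergeometric_eq, abs_mul, abs_mul, abs_mul, abs_mul, abs_neg,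
      abs_of_nonneg p1, abs_of_nonneg p2, abs_of_pos h0]
    calc _ ≤ |k₀ / (k₁ + 1 / 2)| * u ^ k₁ * (1 - u ^ 2) ^ (-k₀) * u * C₂ := by gcongr
      _ = (|k₀ / (k₁ + 1 / 2)| * C₂) * u ^ k₁ * u * (1 - u ^ 2) ^ (-k₀) := by ring
      _ ≤ _ := by gcongr; exact le_max_right _ _

theorem rowA_zero_left (k₁ : ℝ) {u : ℝ} : rowA 0 k₁ u = u ^ k₁ := by
  rw [rowA, neg_zero, Real.rpow_zero, ordinaryHypergeometric_eq, tsum_eq_single 0]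
  · simp [hgCoeff_zero]
  · intro n hn
    simp [hgCoeff, ordinaryHypergeometricCoefficient, hn]

theorem rowB_zero_left (k₁ : ℝ) {u : ℝ} : rowB 0 k₁ u = 0 := by simp [rowB]

/-- The exponent is `-|k₀|` for either sign: a negative `k₀` is replaced by `-k₀`, which changes
only the sign of `rowB`. -/
theorem exists_row_bound (h : Adm k₀ k₁) : ∃ C, 0 ≤ C ∧ ∀ u, 0 < u → u < 1 →
    |rowA k₀ k₁ u| ≤ C * u ^ k₁ * (1 - u ^ 2) ^ (-|k₀|) ∧
    |rowB k₀ k₁ u| ≤ C * u ^ k₁ * u * (1 - u ^ 2) ^ (-|k₀|) := by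
  rcases lt_trichotomy k₀ 0 with hk | rfl | hk
  · obtain ⟨C, hC, hb⟩ := exists_row_bound_of_pos h.neg_left (neg_pos.2 hk)
    refine ⟨C, hC, fun u h0 h1 => ?_⟩
    have := hb u h0 h1
    rw [(row_neg_left h h0 h1).1, (row_neg_left h h0 h1).2, abs_neg] at this
    rwa [abs_of_neg hk]
  · refine ⟨1, zero_le_one, fun u h0 h1 => ?_⟩
    have := (Real.rpow_pos_of_pos h0 k₁).le
    simp only [rowA_zero_left, rowB_zero_left, abs_zero, neg_zero, Real.rpow_zero, mul_one, one_mul]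
    exact ⟨(abs_of_nonneg this).le, by positivity⟩
  · rw [abs_of_pos hk]
    exact exists_row_bound_of_pos h hk

end

end B2

namespace B2

open Filter Topology MeasureTheory

noncomputable section

variable {k₀ k₁ : ℝ}

/-! ## The connection coefficients at `u = 1` -/

theorem tendsto_sq_left_one : Tendsto (fun u : ℝ => u ^ 2) (𝓝[<] 1) (𝓝 1) := by
  have := (continuous_pow (M := ℝ) 2).tendsto 1
  rw [one_pow] at this
  exact this.mono_left nhdsWithin_le_nhds

theorem eventually_Ioo_left_one : ∀ᶠ u : ℝ in 𝓝[<] 1, 0 < u ∧ u < 1 := by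
  filter_upwards [Ioo_mem_nhdsLT (zero_lt_one' ℝ)] with u hu using hu

theorem tendsto_hyp_left_one {a b c l : ℝ} (h : HasSum (hgCoeff a b c) l) :
    Tendsto (fun u : ℝ => ordinaryHypergeometric a b c (u ^ 2)) (𝓝[<] 1) (𝓝 l) := by
  have := tendsto_tsum_mul_pow (T := hgCoeff a b c) (g := fun u => u ^ 2) h.summable.abs
    tendsto_sq_left_one (by
      filter_upwards [eventually_Ioo_left_one] with u hu using (sq_mem hu.1 hu.2).1.le)
  rw [h.tsum_eq] at this
  refine this.congr fun u => ?_
  rw [ordinaryHypergeometric_eq]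

theorem tendsto_rpow_left_one (p : ℝ) : Tendsto (fun u : ℝ => u ^ p) (𝓝[<] 1) (𝓝 1) := by
  have := (Real.continuousAt_rpow_const 1 p (Or.inl one_ne_zero)).tendsto
  rw [Real.one_rpow] at this
  exact this.mono_left nhdsWithin_le_nhds

theorem tendsto_one_sub_sq_rpow_left_one {p : ℝ} (hp : 0 < p) :
    Tendsto (fun u : ℝ => (1 - u ^ 2) ^ p) (𝓝[<] 1) (𝓝 0) := by
  have h1 := (Real.continuousAt_rpow_const 0 p (Or.inr hp.le)).tendsto
  rw [Real.zero_rpow hp.ne'] at h1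
  refine h1.comp ?_
  simpa using tendsto_sq_left_one.const_sub 1

/-- The limit at `1` of the regular factor of `rowA + rowB`. -/
theorem tendsto_add_row (h : Adm k₀ k₁) (hk : 0 < k₀) :
    Tendsto (fun u => (rowA k₀ k₁ u + rowB k₀ k₁ u) * (1 - u ^ 2) ^ (-k₀)) (𝓝[<] 1)
      (𝓝 (Real.Gamma (k₁ + 1 / 2) * Real.Gamma (1 - 2 * k₀) /
        (Real.Gamma (k₁ + 1 / 2 - k₀) * Real.Gamma (1 - k₀)))) := by
  obtain ⟨b1, b2, b3, b4, b5, b6, b7, b8⟩ := h.bounds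
  have hc : 0 < k₁ + 1 / 2 := by linarith
  have hS := hasSum_hgCoeff (a := k₀) (b := 1 / 2 + k₀ + k₁) (c := k₁ + 3 / 2) hk (by linarith)
    (by linarith)
  have t1 := tendsto_hyp_left_one (summable_abs_hyp_fst h hk).of_abs.hasSum
  have t2 := tendsto_hyp_left_one hS
  have t3 := tendsto_one_sub_sq_rpow_left_one (p := 1 - 2 * k₀) (by linarith)
  have hid : Tendsto (fun u : ℝ => u) (𝓝[<] 1) (𝓝 1) := tendsto_id.mono_left nhdsWithin_le_nhds
  have t5 := ((t3.div (hid.const_add 1) (by norm_num)).mul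
    ((tendsto_rpow_left_one k₁).mul t1)).add
    (((tendsto_rpow_left_one k₁).mul hid).mul
      (t2.const_mul ((k₁ + 1 / 2 - k₀) / (k₁ + 1 / 2))))
  have hval : 0 / (1 + 1) * (1 * ∑' n, hgCoeff (-k₀) (1 / 2 - k₀ + k₁) (k₁ + 1 / 2) n) + 1 * 1 *
      ((k₁ + 1 / 2 - k₀) / (k₁ + 1 / 2) * (Real.Gamma (k₁ + 3 / 2) *
        Real.Gamma (k₁ + 3 / 2 - k₀ - (1 / 2 + k₀ + k₁)) /
        (Real.Gamma (k₁ + 3 / 2 - k₀) * Real.Gamma (k₁ + 3 / 2 - (1 / 2 + k₀ + k₁)))))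
      = Real.Gamma (k₁ + 1 / 2) * Real.Gamma (1 - 2 * k₀) /
        (Real.Gamma (k₁ + 1 / 2 - k₀) * Real.Gamma (1 - k₀)) := by
    have hck : 0 < k₁ + 1 / 2 - k₀ := by linarith
    have g1 : Real.Gamma (k₁ + 3 / 2) = (k₁ + 1 / 2) * Real.Gamma (k₁ + 1 / 2) := by
      rw [← Real.Gamma_add_one hc.ne']; ring_nf
    have g2 : Real.Gamma (k₁ + 3 / 2 - k₀)
        = (k₁ + 1 / 2 - k₀) * Real.Gamma (k₁ + 1 / 2 - k₀) := by
      rw [← Real.Gamma_add_one hck.ne']; ring_nf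
    have g3 := (Real.Gamma_pos_of_pos hck).ne'
    have g4 := (Real.Gamma_pos_of_pos (show 0 < 1 - k₀ by linarith)).ne'
    have hck' := hck.ne'
    have hc' := hc.ne'
    rw [g1, g2, show k₁ + 3 / 2 - k₀ - (1 / 2 + k₀ + k₁) = 1 - 2 * k₀ by ring,
      show k₁ + 3 / 2 - (1 / 2 + k₀ + k₁) = 1 - k₀ by ring, zero_div, zero_mul, zero_add,
      one_mul, one_mul]
    generalize k₁ + 1 / 2 - k₀ = D at *
    generalize k₁ + 1 / 2 = C at *
    field_simp
  rw [hval] at t5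
  refine t5.congr' ?_
  filter_upwards [eventually_Ioo_left_one] with u hu
  obtain ⟨h3, h2, h4⟩ := sq_mem hu.1 hu.2
  obtain ⟨sA, sB⟩ := row_neg_left h hu.1 hu.2
  have sB' : rowB k₀ k₁ u = -rowB (-k₀) k₁ u := by rw [sB, neg_neg]
  -- the contiguous relation between the three series
  have key : ordinaryHypergeometric k₀ (1 / 2 + k₀ + k₁) (k₁ + 1 / 2) (u ^ 2)
      - k₀ / (k₁ + 1 / 2) * ordinaryHypergeometric (1 + k₀) (1 / 2 + k₀ + k₁) (k₁ + 3 / 2) (u ^ 2)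
      = (k₁ + 1 / 2 - k₀) / (k₁ + 1 / 2) *
        ordinaryHypergeometric k₀ (1 / 2 + k₀ + k₁) (k₁ + 3 / 2) (u ^ 2) := by
    have s1 := (summable_mul_pow (fun r h0 h1 => summable_hgCoeff_abs_mul_pow k₀
      (1 / 2 + k₀ + k₁) (c := k₁ + 1 / 2) hc h0 h1) h3).hasSum
    have s2 := (summable_mul_pow (fun r h0 h1 => summable_hgCoeff_abs_mul_pow (1 + k₀)
      (1 / 2 + k₀ + k₁) (c := k₁ + 3 / 2) (by linarith) h0 h1) h3).hasSum
    have s3 := (summable_mul_pow (fun r h0 h1 => summable_hgCoeff_abs_mul_pow k₀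
      (1 / 2 + k₀ + k₁) (c := k₁ + 3 / 2) (by linarith) h0 h1) h3).hasSum
    simp only [ordinaryHypergeometric_eq]
    refine (s1.sub (s2.mul_left (k₀ / (k₁ + 1 / 2)))).unique ?_
    convert! s3.mul_left ((k₁ + 1 / 2 - k₀) / (k₁ + 1 / 2)) using 1
    ext n
    have g1 := hgCoeff_shift_left k₀ (1 / 2 + k₀ + k₁) (c := k₁ + 3 / 2) n
    have g2 := hgCoeff_shift_right k₀ (1 / 2 + k₀ + k₁) hc n
    rw [show k₀ + 1 = 1 + k₀ by ring] at g1
    rw [show k₁ + 1 / 2 + 1 = k₁ + 3 / 2 by ring] at g2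
    have e : hgCoeff k₀ (1 / 2 + k₀ + k₁) (k₁ + 1 / 2) n
        - k₀ / (k₁ + 1 / 2) * hgCoeff (1 + k₀) (1 / 2 + k₀ + k₁) (k₁ + 3 / 2) n
        = (k₁ + 1 / 2 - k₀) / (k₁ + 1 / 2) * hgCoeff k₀ (1 / 2 + k₀ + k₁) (k₁ + 3 / 2) n := by
      generalize hgCoeff k₀ (1 / 2 + k₀ + k₁) (k₁ + 1 / 2) n = x at *
      generalize hgCoeff (1 + k₀) (1 / 2 + k₀ + k₁) (k₁ + 3 / 2) n = y at *
      generalize hgCoeff k₀ (1 / 2 + k₀ + k₁) (k₁ + 3 / 2) n = z at *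
      generalize k₁ + 1 / 2 = C at *
      field_simp
      linear_combination -g1 - g2
    linear_combination (u ^ 2) ^ n * e
  have e1 : rowA (-k₀) k₁ u = u ^ k₁ * (1 - u ^ 2) ^ k₀ *
      ordinaryHypergeometric k₀ (1 / 2 + k₀ + k₁) (k₁ + 1 / 2) (u ^ 2) := by
    simp only [rowA, neg_neg, sub_neg_eq_add]
  have e2 : rowB (-k₀) k₁ u = k₀ / (k₁ + 1 / 2) * u ^ k₁ * (1 - u ^ 2) ^ k₀ * u *
      ordinaryHypergeometric (1 + k₀) (1 / 2 + k₀ + k₁) (k₁ + 3 / 2) (u ^ 2) := by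
    simp only [rowB, neg_neg, sub_neg_eq_add, neg_div]
  -- Write `A + B = (1 - u) A + u (A + B/u)`. In the first part `A` is kept in its original form,
  -- and multiplication by `(1 - u²)^(-k₀)` leaves a positive power `1 - 2k₀` of `1 - u²`. The
  -- second part is rewritten with `-k₀`, where `key` merges the two series into one that Gauss's
  -- theorem sums at `1`.
  have e3 : rowA k₀ k₁ u + rowB k₀ k₁ u = (1 - u) * rowA k₀ k₁ u + u ^ k₁ * (1 - u ^ 2) ^ k₀ * u *
      ((k₁ + 1 / 2 - k₀) / (k₁ + 1 / 2) *
        ordinaryHypergeometric k₀ (1 / 2 + k₀ + k₁) (k₁ + 3 / 2) (u ^ 2)) := by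
    rw [← key, sB', e2, ← sA, e1]; ring
  have e4 : (1 - u ^ 2) ^ k₀ * (1 - u ^ 2) ^ (-k₀) = 1 := by
    rw [← Real.rpow_add h2, add_neg_cancel, Real.rpow_zero]
  have e5 : (1 - u ^ 2) ^ (1 - 2 * k₀) = (1 - u ^ 2) * ((1 - u ^ 2) ^ (-k₀) * (1 - u ^ 2) ^ (-k₀)) := by
    rw [← Real.rpow_add h2, ← Real.rpow_one_add' h2.le (by linarith)]
    ring_nf
  have hu2 : 1 + u ≠ 0 := by linarith [hu.1]
  simp only [Pi.div_apply]
  have e6 : (1 - u ^ 2) / (1 + u) = 1 - u := by field_simp; ring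
  rw [e3, e5, rowA]
  generalize (1 - u ^ 2) ^ (-k₀) = w at *
  generalize (1 - u ^ 2) ^ k₀ = w' at *
  linear_combination w * w * u ^ k₁ *
    ordinaryHypergeometric (-k₀) (1 / 2 - k₀ + k₁) (k₁ + 1 / 2) (u ^ 2) * e6
    - u ^ k₁ * u * ((k₁ + 1 / 2 - k₀) / (k₁ + 1 / 2) *
      ordinaryHypergeometric k₀ (1 / 2 + k₀ + k₁) (k₁ + 3 / 2) (u ^ 2)) * e4

/-- Write `A - B = (A + B) - 2B`. By `tendsto_add_row` the first part contributes `(1 - u²)^(2k₀)`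
times a bounded factor, which tends to `0`; in the second the powers of `1 - u²` cancel and Gauss's
theorem gives the limit. -/
theorem tendsto_sub_row (h : Adm k₀ k₁) (hk : 0 < k₀) :
    Tendsto (fun u => (rowA k₀ k₁ u - rowB k₀ k₁ u) * (1 - u ^ 2) ^ k₀) (𝓝[<] 1)
      (𝓝 (Real.Gamma (k₁ + 1 / 2) * Real.Gamma (1 + 2 * k₀) /
        (Real.Gamma (k₁ + 1 / 2 + k₀) * Real.Gamma (1 + k₀)))) := by
  obtain ⟨b1, b2, b3, b4, b5, b6, b7, b8⟩ := h.bounds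
  have hc : 0 < k₁ + 1 / 2 := by linarith
  have hid : Tendsto (fun u : ℝ => u) (𝓝[<] 1) (𝓝 1) := tendsto_id.mono_left nhdsWithin_le_nhds
  have t1 := (tendsto_add_row h hk).mul (tendsto_one_sub_sq_rpow_left_one (p := 2 * k₀)
    (by linarith))
  have t2 := tendsto_hyp_left_one (summable_hyp_snd h hk)
  have t3 := t1.add ((((tendsto_rpow_left_one k₁).mul hid).mul t2).const_mul
    (2 * k₀ / (k₁ + 1 / 2)))
  have g1 : Real.Gamma (k₁ + 3 / 2) = (k₁ + 1 / 2) * Real.Gamma (k₁ + 1 / 2) := by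
    rw [← Real.Gamma_add_one hc.ne']; ring_nf
  have g2 : Real.Gamma (1 + 2 * k₀) = 2 * k₀ * Real.Gamma (2 * k₀) := by
    rw [add_comm, Real.Gamma_add_one (by positivity)]
  have g3 := (Real.Gamma_pos_of_pos (show 0 < k₁ + 1 / 2 + k₀ by linarith)).ne'
  have g4 := (Real.Gamma_pos_of_pos (show 0 < 1 + k₀ by linarith)).ne'
  convert! t3.congr' ?_ using 2
  · rw [g1, g2]
    generalize k₁ + 1 / 2 + k₀ = D at *
    generalize k₁ + 1 / 2 = C at *
    field_simp
    ring
  filter_upwards [eventually_Ioo_left_one] with u hu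
  obtain ⟨h3, h2, h4⟩ := sq_mem hu.1 hu.2
  have e1 : (1 - u ^ 2) ^ (2 * k₀) = (1 - u ^ 2) ^ k₀ * (1 - u ^ 2) ^ k₀ := by
    rw [← Real.rpow_add h2]; ring_nf
  have e4 : (1 - u ^ 2) ^ k₀ * (1 - u ^ 2) ^ (-k₀) = 1 := by
    rw [← Real.rpow_add h2, add_neg_cancel, Real.rpow_zero]
  rw [e1]
  rw [rowB]
  generalize (1 - u ^ 2) ^ (-k₀) = w at *
  generalize (1 - u ^ 2) ^ k₀ = w' at *
  generalize ordinaryHypergeometric (1 - k₀) (1 / 2 - k₀ + k₁) (k₁ + 3 / 2) (u ^ 2) = f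
  linear_combination ((rowA k₀ k₁ u - k₀ / (k₁ + 1 / 2) * u ^ k₁ * w * u * f) * w'
    - 2 * k₀ / (k₁ + 1 / 2) * u ^ k₁ * u * f) * e4

/-- The factor of the connection coefficient that does not depend on `k₁`. -/
def connConst (k₀ : ℝ) : ℝ :=
  Real.Gamma (1 + 2 * k₀) * Real.Gamma (1 - 2 * k₀) / (Real.Gamma (1 + k₀) * Real.Gamma (1 - k₀))

/-- The factors `A + B` and `A - B` carry opposite powers of `1 - u²`, so their product has a finite
limit. The factor `connConst k₀` is even in `k₀` and independent of `k₁`, hence common to the rows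
for `k₁` and `-k₁`. -/
theorem tendsto_row_sq_sub (h : Adm k₀ k₁) :
    Tendsto (fun u => rowA k₀ k₁ u ^ 2 - rowB k₀ k₁ u ^ 2) (𝓝[<] 1)
      (𝓝 (connConst k₀ * Real.Gamma (1 / 2 + k₁) ^ 2 /
        (Real.Gamma (1 / 2 + k₀ + k₁) * Real.Gamma (1 / 2 - k₀ + k₁)))) := by
  have pos : ∀ k₀, Adm k₀ k₁ → 0 < k₀ →
      Tendsto (fun u => rowA k₀ k₁ u ^ 2 - rowB k₀ k₁ u ^ 2) (𝓝[<] 1)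
      (𝓝 (connConst k₀ * Real.Gamma (1 / 2 + k₁) ^ 2 /
        (Real.Gamma (1 / 2 + k₀ + k₁) * Real.Gamma (1 / 2 - k₀ + k₁)))) := by
    intro k₀ h hk
    have t := (tendsto_add_row h hk).mul (tendsto_sub_row h hk)
    convert! t.congr' ?_ using 2
    · rw [connConst, show 1 / 2 + k₁ = k₁ + 1 / 2 by ring,
        show 1 / 2 + k₀ + k₁ = k₁ + 1 / 2 + k₀ by ring,
        show 1 / 2 - k₀ + k₁ = k₁ + 1 / 2 - k₀ by ring, div_mul_div_comm, div_mul_eq_mul_div,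
        div_div]
      congr 1 <;> ring
    filter_upwards [eventually_Ioo_left_one] with u hu
    obtain ⟨h3, h2, h4⟩ := sq_mem hu.1 hu.2
    have e4 : (1 - u ^ 2) ^ k₀ * (1 - u ^ 2) ^ (-k₀) = 1 := by
      rw [← Real.rpow_add h2, add_neg_cancel, Real.rpow_zero]
    linear_combination (rowA k₀ k₁ u ^ 2 - rowB k₀ k₁ u ^ 2) * e4
  rcases lt_trichotomy k₀ 0 with hk | rfl | hk
  · have := pos (-k₀) h.neg_left (neg_pos.2 hk)
    convert! this.congr' ?_ using 2
    · simp only [connConst]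
      ring_nf
    filter_upwards [eventually_Ioo_left_one] with u hu
    rw [(row_neg_left h hu.1 hu.2).1, (row_neg_left h hu.1 hu.2).2, neg_sq]
  · simp only [rowA_zero_left, rowB_zero_left]
    have hg := (Real.Gamma_pos_of_pos
      (show 0 < 1 / 2 + k₁ by linarith [h.bounds.2.2.2.2.2.2.1])).ne'
    have t := (tendsto_rpow_left_one k₁).pow 2
    convert! t using 2
    · simp
    · simp only [connConst, mul_zero, add_zero, sub_zero, Real.Gamma_one, one_pow, mul_one, one_mul,
        div_one]
      rw [sq, div_self (mul_ne_zero hg hg)]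
  · exact pos k₀ h hk

/-! ## The weight on the arc `0 < θ < π / 4` -/

/-- Half the trace of the weight. -/
def kAlpha (c k₀ k₁ θ : ℝ) : ℝ :=
  (d1 c k₀ k₁ * (rowA k₀ k₁ (Real.tan θ) ^ 2 + rowB k₀ k₁ (Real.tan θ) ^ 2)
    + d2 c k₀ k₁ * (rowA k₀ (-k₁) (Real.tan θ) ^ 2 + rowB k₀ (-k₁) (Real.tan θ) ^ 2)) / 2

/-- The off-diagonal entry of the weight. -/
def kBeta (c k₀ k₁ θ : ℝ) : ℝ :=
  d1 c k₀ k₁ * (rowA k₀ k₁ (Real.tan θ) * rowB k₀ k₁ (Real.tan θ))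
    + d2 c k₀ k₁ * (rowA k₀ (-k₁) (Real.tan θ) * rowB k₀ (-k₁) (Real.tan θ))

/-- Half the difference of the diagonal entries of the weight. -/
def kGamma (c k₀ k₁ θ : ℝ) : ℝ :=
  (d1 c k₀ k₁ * (rowA k₀ k₁ (Real.tan θ) ^ 2 - rowB k₀ k₁ (Real.tan θ) ^ 2)
    - d2 c k₀ k₁ * (rowA k₀ (-k₁) (Real.tan θ) ^ 2 - rowB k₀ (-k₁) (Real.tan θ) ^ 2)) / 2

theorem arc_facts {θ : ℝ} (h0 : 0 < θ) (h1 : θ < Real.pi / 4) :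
    0 < Real.cos θ ∧ 0 < Real.sin θ ∧ 0 < Real.tan θ ∧ Real.tan θ < 1 ∧
    0 < Real.cos (2 * θ) ∧ 0 < Real.sin (2 * θ) := by
  have hp := Real.pi_pos
  have hc : 0 < Real.cos θ := Real.cos_pos_of_mem_Ioo ⟨by linarith, by linarith⟩
  have hc2 : 0 < Real.cos (2 * θ) := Real.cos_pos_of_mem_Ioo ⟨by linarith, by linarith⟩
  have hs : 0 < Real.sin θ := Real.sin_pos_of_pos_of_lt_pi h0 (by linarith)
  refine ⟨hc, hs, Real.tan_pos_of_pos_of_lt_pi_div_two h0 (by linarith), ?_, hc2,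
    Real.sin_pos_of_pos_of_lt_pi (by linarith) (by linarith)⟩
  rw [← Real.tan_pi_div_four]
  exact Real.tan_lt_tan_of_lt_of_lt_pi_div_two (by linarith) (by linarith) h1

theorem one_sub_tan_sq {θ : ℝ} (h : Real.cos θ ≠ 0) :
    1 - Real.tan θ ^ 2 = Real.cos (2 * θ) / Real.cos θ ^ 2 := by
  rw [Real.tan_eq_sin_div_cos, Real.cos_two_mul, div_pow]
  field_simp
  rw [Real.sin_sq]; ring

/-- With `u = tan θ` the singular coefficients `1/u` and `1/(1 - u²)`, multiplied by `du/dθ`, become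
`2/sin 2θ` and `1/cos 2θ`. -/
theorem hasDerivAt_rowA_tan (h : Adm k₀ k₁) {θ : ℝ} (h0 : 0 < θ) (h1 : θ < Real.pi / 4) :
    HasDerivAt (fun θ => rowA k₀ k₁ (Real.tan θ))
      (2 * k₁ / Real.sin (2 * θ) * rowA k₀ k₁ (Real.tan θ)
        - 2 * k₀ / Real.cos (2 * θ) * rowB k₀ k₁ (Real.tan θ)) θ := by
  obtain ⟨f1, f2, f3, f4, f5, f6⟩ := arc_facts h0 h1
  have e := (hasDerivAt_rowA h f3 f4).comp θ (Real.hasDerivAt_tan f1.ne')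
  convert! e using 1
  rw [one_sub_tan_sq f1.ne', Real.tan_eq_sin_div_cos, Real.sin_two_mul]
  field_simp

theorem hasDerivAt_rowB_tan (h : Adm k₀ k₁) {θ : ℝ} (h0 : 0 < θ) (h1 : θ < Real.pi / 4) :
    HasDerivAt (fun θ => rowB k₀ k₁ (Real.tan θ))
      (-(2 * k₀ / Real.cos (2 * θ)) * rowA k₀ k₁ (Real.tan θ)
        - 2 * k₁ / Real.sin (2 * θ) * rowB k₀ k₁ (Real.tan θ)) θ := by
  obtain ⟨f1, f2, f3, f4, f5, f6⟩ := arc_facts h0 h1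
  have e := (hasDerivAt_rowB h f3 f4).comp θ (Real.hasDerivAt_tan f1.ne')
  convert! e using 1
  rw [one_sub_tan_sq f1.ne', Real.tan_eq_sin_div_cos, Real.sin_two_mul]
  field_simp

/-- The second row of `L` is the first with `k₁` negated and its entries exchanged, so it solves the
same system `L' = L M`. Hence `K' = M K + K M`, whatever the diagonal constants. Since `M` is
symmetric of trace zero, `M K + K M` is `2α M` plus a scalar matrix; this and the next two lemmas
are its components. -/
theorem hasDerivAt_kAlpha (h : Adm k₀ k₁) (c : ℝ) {θ : ℝ} (h0 : 0 < θ) (h1 : θ < Real.pi / 4) :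
    HasDerivAt (kAlpha c k₀ k₁) (-(4 * k₀ / Real.cos (2 * θ)) * kBeta c k₀ k₁ θ
      + 4 * k₁ / Real.sin (2 * θ) * kGamma c k₀ k₁ θ) θ := by
  have a1 := hasDerivAt_rowA_tan h h0 h1
  have b1 := hasDerivAt_rowB_tan h h0 h1
  have a2 := hasDerivAt_rowA_tan h.neg_right h0 h1
  have b2 := hasDerivAt_rowB_tan h.neg_right h0 h1
  have e := ((((a1.pow 2).add (b1.pow 2)).const_mul (d1 c k₀ k₁)).add
    (((a2.pow 2).add (b2.pow 2)).const_mul (d2 c k₀ k₁))).div_const 2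
  convert! e using 1
  rw [kBeta, kGamma]
  ring

theorem hasDerivAt_kBeta (h : Adm k₀ k₁) (c : ℝ) {θ : ℝ} (h0 : 0 < θ) (h1 : θ < Real.pi / 4) :
    HasDerivAt (kBeta c k₀ k₁) (-(4 * k₀ / Real.cos (2 * θ)) * kAlpha c k₀ k₁ θ) θ := by
  have a1 := hasDerivAt_rowA_tan h h0 h1
  have b1 := hasDerivAt_rowB_tan h h0 h1
  have a2 := hasDerivAt_rowA_tan h.neg_right h0 h1
  have b2 := hasDerivAt_rowB_tan h.neg_right h0 h1
  have e := ((a1.mul b1).const_mul (d1 c k₀ k₁)).add ((a2.mul b2).const_mul (d2 c k₀ k₁))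
  convert! e using 1
  rw [kAlpha]
  ring

theorem hasDerivAt_kGamma (h : Adm k₀ k₁) (c : ℝ) {θ : ℝ} (h0 : 0 < θ) (h1 : θ < Real.pi / 4) :
    HasDerivAt (kGamma c k₀ k₁) (4 * k₁ / Real.sin (2 * θ) * kAlpha c k₀ k₁ θ) θ := by
  have a1 := hasDerivAt_rowA_tan h h0 h1
  have b1 := hasDerivAt_rowB_tan h h0 h1
  have a2 := hasDerivAt_rowA_tan h.neg_right h0 h1
  have b2 := hasDerivAt_rowB_tan h.neg_right h0 h1
  have e := ((((a1.pow 2).sub (b1.pow 2)).const_mul (d1 c k₀ k₁)).sub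
    (((a2.pow 2).sub (b2.pow 2)).const_mul (d2 c k₀ k₁))).div_const 2
  convert! e using 1
  rw [kAlpha]
  ring

/-- The common majorant of the entries of the weight. -/
def kBound (k₀ k₁ θ : ℝ) : ℝ :=
  Real.tan θ ^ (-(2 * |k₁|)) * (1 - Real.tan θ ^ 2) ^ (-(2 * |k₀|))

theorem row_products_bound (h : Adm k₀ k₁) : ∃ C, 0 ≤ C ∧ ∀ u, 0 < u → u < 1 →
    rowA k₀ k₁ u ^ 2 ≤ C * (u ^ (2 * k₁) * (1 - u ^ 2) ^ (-(2 * |k₀|))) ∧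
    |rowA k₀ k₁ u * rowB k₀ k₁ u| ≤ C * (u ^ (2 * k₁) * (1 - u ^ 2) ^ (-(2 * |k₀|))) * u ∧
    rowB k₀ k₁ u ^ 2 ≤ C * (u ^ (2 * k₁) * (1 - u ^ 2) ^ (-(2 * |k₀|))) * u ^ 2 := by
  obtain ⟨C, hC, hb⟩ := exists_row_bound h
  refine ⟨C ^ 2, by positivity, fun u h0 h1 => ?_⟩
  obtain ⟨h3, h2, h4⟩ := sq_mem h0 h1
  obtain ⟨hA, hB⟩ := hb u h0 h1
  have p1 := (Real.rpow_pos_of_pos h0 k₁).le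
  have p2 := (Real.rpow_pos_of_pos h2 (-|k₀|)).le
  have e1 : u ^ (2 * k₁) = u ^ k₁ * u ^ k₁ := by rw [← Real.rpow_add h0]; ring_nf
  have e2 : (1 - u ^ 2) ^ (-(2 * |k₀|)) = (1 - u ^ 2) ^ (-|k₀|) * (1 - u ^ 2) ^ (-|k₀|) := by
    rw [← Real.rpow_add h2]; ring_nf
  have nA : 0 ≤ C * u ^ k₁ * (1 - u ^ 2) ^ (-|k₀|) := by positivity
  rw [e1, e2]
  refine ⟨?_, ?_, ?_⟩
  · rw [← sq_abs]
    calc |rowA k₀ k₁ u| ^ 2 ≤ (C * u ^ k₁ * (1 - u ^ 2) ^ (-|k₀|)) ^ 2 := by gcongr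
      _ = _ := by ring
  · rw [abs_mul]
    calc |rowA k₀ k₁ u| * |rowB k₀ k₁ u|
        ≤ (C * u ^ k₁ * (1 - u ^ 2) ^ (-|k₀|)) * (C * u ^ k₁ * u * (1 - u ^ 2) ^ (-|k₀|)) := by
          gcongr
      _ = _ := by ring
  · rw [← sq_abs]
    calc |rowB k₀ k₁ u| ^ 2 ≤ (C * u ^ k₁ * u * (1 - u ^ 2) ^ (-|k₀|)) ^ 2 := by gcongr
      _ = _ := by ring

theorem row_products_bound_tan (h : Adm k₀ k₁) : ∃ C, 0 ≤ C ∧ ∀ θ, 0 < θ → θ < Real.pi / 4 →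
    rowA k₀ k₁ (Real.tan θ) ^ 2 ≤ C * kBound k₀ k₁ θ ∧
    |rowA k₀ k₁ (Real.tan θ) * rowB k₀ k₁ (Real.tan θ)| ≤ C * kBound k₀ k₁ θ * Real.tan θ ∧
    rowB k₀ k₁ (Real.tan θ) ^ 2 ≤ C * kBound k₀ k₁ θ := by
  obtain ⟨C, hC, hb⟩ := row_products_bound h
  refine ⟨C, hC, fun θ h0 h1 => ?_⟩
  obtain ⟨f1, f2, f3, f4, f5, f6⟩ := arc_facts h0 h1
  obtain ⟨hA, hAB, hB⟩ := hb _ f3 f4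
  obtain ⟨-, h2, -⟩ := sq_mem f3 f4
  have p2 := (Real.rpow_pos_of_pos h2 (-(2 * |k₀|))).le
  have p3 : Real.tan θ ^ (2 * k₁) ≤ Real.tan θ ^ (-(2 * |k₁|)) :=
    Real.rpow_le_rpow_of_exponent_ge f3 f4.le (by linarith [neg_abs_le k₁])
  have p4 : Real.tan θ ^ (2 * k₁) * (1 - Real.tan θ ^ 2) ^ (-(2 * |k₀|)) ≤ kBound k₀ k₁ θ := by
    unfold kBound; gcongr
  have p5 : 0 ≤ kBound k₀ k₁ θ := by
    unfold kBound
    have := Real.rpow_nonneg f3.le (-(2 * |k₁|))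
    positivity
  refine ⟨hA.trans (by gcongr), hAB.trans (by gcongr), hB.trans ?_⟩
  calc _ ≤ C * kBound k₀ k₁ θ * 1 := by
        gcongr
        nlinarith
    _ = _ := mul_one _

theorem kBound_nonneg {θ : ℝ} (h0 : 0 < θ) (h1 : θ < Real.pi / 4) : 0 ≤ kBound k₀ k₁ θ := by
  obtain ⟨f1, f2, f3, f4, f5, f6⟩ := arc_facts h0 h1
  obtain ⟨-, h2, -⟩ := sq_mem f3 f4
  have := Real.rpow_nonneg f3.le (-(2 * |k₁|))
  have := Real.rpow_nonneg h2.le (-(2 * |k₀|))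
  unfold kBound
  positivity

/-- The extra factor `tan θ` for `β` matters: the boundary term at `0` in
`integral_cos_pow_sin_kBeta` contains no sine that would make it vanish. -/
theorem k_bounds (h : Adm k₀ k₁) (c : ℝ) : ∃ C, 0 ≤ C ∧ ∀ θ, 0 < θ → θ < Real.pi / 4 →
    |kAlpha c k₀ k₁ θ| ≤ C * kBound k₀ k₁ θ ∧
    |kBeta c k₀ k₁ θ| ≤ C * kBound k₀ k₁ θ * Real.tan θ ∧
    |kGamma c k₀ k₁ θ| ≤ C * kBound k₀ k₁ θ := by
  obtain ⟨C₁, hC₁, hb₁⟩ := row_products_bound_tan h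
  obtain ⟨C₂, hC₂, hb₂⟩ := row_products_bound_tan h.neg_right
  refine ⟨|d1 c k₀ k₁| * C₁ + |d2 c k₀ k₁| * C₂, by positivity, fun θ h0 h1 => ?_⟩
  obtain ⟨a1, b1, g1⟩ := hb₁ θ h0 h1
  obtain ⟨a2, b2, g2⟩ := hb₂ θ h0 h1
  have hk : kBound k₀ (-k₁) θ = kBound k₀ k₁ θ := by simp [kBound]
  rw [hk] at a2 b2 g2
  obtain ⟨f1, f2, f3, f4, f5, f6⟩ := arc_facts h0 h1
  have p := kBound_nonneg (k₀ := k₀) (k₁ := k₁) h0 h1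
  generalize kBound k₀ k₁ θ = P at *
  unfold kAlpha kBeta kGamma
  generalize rowA k₀ k₁ (Real.tan θ) = A at *
  generalize rowB k₀ k₁ (Real.tan θ) = B at *
  generalize rowA k₀ (-k₁) (Real.tan θ) = A' at *
  generalize rowB k₀ (-k₁) (Real.tan θ) = B' at *
  generalize d1 c k₀ k₁ = D at *
  generalize d2 c k₀ k₁ = D' at *
  have sA := sq_nonneg A
  have sB := sq_nonneg B
  have sA' := sq_nonneg A'
  have sB' := sq_nonneg B'
  have comb : ∀ x y : ℝ, |x| ≤ 2 * (C₁ * P) → |y| ≤ 2 * (C₂ * P) →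
      |D * x + D' * y| / 2 ≤ (|D| * C₁ + |D'| * C₂) * P := by
    intro x y hx hy
    have := abs_add_le (D * x) (D' * y)
    rw [abs_mul, abs_mul] at this
    have := mul_le_mul_of_nonneg_left hx (abs_nonneg D)
    have := mul_le_mul_of_nonneg_left hy (abs_nonneg D')
    linarith
  refine ⟨?_, ?_, ?_⟩
  · rw [abs_div, abs_two]
    exact comb _ _ (abs_le.2 ⟨by linarith, by linarith⟩) (abs_le.2 ⟨by linarith, by linarith⟩)
  · have := abs_add_le (D * (A * B)) (D' * (A' * B'))
    rw [abs_mul D, abs_mul D'] at this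
    have := mul_le_mul_of_nonneg_left b1 (abs_nonneg D)
    have := mul_le_mul_of_nonneg_left b2 (abs_nonneg D')
    linarith
  · rw [abs_div, abs_two, sub_eq_add_neg, ← mul_neg]
    exact comb _ _ (abs_le.2 ⟨by linarith, by linarith⟩) (abs_le.2 ⟨by linarith, by linarith⟩)

/-- The two singularities sit at opposite ends of the arc, so the product of powers is dominated by
their sum, split at `π/8`. The comparison of `1 - tan² θ` with the distance to `π/4` is Jordan's
inequality for `cos 2θ`. -/
theorem kBound_le (k₀ k₁ : ℝ) : ∃ C, 0 ≤ C ∧ ∀ θ, 0 < θ → θ < Real.pi / 4 →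
    kBound k₀ k₁ θ ≤ C * (θ ^ (-(2 * |k₁|)) + (Real.pi / 4 - θ) ^ (-(2 * |k₀|))) := by
  have hpi := Real.pi_pos
  set p := 2 * |k₁| with hp
  set q := 2 * |k₀| with hq
  have hp0 : 0 ≤ p := by positivity
  have hq0 : 0 ≤ q := by positivity
  have hP8 : 0 < Real.pi / 8 := by positivity
  set Cq := (Real.pi / 8) ^ (-q)
  set Cp := (Real.pi / 8) ^ (-p)
  have hCq : 0 ≤ Cq := Real.rpow_nonneg hP8.le _
  have hCp : 0 ≤ Cp := Real.rpow_nonneg hP8.le _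
  have hCs : (0 : ℝ) ≤ (4 / Real.pi) ^ (-q) := Real.rpow_nonneg (by positivity) _
  refine ⟨(4 / Real.pi) ^ (-q) * (Cq + Cp), by positivity, fun θ h0 h1 => ?_⟩
  obtain ⟨f1, f2, f3, f4, f5, f6⟩ := arc_facts h0 h1
  have hd : 0 < Real.pi / 4 - θ := by linarith
  have e1 : Real.tan θ ^ (-p) ≤ θ ^ (-p) :=
    Real.rpow_le_rpow_of_nonpos h0 (Real.le_tan h0.le (by linarith)) (by linarith)
  have e2 : 4 / Real.pi * (Real.pi / 4 - θ) ≤ 1 - Real.tan θ ^ 2 := by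
    rw [one_sub_tan_sq f1.ne']
    have s1 : Real.cos (2 * θ) ≤ Real.cos (2 * θ) / Real.cos θ ^ 2 := by
      rw [le_div_iff₀ (by positivity)]
      exact mul_le_of_le_one_right f5.le (pow_le_one₀ f1.le (Real.cos_le_one θ))
    have s2 := Real.mul_le_sin (x := Real.pi / 2 - 2 * θ) (by linarith) (by linarith)
    rw [Real.sin_pi_div_two_sub] at s2
    refine le_trans (le_of_eq ?_) (s2.trans s1)
    ring
  have e3 : (1 - Real.tan θ ^ 2) ^ (-q) ≤ (4 / Real.pi) ^ (-q) * (Real.pi / 4 - θ) ^ (-q) := by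
    rw [← Real.mul_rpow (by positivity) hd.le]
    exact Real.rpow_le_rpow_of_nonpos (by positivity) e2 (by linarith)
  have n1 := Real.rpow_nonneg h0.le (-p)
  have n2 := Real.rpow_nonneg hd.le (-q)
  have n3 : (0 : ℝ) ≤ (1 - Real.tan θ ^ 2) ^ (-q) :=
    Real.rpow_nonneg (sq_mem f3 f4).2.1.le _
  have e4 : θ ^ (-p) * (Real.pi / 4 - θ) ^ (-q)
      ≤ (Cq + Cp) * (θ ^ (-p) + (Real.pi / 4 - θ) ^ (-q)) := by
    rcases le_total θ (Real.pi / 8) with hθ | hθ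
    · have : (Real.pi / 4 - θ) ^ (-q) ≤ Cq :=
        Real.rpow_le_rpow_of_nonpos hP8 (by linarith) (by linarith)
      linarith [mul_nonneg hCp n1, mul_nonneg hCp n2, mul_nonneg hCq n2,
        mul_le_mul_of_nonneg_left this n1]
    · have : θ ^ (-p) ≤ Cp := Real.rpow_le_rpow_of_nonpos hP8 hθ (by linarith)
      linarith [mul_nonneg hCp n1, mul_nonneg hCq n1, mul_nonneg hCq n2,
        mul_le_mul_of_nonneg_right this n2]
  calc kBound k₀ k₁ θ ≤ θ ^ (-p) * ((4 / Real.pi) ^ (-q) * (Real.pi / 4 - θ) ^ (-q)) := by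
        unfold kBound; gcongr
    _ = (4 / Real.pi) ^ (-q) * (θ ^ (-p) * (Real.pi / 4 - θ) ^ (-q)) := by ring
    _ ≤ (4 / Real.pi) ^ (-q) * ((Cq + Cp) * (θ ^ (-p) + (Real.pi / 4 - θ) ^ (-q))) := by gcongr
    _ = _ := by ring

theorem intervalIntegrable_of_le_kBound (h : Adm k₀ k₁) {f : ℝ → ℝ} {C : ℝ} (hC : 0 ≤ C)
    (hf : ContinuousOn f (Set.Ioo 0 (Real.pi / 4)))
    (hb : ∀ θ, 0 < θ → θ < Real.pi / 4 → |f θ| ≤ C * kBound k₀ k₁ θ) :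
    IntervalIntegrable f volume 0 (Real.pi / 4) := by
  obtain ⟨C', hC', hb'⟩ := kBound_le k₀ k₁
  have hpi := Real.pi_pos
  have hp : -1 < -(2 * |k₁|) := by
    have := h; unfold Adm at this; linarith [abs_nonneg k₀]
  have hq : -1 < -(2 * |k₀|) := by
    have := h; unfold Adm at this; linarith [abs_nonneg k₁]
  have i1 : IntervalIntegrable (fun θ : ℝ => θ ^ (-(2 * |k₁|))) volume 0 (Real.pi / 4) :=
    intervalIntegral.intervalIntegrable_rpow' hp
  have i2 : IntervalIntegrable (fun θ : ℝ => (Real.pi / 4 - θ) ^ (-(2 * |k₀|))) volume 0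
      (Real.pi / 4) := by
    have := (intervalIntegral.intervalIntegrable_rpow' (a := 0) (b := Real.pi / 4) hq).comp_sub_left
      (Real.pi / 4)
    simpa using this.symm
  have i3 := ((i1.add i2).const_mul C').const_mul C
  rw [intervalIntegrable_iff_integrableOn_Ioo_of_le (by positivity)] at i3 ⊢
  refine Integrable.mono' i3 (hf.aestronglyMeasurable measurableSet_Ioo) ?_
  filter_upwards [ae_restrict_mem measurableSet_Ioo] with θ hθ
  rw [Real.norm_eq_abs]
  exact (hb θ hθ.1 hθ.2).trans (by
    have := hb' θ hθ.1 hθ.2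
    gcongr)

theorem continuousOn_k (h : Adm k₀ k₁) (c : ℝ) :
    ContinuousOn (kAlpha c k₀ k₁) (Set.Ioo 0 (Real.pi / 4)) ∧
    ContinuousOn (kBeta c k₀ k₁) (Set.Ioo 0 (Real.pi / 4)) ∧
    ContinuousOn (kGamma c k₀ k₁) (Set.Ioo 0 (Real.pi / 4)) :=
  ⟨fun _ hθ => (hasDerivAt_kAlpha h c hθ.1 hθ.2).continuousAt.continuousWithinAt,
   fun _ hθ => (hasDerivAt_kBeta h c hθ.1 hθ.2).continuousAt.continuousWithinAt,
   fun _ hθ => (hasDerivAt_kGamma h c hθ.1 hθ.2).continuousAt.continuousWithinAt⟩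

theorem intervalIntegrable_k (h : Adm k₀ k₁) (c : ℝ) :
    IntervalIntegrable (kAlpha c k₀ k₁) volume 0 (Real.pi / 4) ∧
    IntervalIntegrable (kBeta c k₀ k₁) volume 0 (Real.pi / 4) ∧
    IntervalIntegrable (kGamma c k₀ k₁) volume 0 (Real.pi / 4) := by
  obtain ⟨C, hC, hb⟩ := k_bounds h c
  obtain ⟨ca, cb, cg⟩ := continuousOn_k h c
  refine ⟨intervalIntegrable_of_le_kBound h hC ca fun θ h0 h1 => (hb θ h0 h1).1,
    intervalIntegrable_of_le_kBound h hC cb fun θ h0 h1 => (hb θ h0 h1).2.1.trans ?_,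
    intervalIntegrable_of_le_kBound h hC cg fun θ h0 h1 => (hb θ h0 h1).2.2⟩
  have := kBound_nonneg (k₀ := k₀) (k₁ := k₁) h0 h1
  exact mul_le_of_le_one_right (by positivity) (arc_facts h0 h1).2.2.2.1.le

/-! ## Boundary behaviour and integration by parts on the arc -/

theorem eventually_arc_zero : ∀ᶠ θ : ℝ in 𝓝[>] 0, 0 < θ ∧ θ < Real.pi / 4 :=
  Ioo_mem_nhdsGT (by positivity)

theorem eventually_arc_end : ∀ᶠ θ : ℝ in 𝓝[<] (Real.pi / 4), 0 < θ ∧ θ < Real.pi / 4 :=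
  Ioo_mem_nhdsLT (by positivity)

theorem tendsto_tan_zero : Tendsto Real.tan (𝓝[>] 0) (𝓝[>] 0) := by
  refine tendsto_nhdsWithin_iff.2 ⟨?_, ?_⟩
  · have : ContinuousAt Real.tan 0 := Real.continuousAt_tan.2 (by simp)
    have := this.tendsto
    rw [Real.tan_zero] at this
    exact this.mono_left nhdsWithin_le_nhds
  · filter_upwards [eventually_arc_zero] with θ hθ using (arc_facts hθ.1 hθ.2).2.2.1

theorem tendsto_tan_end : Tendsto Real.tan (𝓝[<] (Real.pi / 4)) (𝓝[<] 1) := by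
  refine tendsto_nhdsWithin_iff.2 ⟨?_, ?_⟩
  · have : ContinuousAt Real.tan (Real.pi / 4) := Real.continuousAt_tan.2 (by simp)
    have := this.tendsto
    rw [Real.tan_pi_div_four] at this
    exact this.mono_left nhdsWithin_le_nhds
  · filter_upwards [eventually_arc_end] with θ hθ using (arc_facts hθ.1 hθ.2).2.2.2.1

theorem tendsto_tan_mul_kBound (h : Adm k₀ k₁) :
    Tendsto (fun θ => Real.tan θ * kBound k₀ k₁ θ) (𝓝[>] 0) (𝓝 0) := by
  have hp : 0 < 1 - 2 * |k₁| := by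
    have := h; unfold Adm at this; linarith [abs_nonneg k₀]
  have t1 : Tendsto (fun u : ℝ => u ^ (1 - 2 * |k₁|)) (𝓝[>] 0) (𝓝 0) := by
    have := (Real.continuousAt_rpow_const 0 (1 - 2 * |k₁|) (Or.inr hp.le)).tendsto
    rw [Real.zero_rpow hp.ne'] at this
    exact this.mono_left nhdsWithin_le_nhds
  have t2 := (t1.mul (tendsto_one_sub_sq_rpow (-(2 * |k₀|)))).comp tendsto_tan_zero
  rw [zero_mul] at t2
  refine t2.congr' ?_
  filter_upwards [eventually_arc_zero] with θ hθ
  have := (arc_facts hθ.1 hθ.2).2.2.1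
  simp only [Function.comp, kBound]
  rw [sub_eq_add_neg, Real.rpow_add this, Real.rpow_one, mul_assoc]

theorem tendsto_cos_mul_kBound (h : Adm k₀ k₁) :
    Tendsto (fun θ => Real.cos (2 * θ) * kBound k₀ k₁ θ) (𝓝[<] (Real.pi / 4)) (𝓝 0) := by
  have hp : 0 < 1 - 2 * |k₀| := by
    have := h; unfold Adm at this; linarith [abs_nonneg k₁]
  have t1 := (tendsto_one_sub_sq_rpow_left_one hp).comp tendsto_tan_end
  have t2 := (tendsto_rpow_left_one (-(2 * |k₁|))).comp tendsto_tan_end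
  have t3 : Tendsto (fun θ : ℝ => Real.cos θ ^ 2) (𝓝[<] (Real.pi / 4))
      (𝓝 (Real.cos (Real.pi / 4) ^ 2)) :=
    ((Real.continuous_cos.pow 2).tendsto _).mono_left nhdsWithin_le_nhds
  have t4 := (t1.mul t2).mul t3
  rw [zero_mul, zero_mul] at t4
  refine t4.congr' ?_
  filter_upwards [eventually_arc_end] with θ hθ
  obtain ⟨f1, f2, f3, f4, f5, f6⟩ := arc_facts hθ.1 hθ.2
  have e : Real.cos (2 * θ) = (1 - Real.tan θ ^ 2) * Real.cos θ ^ 2 := by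
    rw [one_sub_tan_sq f1.ne']; field_simp
  have h2 := (sq_mem f3 f4).2.1
  simp only [Function.comp, kBound]
  rw [e, sub_eq_add_neg 1 (2 * |k₀|), Real.rpow_add h2, Real.rpow_one]
  ring

theorem abs_cos_pow_le (m : ℕ) (x : ℝ) : |Real.cos x ^ m| ≤ 1 := by
  rw [abs_pow]; exact pow_le_one₀ (abs_nonneg _) (Real.abs_cos_le_one _)

theorem sin_two_le_tan {θ : ℝ} (h0 : 0 < θ) (h1 : θ < Real.pi / 4) :
    |Real.sin (2 * θ)| ≤ 2 * Real.tan θ := by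
  obtain ⟨f1, f2, f3, f4, f5, f6⟩ := arc_facts h0 h1
  rw [abs_of_pos f6, Real.sin_two_mul, Real.tan_eq_sin_div_cos, mul_div_assoc', le_div_iff₀ f1]
  have : Real.cos θ * Real.cos θ ≤ 1 := mul_le_one₀ (Real.cos_le_one _) f1.le (Real.cos_le_one _)
  nlinarith

theorem tendsto_zero_of_tan_bound (h : Adm k₀ k₁) {f : ℝ → ℝ} {C : ℝ}
    (hb : ∀ θ, 0 < θ → θ < Real.pi / 4 → |f θ| ≤ C * (Real.tan θ * kBound k₀ k₁ θ)) :
    Tendsto f (𝓝[>] 0) (𝓝 0) := by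
  have t := (tendsto_tan_mul_kBound h).const_mul C
  rw [mul_zero] at t
  refine squeeze_zero_norm' ?_ t
  filter_upwards [eventually_arc_zero] with θ hθ using hb θ hθ.1 hθ.2

theorem tendsto_zero_of_cos_bound (h : Adm k₀ k₁) {f : ℝ → ℝ} {C : ℝ}
    (hb : ∀ θ, 0 < θ → θ < Real.pi / 4 → |f θ| ≤ C * (Real.cos (2 * θ) * kBound k₀ k₁ θ)) :
    Tendsto f (𝓝[<] (Real.pi / 4)) (𝓝 0) := by
  have t := (tendsto_cos_mul_kBound h).const_mul C
  rw [mul_zero] at t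
  refine squeeze_zero_norm' ?_ t
  filter_upwards [eventually_arc_end] with θ hθ using hb θ hθ.1 hθ.2

/-- The choice of `d₁ / d₂` makes the diagonal entries agree on the mirror `x₁ = x₂`. -/
theorem tendsto_kGamma_end (h : Adm k₀ k₁) (c : ℝ) :
    Tendsto (kGamma c k₀ k₁) (𝓝[<] (Real.pi / 4)) (𝓝 0) := by
  have t1 := (tendsto_row_sq_sub h).comp tendsto_tan_end
  have t2 := (tendsto_row_sq_sub h.neg_right).comp tendsto_tan_end
  have t3 := ((t1.const_mul (d1 c k₀ k₁)).sub (t2.const_mul (d2 c k₀ k₁))).div_const 2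
  convert! t3 using 2
  obtain ⟨b1, b2, b3, b4, b5, b6, b7, b8⟩ := h.bounds
  rw [d1, d2, ← sub_eq_add_neg (1 / 2) k₁, ← sub_eq_add_neg (1 / 2 + k₀) k₁,
    -- Each constant `d` carries exactly the Gamma quotient occurring in the limit for the opposite
    -- row. The two products therefore agree and their difference is zero.
    ← sub_eq_add_neg (1 / 2 - k₀) k₁]
  ring

/-- Integrates the derivative of `cos(2θ)^(m+1) β`. One cosine cancels the pole of `β'` and also
removes the boundary term at `π/4`. -/
theorem integral_cos_pow_sin_kBeta (h : Adm k₀ k₁) (c : ℝ) (m : ℕ) :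
    (m + 1) * ∫ θ in (0 : ℝ)..(Real.pi / 4),
        Real.cos (2 * θ) ^ m * (Real.sin (2 * θ) * kBeta c k₀ k₁ θ)
      = -(2 * k₀) * ∫ θ in (0 : ℝ)..(Real.pi / 4), Real.cos (2 * θ) ^ m * kAlpha c k₀ k₁ θ := by
  obtain ⟨ia, ib, ig⟩ := intervalIntegrable_k h c
  obtain ⟨C, hC, hb⟩ := k_bounds h c
  have i1 : IntervalIntegrable (fun θ => Real.cos (2 * θ) ^ m *
      (Real.sin (2 * θ) * kBeta c k₀ k₁ θ)) volume 0 (Real.pi / 4) :=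
    (ib.continuousOn_mul (by fun_prop)).continuousOn_mul (by fun_prop)
  have i2 : IntervalIntegrable (fun θ => Real.cos (2 * θ) ^ m * kAlpha c k₀ k₁ θ) volume 0
      (Real.pi / 4) := ia.continuousOn_mul (by fun_prop)
  have key := intervalIntegral.integral_eq_sub_of_hasDerivAt_of_tendsto
    (f := fun θ => Real.cos (2 * θ) ^ (m + 1) * kBeta c k₀ k₁ θ)
    (f' := fun θ => (-2 * (m + 1)) * (Real.cos (2 * θ) ^ m * (Real.sin (2 * θ) * kBeta c k₀ k₁ θ))
      + (-4 * k₀) * (Real.cos (2 * θ) ^ m * kAlpha c k₀ k₁ θ))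
    (a := 0) (b := Real.pi / 4) (fa := 0) (fb := 0) (by positivity) ?_
    ((i1.const_mul _).add (i2.const_mul _)) ?_ ?_
  · rw [intervalIntegral.integral_add (i1.const_mul _) (i2.const_mul _),
      intervalIntegral.integral_const_mul, intervalIntegral.integral_const_mul] at key
    linear_combination (-1 / 2) * key
  · intro θ hθ
    obtain ⟨f1, f2, f3, f4, f5, f6⟩ := arc_facts hθ.1 hθ.2
    have e := (((((hasDerivAt_id θ).const_mul 2).cos).pow (m + 1))).mul
      (hasDerivAt_kBeta h c hθ.1 hθ.2)
    convert! e using 1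
    simp only [id, Pi.pow_apply, Nat.add_sub_cancel, pow_succ]
    push_cast
    field_simp
  · refine tendsto_zero_of_tan_bound (C := C) h fun θ h0 h1 => ?_
    have h2 := (hb θ h0 h1).2.1
    rw [abs_mul]
    calc _ ≤ 1 * (C * kBound k₀ k₁ θ * Real.tan θ) := by gcongr; exact abs_cos_pow_le _ _
      _ = _ := by ring
  · refine tendsto_zero_of_cos_bound (C := C) h fun θ h0 h1 => ?_
    obtain ⟨f1, f2, f3, f4, f5, f6⟩ := arc_facts h0 h1
    have h2 := (hb θ h0 h1).2.1
    have h3 := kBound_nonneg (k₀ := k₀) (k₁ := k₁) h0 h1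
    rw [pow_succ, abs_mul, abs_mul, abs_of_pos f5]
    calc _ ≤ 1 * Real.cos (2 * θ) * (C * kBound k₀ k₁ θ * 1) := by
          gcongr
          · exact abs_cos_pow_le _ _
          · exact h2.trans (by gcongr)
      _ = _ := by ring

/-- Integrates the derivative of `cos(2θ)^m sin(2θ) γ`. For `m = 0` no cosine is left at `π/4`, so
the size bound is not enough and `tendsto_kGamma_end` is indispensable. At `m = 0` the truncated
exponent `m - 1` is harmless, its coefficient being `m`. -/
theorem integral_cos_pow_kGamma (h : Adm k₀ k₁) (c : ℝ) (m : ℕ) :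
    (m + 1) * (∫ θ in (0 : ℝ)..(Real.pi / 4), Real.cos (2 * θ) ^ (m + 1) * kGamma c k₀ k₁ θ)
      = m * (∫ θ in (0 : ℝ)..(Real.pi / 4), Real.cos (2 * θ) ^ (m - 1) * kGamma c k₀ k₁ θ)
      - 2 * k₁ * ∫ θ in (0 : ℝ)..(Real.pi / 4), Real.cos (2 * θ) ^ m * kAlpha c k₀ k₁ θ := by
  obtain ⟨ia, ib, ig⟩ := intervalIntegrable_k h c
  obtain ⟨C, hC, hb⟩ := k_bounds h c
  have i1 : ∀ m : ℕ, IntervalIntegrable (fun θ => Real.cos (2 * θ) ^ m * kGamma c k₀ k₁ θ) volume 0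
      (Real.pi / 4) := fun m => ig.continuousOn_mul (by fun_prop)
  have i2 : IntervalIntegrable (fun θ => Real.cos (2 * θ) ^ m * kAlpha c k₀ k₁ θ) volume 0
      (Real.pi / 4) := ia.continuousOn_mul (by fun_prop)
  have j := (((i1 (m + 1)).const_mul (2 * (m + 1))).add ((i1 (m - 1)).const_mul (-2 * m)))
  have key := intervalIntegral.integral_eq_sub_of_hasDerivAt_of_tendsto
    (f := fun θ => Real.cos (2 * θ) ^ m * (Real.sin (2 * θ) * kGamma c k₀ k₁ θ))
    (f' := fun θ => ((2 * (m + 1)) * (Real.cos (2 * θ) ^ (m + 1) * kGamma c k₀ k₁ θ)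
      + (-2 * m) * (Real.cos (2 * θ) ^ (m - 1) * kGamma c k₀ k₁ θ))
      + (4 * k₁) * (Real.cos (2 * θ) ^ m * kAlpha c k₀ k₁ θ))
    (a := 0) (b := Real.pi / 4) (fa := 0) (fb := 0) (by positivity) ?_
    (j.add (i2.const_mul _)) ?_ ?_
  · rw [intervalIntegral.integral_add j (i2.const_mul _),
      intervalIntegral.integral_add ((i1 (m + 1)).const_mul _) ((i1 (m - 1)).const_mul _),
      intervalIntegral.integral_const_mul, intervalIntegral.integral_const_mul,
      intervalIntegral.integral_const_mul] at key
    linear_combination (1 / 2) * key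
  · intro θ hθ
    obtain ⟨f1, f2, f3, f4, f5, f6⟩ := arc_facts hθ.1 hθ.2
    have e := (((((hasDerivAt_id θ).const_mul 2).cos).pow m)).mul
      ((((hasDerivAt_id θ).const_mul 2).sin).mul (hasDerivAt_kGamma h c hθ.1 hθ.2))
    convert! e using 1
    have hs : Real.sin (2 * θ) ^ 2 = 1 - Real.cos (2 * θ) ^ 2 := Real.sin_sq _
    have hm : (m : ℝ) * Real.cos (2 * θ) ^ (m - 1) * Real.cos (2 * θ) ^ 2
        = m * Real.cos (2 * θ) ^ (m + 1) := by
      rcases m with _ | m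
      · simp
      · simp only [Nat.add_sub_cancel]; ring
    have hsi : Real.sin (2 * θ) * (4 * k₁ / Real.sin (2 * θ)) = 4 * k₁ := by field_simp
    simp only [id, Pi.pow_apply, Pi.mul_apply, mul_one]
    linear_combination (-2 * kGamma c k₀ k₁ θ) * hm - (Real.cos (2 * θ) ^ m * kAlpha c k₀ k₁ θ) * hsi
      + 2 * m * Real.cos (2 * θ) ^ (m - 1) * kGamma c k₀ k₁ θ * hs
  · refine tendsto_zero_of_tan_bound (C := 2 * C) h fun θ h0 h1 => ?_
    have h2 := (hb θ h0 h1).2.2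
    have h3 := sin_two_le_tan h0 h1
    have f3 := (arc_facts h0 h1).2.2.1
    rw [abs_mul, abs_mul]
    calc _ ≤ 1 * (2 * Real.tan θ * (C * kBound k₀ k₁ θ)) := by
          gcongr
          exact abs_cos_pow_le _ _
      _ = _ := by ring
  · refine squeeze_zero_norm' ?_ (tendsto_zero_iff_norm_tendsto_zero.1 (tendsto_kGamma_end h c))
    filter_upwards with θ
    rw [norm_mul, norm_mul]
    calc _ ≤ 1 * (1 * ‖kGamma c k₀ k₁ θ‖) := by
          gcongr
          · exact abs_cos_pow_le _ _
          · exact Real.abs_sin_le_one _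
      _ = _ := by ring

/-- Integrates the derivative of `cos(2θ)^(m+1) sin(2θ) α`; the cosine and the sine cancel the two
poles of `α'`. -/
theorem integral_cos_pow_kAlpha (h : Adm k₀ k₁) (c : ℝ) (m : ℕ) :
    (m + 2) * (∫ θ in (0 : ℝ)..(Real.pi / 4), Real.cos (2 * θ) ^ (m + 2) * kAlpha c k₀ k₁ θ)
      = (m + 1) * (∫ θ in (0 : ℝ)..(Real.pi / 4), Real.cos (2 * θ) ^ m * kAlpha c k₀ k₁ θ)
      + 2 * k₀ * (∫ θ in (0 : ℝ)..(Real.pi / 4),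
          Real.cos (2 * θ) ^ m * (Real.sin (2 * θ) * kBeta c k₀ k₁ θ))
      - 2 * k₁ * ∫ θ in (0 : ℝ)..(Real.pi / 4), Real.cos (2 * θ) ^ (m + 1) * kGamma c k₀ k₁ θ := by
  obtain ⟨ia, ib, ig⟩ := intervalIntegrable_k h c
  obtain ⟨C, hC, hb⟩ := k_bounds h c
  have i1 : ∀ m : ℕ, IntervalIntegrable (fun θ => Real.cos (2 * θ) ^ m * kGamma c k₀ k₁ θ) volume 0
      (Real.pi / 4) := fun m => ig.continuousOn_mul (by fun_prop)
  have i2 : ∀ m : ℕ, IntervalIntegrable (fun θ => Real.cos (2 * θ) ^ m * kAlpha c k₀ k₁ θ) volume 0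
      (Real.pi / 4) := fun m => ia.continuousOn_mul (by fun_prop)
  have i3 : IntervalIntegrable (fun θ => Real.cos (2 * θ) ^ m *
      (Real.sin (2 * θ) * kBeta c k₀ k₁ θ)) volume 0 (Real.pi / 4) :=
    (ib.continuousOn_mul (by fun_prop)).continuousOn_mul (by fun_prop)
  have j1 := ((i2 (m + 2)).const_mul (2 * (m + 2))).add ((i2 m).const_mul (-2 * (m + 1)))
  have j2 := (i3.const_mul (-4 * k₀)).add ((i1 (m + 1)).const_mul (4 * k₁))
  have key := intervalIntegral.integral_eq_sub_of_hasDerivAt_of_tendsto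
    (f := fun θ => Real.cos (2 * θ) ^ (m + 1) * (Real.sin (2 * θ) * kAlpha c k₀ k₁ θ))
    (f' := fun θ => ((2 * (m + 2)) * (Real.cos (2 * θ) ^ (m + 2) * kAlpha c k₀ k₁ θ)
      + (-2 * (m + 1)) * (Real.cos (2 * θ) ^ m * kAlpha c k₀ k₁ θ))
      + ((-4 * k₀) * (Real.cos (2 * θ) ^ m * (Real.sin (2 * θ) * kBeta c k₀ k₁ θ))
      + (4 * k₁) * (Real.cos (2 * θ) ^ (m + 1) * kGamma c k₀ k₁ θ)))
    (a := 0) (b := Real.pi / 4) (fa := 0) (fb := 0) (by positivity) ?_ (j1.add j2) ?_ ?_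
  · rw [intervalIntegral.integral_add j1 j2,
      intervalIntegral.integral_add ((i2 (m + 2)).const_mul _) ((i2 m).const_mul _),
      intervalIntegral.integral_add (i3.const_mul _) ((i1 (m + 1)).const_mul _),
      intervalIntegral.integral_const_mul, intervalIntegral.integral_const_mul,
      intervalIntegral.integral_const_mul, intervalIntegral.integral_const_mul] at key
    linear_combination (1 / 2) * key
  · intro θ hθ
    obtain ⟨f1, f2, f3, f4, f5, f6⟩ := arc_facts hθ.1 hθ.2
    have e := (((((hasDerivAt_id θ).const_mul 2).cos).pow (m + 1))).mul
      ((((hasDerivAt_id θ).const_mul 2).sin).mul (hasDerivAt_kAlpha h c hθ.1 hθ.2))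
    convert! e using 1
    have hs : Real.sin (2 * θ) ^ 2 = 1 - Real.cos (2 * θ) ^ 2 := Real.sin_sq _
    have hsi : Real.sin (2 * θ) * (4 * k₁ / Real.sin (2 * θ)) = 4 * k₁ := by field_simp
    have hci : Real.cos (2 * θ) * (4 * k₀ / Real.cos (2 * θ)) = 4 * k₀ := by field_simp
    simp only [id, Pi.pow_apply, Pi.mul_apply, mul_one, Nat.add_sub_cancel]
    push_cast
    linear_combination 2 * (m + 1) * Real.cos (2 * θ) ^ m * kAlpha c k₀ k₁ θ * hs
      + Real.cos (2 * θ) ^ m * Real.sin (2 * θ) * kBeta c k₀ k₁ θ * hci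
      - Real.cos (2 * θ) ^ (m + 1) * kGamma c k₀ k₁ θ * hsi
  · refine tendsto_zero_of_tan_bound (C := 2 * C) h fun θ h0 h1 => ?_
    have h2 := (hb θ h0 h1).1
    have h3 := sin_two_le_tan h0 h1
    have f3 := (arc_facts h0 h1).2.2.1
    rw [abs_mul, abs_mul]
    calc _ ≤ 1 * (2 * Real.tan θ * (C * kBound k₀ k₁ θ)) := by
          gcongr
          exact abs_cos_pow_le _ _
      _ = _ := by ring
  · refine tendsto_zero_of_cos_bound (C := C) h fun θ h0 h1 => ?_
    obtain ⟨f1, f2, f3, f4, f5, f6⟩ := arc_facts h0 h1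
    have h2 := (hb θ h0 h1).1
    rw [pow_succ, abs_mul, abs_mul, abs_mul, abs_of_pos f5]
    calc _ ≤ 1 * Real.cos (2 * θ) * (1 * (C * kBound k₀ k₁ θ)) := by
          gcongr
          · exact abs_cos_pow_le _ _
          · exact Real.abs_sin_le_one _
      _ = _ := by ring

end

end B2

namespace B2

open Filter Topology MeasureTheory MvPolynomial

noncomputable section

variable {k₀ k₁ : ℝ}

/-! ## Moments of the weight -/

/-- The pairing of `φ^{2n} p_{1,2}` with `p_{1,2}` over the circle. -/
def sInt (c k₀ k₁ : ℝ) (n : ℕ) : ℝ :=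
  8 * ∫ θ in (0 : ℝ)..(Real.pi / 4), Real.cos (2 * θ) ^ (2 * n) *
    (kAlpha c k₀ k₁ θ - Real.sin (2 * θ) * kBeta c k₀ k₁ θ - Real.cos (2 * θ) * kGamma c k₀ k₁ θ)

/-- The pairing of `φ^{2n+1} (x₂, x₁)` with `p_{1,2}` over the circle. -/
def tInt (c k₀ k₁ : ℝ) (n : ℕ) : ℝ :=
  8 * ∫ θ in (0 : ℝ)..(Real.pi / 4), Real.cos (2 * θ) ^ (2 * n + 1) *
    (Real.cos (2 * θ) * kAlpha c k₀ k₁ θ - kGamma c k₀ k₁ θ)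

theorem sInt_eq (h : Adm k₀ k₁) (c : ℝ) (n : ℕ) : sInt c k₀ k₁ n =
    8 * ((∫ θ in (0 : ℝ)..(Real.pi / 4), Real.cos (2 * θ) ^ (2 * n) * kAlpha c k₀ k₁ θ)
      - (∫ θ in (0 : ℝ)..(Real.pi / 4),
          Real.cos (2 * θ) ^ (2 * n) * (Real.sin (2 * θ) * kBeta c k₀ k₁ θ))
      - ∫ θ in (0 : ℝ)..(Real.pi / 4), Real.cos (2 * θ) ^ (2 * n + 1) * kGamma c k₀ k₁ θ) := by
  obtain ⟨ia, ib, ig⟩ := intervalIntegrable_k h c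
  have i1 : IntervalIntegrable (fun θ => Real.cos (2 * θ) ^ (2 * n) * kAlpha c k₀ k₁ θ) volume 0
      (Real.pi / 4) := ia.continuousOn_mul (by fun_prop)
  have i2 : IntervalIntegrable (fun θ => Real.cos (2 * θ) ^ (2 * n) *
      (Real.sin (2 * θ) * kBeta c k₀ k₁ θ)) volume 0 (Real.pi / 4) :=
    (ib.continuousOn_mul (by fun_prop)).continuousOn_mul (by fun_prop)
  have i3 : IntervalIntegrable (fun θ => Real.cos (2 * θ) ^ (2 * n + 1) * kGamma c k₀ k₁ θ) volume 0
      (Real.pi / 4) := ig.continuousOn_mul (by fun_prop)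
  rw [sInt, ← intervalIntegral.integral_sub i1 i2, ← intervalIntegral.integral_sub (i1.sub i2) i3]
  congr 2
  ext θ
  ring

theorem tInt_eq (h : Adm k₀ k₁) (c : ℝ) (n : ℕ) : tInt c k₀ k₁ n =
    8 * ((∫ θ in (0 : ℝ)..(Real.pi / 4), Real.cos (2 * θ) ^ (2 * n + 2) * kAlpha c k₀ k₁ θ)
      - ∫ θ in (0 : ℝ)..(Real.pi / 4), Real.cos (2 * θ) ^ (2 * n + 1) * kGamma c k₀ k₁ θ) := by
  obtain ⟨ia, ib, ig⟩ := intervalIntegrable_k h c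
  have i1 : IntervalIntegrable (fun θ => Real.cos (2 * θ) ^ (2 * n + 2) * kAlpha c k₀ k₁ θ) volume 0
      (Real.pi / 4) := ia.continuousOn_mul (by fun_prop)
  have i3 : IntervalIntegrable (fun θ => Real.cos (2 * θ) ^ (2 * n + 1) * kGamma c k₀ k₁ θ) volume 0
      (Real.pi / 4) := ig.continuousOn_mul (by fun_prop)
  rw [tInt, ← intervalIntegral.integral_sub i1 i3]
  congr 2
  ext θ
  ring

/-- At exponent `0` the moments of `β` and `γ` reduce to the mean of `α`, which is the quantity
fixed by the Gaussian normalization. -/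
theorem sInt_zero (h : Adm k₀ k₁) (c : ℝ) : sInt c k₀ k₁ 0 =
    (1 + 2 * k₀ + 2 * k₁) * (8 * ∫ θ in (0 : ℝ)..(Real.pi / 4), kAlpha c k₀ k₁ θ) := by
  have r1 := integral_cos_pow_sin_kBeta h c 0
  have r2 := integral_cos_pow_kGamma h c 0
  rw [sInt_eq h]
  simp only [Nat.cast_zero, mul_zero, zero_add, zero_mul, pow_zero, one_mul] at r1 r2 ⊢
  linear_combination -8 * r1 - 8 * r2

theorem tInt_zero (h : Adm k₀ k₁) (c : ℝ) :
    2 * tInt c k₀ k₁ 0 = (1 + 2 * k₁ - 2 * k₀) * sInt c k₀ k₁ 0 := by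
  have r1 := integral_cos_pow_sin_kBeta h c 0
  have r2 := integral_cos_pow_kGamma h c 0
  have r3 := integral_cos_pow_kAlpha h c 0
  rw [sInt_eq h, tInt_eq h]
  simp only [Nat.cast_zero, mul_zero, zero_add, zero_mul, pow_zero, one_mul] at r1 r2 r3 ⊢
  linear_combination 8 * r3 + 8 * (1 + 2 * k₁) * r1 - 8 * (1 + 2 * k₀) * r2

/-- This relation and the next eliminate the separate moments. Together with the initial ones they
are the hypotheses of `curl_lapL_pow`. -/
theorem sInt_succ (h : Adm k₀ k₁) (c : ℝ) (n : ℕ) : (2 * n + 3) * sInt c k₀ k₁ (n + 1) =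
    (2 * n + 1 - 2 * k₀) * sInt c k₀ k₁ n + (1 + 2 * k₀ + 2 * k₁) * tInt c k₀ k₁ n := by
  have r1 := integral_cos_pow_sin_kBeta h c (2 * n)
  have r1' := integral_cos_pow_sin_kBeta h c (2 * n + 2)
  have r2 := integral_cos_pow_kGamma h c (2 * n + 2)
  have r3 := integral_cos_pow_kAlpha h c (2 * n)
  rw [sInt_eq h, sInt_eq h, tInt_eq h, show 2 * (n + 1) = 2 * n + 2 by ring]
  rw [show 2 * n + 2 - 1 = 2 * n + 1 by omega] at r2
  push_cast at r1 r1' r2 r3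
  linear_combination -8 * r1' - 8 * r2 + 8 * r3 + 8 * r1

theorem tInt_succ (h : Adm k₀ k₁) (c : ℝ) (n : ℕ) :
    (2 * n + 3) * (2 * n + 4) * tInt c k₀ k₁ (n + 1) =
    (2 * n + 2) * (2 * n + 3 + 2 * k₀) * tInt c k₀ k₁ n
      + (2 * n + 3) * (1 + 2 * k₁ - 2 * k₀) * sInt c k₀ k₁ (n + 1) := by
  have r1' := integral_cos_pow_sin_kBeta h c (2 * n + 2)
  have r2 := integral_cos_pow_kGamma h c (2 * n + 2)
  have r3' := integral_cos_pow_kAlpha h c (2 * n + 2)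
  rw [sInt_eq h, tInt_eq h, tInt_eq h, show 2 * (n + 1) = 2 * n + 2 by ring]
  rw [show 2 * n + 2 - 1 = 2 * n + 1 by omega] at r2
  push_cast at r1' r2 r3'
  linear_combination 8 * (2 * n + 3) * r3' + 8 * (1 + 2 * k₁) * r1' - 8 * (2 * n + 3 + 2 * k₀) * r2

theorem matL_tan {θ : ℝ} (h0 : 0 < θ) (h1 : θ < Real.pi / 4) :
    matL k₀ k₁ (Real.tan θ) = !![rowA k₀ k₁ (Real.tan θ), rowB k₀ k₁ (Real.tan θ);
      rowB k₀ (-k₁) (Real.tan θ), rowA k₀ (-k₁) (Real.tan θ)] := by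
  have hp := (arc_facts h0 h1).2.2.1
  rw [matL, abs_of_pos hp]
  simp only [rowA, rowB]
  congr 1
  ring_nf

theorem chamberK_arc (c : ℝ) {θ r : ℝ} (h0 : 0 < θ) (h1 : θ < Real.pi / 4) (hr : 0 < r) :
    chamberK c k₀ k₁ ![r * Real.cos θ, r * Real.sin θ] =
      !![kAlpha c k₀ k₁ θ + kGamma c k₀ k₁ θ, kBeta c k₀ k₁ θ;
         kBeta c k₀ k₁ θ, kAlpha c k₀ k₁ θ - kGamma c k₀ k₁ θ] := by
  have e : (![r * Real.cos θ, r * Real.sin θ] : Fin 2 → ℝ) 1 /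
      (![r * Real.cos θ, r * Real.sin θ] : Fin 2 → ℝ) 0 = Real.tan θ := by
    simp only [Matrix.cons_val_zero, Matrix.cons_val_one]
    rw [mul_div_mul_left _ _ hr.ne', Real.tan_eq_sin_div_cos]
  rw [chamberK, e, matL_tan h0 h1]
  ext i j
  fin_cases i <;> fin_cases j <;>
    simp [Matrix.mul_apply, Fin.sum_univ_two, kAlpha, kBeta, kGamma] <;> ring

theorem weightK_arc (c : ℝ) {θ r : ℝ} (h0 : 0 < θ) (h1 : θ < Real.pi / 4) (hr : 0 < r) :
    weightK c k₀ k₁ ![r * Real.cos θ, r * Real.sin θ] =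
      !![kAlpha c k₀ k₁ θ + kGamma c k₀ k₁ θ, kBeta c k₀ k₁ θ;
         kBeta c k₀ k₁ θ, kAlpha c k₀ k₁ θ - kGamma c k₀ k₁ θ] := by
  obtain ⟨f1, f2, f3, f4, f5, f6⟩ := arc_facts h0 h1
  have hsc : r * Real.sin θ < r * Real.cos θ := by
    rw [Real.tan_eq_sin_div_cos, div_lt_one f1] at f4
    gcongr
  have p1 : 0 < r * Real.cos θ := by positivity
  have p2 : 0 < r * Real.sin θ := by positivity
  rw [weightK]
  have e : chamberElt ![r * Real.cos θ, r * Real.sin θ] = 1 := by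
    simp only [chamberElt, Matrix.cons_val_zero, Matrix.cons_val_one, abs_of_pos p1, abs_of_pos p2,
      if_pos hsc, Real.sign_of_pos p1, Real.sign_of_pos p2, one_mul]
    ext i j
    fin_cases i <;> fin_cases j <;> simp
  rw [e]
  simp only [Matrix.cons_val_zero, Matrix.cons_val_one, abs_of_pos p1, abs_of_pos p2,
    max_eq_left hsc.le, min_eq_right hsc.le, Matrix.transpose_one, one_mul, mul_one]
  exact chamberK_arc c h0 h1 hr

theorem integrand_eq (n : ℕ) {θ : ℝ} (h0 : 0 < θ) (h1 : θ < Real.pi / 4) :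
    integrand k₀ k₁ n θ = Real.cos (2 * θ) ^ (2 * n) *
      (kAlpha (normConst k₀ k₁) k₀ k₁ θ - Real.sin (2 * θ) * kBeta (normConst k₀ k₁) k₀ k₁ θ
        - Real.cos (2 * θ) * kGamma (normConst k₀ k₁) k₀ k₁ θ) := by
  have e := weightK_arc (k₀ := k₀) (k₁ := k₁) (normConst k₀ k₁) h0 h1 one_pos
  simp only [one_mul] at e
  have e2 : eval (circ θ) phi = Real.cos (2 * θ) := by
    simp [phi, circ, Real.cos_two_mul']
  have e3 : evalPV (circ θ) p12 = ![-Real.sin θ, Real.cos θ] := by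
    ext i; fin_cases i <;> simp [evalPV, p12, circ]
  rw [integrand, e2, e3, K, circ, e]
  congr 1
  simp [Matrix.mulVec, dotProduct, Fin.sum_univ_two]
  rw [Real.cos_two_mul', Real.sin_two_mul]
  linear_combination (kAlpha (normConst k₀ k₁) k₀ k₁ θ) * Real.sin_sq_add_cos_sq θ

theorem intervalIntegrable_integrand (h : Adm k₀ k₁) (n : ℕ) :
    IntervalIntegrable (integrand k₀ k₁ n) volume 0 (Real.pi / 4) := by
  obtain ⟨ia, ib, ig⟩ := intervalIntegrable_k h (normConst k₀ k₁)
  have i : IntervalIntegrable (fun θ => Real.cos (2 * θ) ^ (2 * n) *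
      (kAlpha (normConst k₀ k₁) k₀ k₁ θ - Real.sin (2 * θ) * kBeta (normConst k₀ k₁) k₀ k₁ θ
        - Real.cos (2 * θ) * kGamma (normConst k₀ k₁) k₀ k₁ θ)) volume 0 (Real.pi / 4) :=
    ((ia.sub (ib.continuousOn_mul (by fun_prop))).sub
      (ig.continuousOn_mul (by fun_prop))).continuousOn_mul (by fun_prop)
  rw [intervalIntegrable_iff_integrableOn_Ioo_of_le (by positivity)] at i ⊢
  exact i.congr_fun (fun θ hθ => (integrand_eq n hθ.1 hθ.2).symm) measurableSet_Ioo

theorem integral_integrand (n : ℕ) :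
    8 * ∫ θ in (0 : ℝ)..(Real.pi / 4), integrand k₀ k₁ n θ = sInt (normConst k₀ k₁) k₀ k₁ n := by
  rw [sInt, intervalIntegral.integral_of_le (by positivity),
    intervalIntegral.integral_of_le (by positivity), integral_Ioc_eq_integral_Ioo,
    integral_Ioc_eq_integral_Ioo]
  congr 1
  exact setIntegral_congr_fun measurableSet_Ioo fun θ hθ => integrand_eq n hθ.1 hθ.2

/-! ## The normalizing integral in polar coordinates -/

theorem weightK_zero_zero (c a b : ℝ) : weightK c k₀ k₁ ![a, b] 0 0 =
    Real.sign a ^ 2 * if |b| < |a| then chamberK c k₀ k₁ ![|a|, |b|] 0 0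
      else chamberK c k₀ k₁ ![|b|, |a|] 1 1 := by
  by_cases h : |b| < |a|
  · simp [weightK, chamberElt, h, Matrix.mul_apply, Fin.sum_univ_two, max_eq_left h.le,
      min_eq_right h.le]
    ring
  · have h' := not_lt.1 h
    simp [weightK, chamberElt, h, Matrix.mul_apply, Fin.sum_univ_two, max_eq_right h',
      min_eq_left h', Matrix.vecMul_diagonal]
    ring

theorem chamberK_smul (c a b : ℝ) {r : ℝ} (hr : 0 < r) :
    chamberK c k₀ k₁ ![r * a, r * b] = chamberK c k₀ k₁ ![a, b] := by
  simp only [chamberK, Matrix.cons_val_zero, Matrix.cons_val_one, mul_div_mul_left _ _ hr.ne']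

theorem weightK_smul_zero_zero (c a b : ℝ) {r : ℝ} (hr : 0 < r) :
    weightK c k₀ k₁ ![r * a, r * b] 0 0 = weightK c k₀ k₁ ![a, b] 0 0 := by
  have hs : Real.sign (r * a) = Real.sign a := by
    rcases lt_trichotomy a 0 with ha | rfl | ha
    · rw [Real.sign_of_neg ha, Real.sign_of_neg (mul_neg_of_pos_of_neg hr ha)]
    · rw [mul_zero]
    · rw [Real.sign_of_pos ha, Real.sign_of_pos (mul_pos hr ha)]
  rw [weightK_zero_zero, weightK_zero_zero, hs]
  simp only [abs_mul, abs_of_pos hr, mul_lt_mul_iff_right₀ hr, chamberK_smul c _ _ hr]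

/-- The upper left entry of the weight on the unit circle. -/
def circK (c k₀ k₁ θ : ℝ) : ℝ := weightK c k₀ k₁ ![Real.cos θ, Real.sin θ] 0 0

theorem circK_neg (c θ : ℝ) : circK c k₀ k₁ (-θ) = circK c k₀ k₁ θ := by
  simp [circK, weightK_zero_zero]

theorem circK_pi_sub (c θ : ℝ) : circK c k₀ k₁ (Real.pi - θ) = circK c k₀ k₁ θ := by
  simp [circK, weightK_zero_zero, Real.sign_neg]

theorem circK_arc (c : ℝ) {θ : ℝ} (h0 : 0 < θ) (h1 : θ < Real.pi / 4) :
    circK c k₀ k₁ θ = kAlpha c k₀ k₁ θ + kGamma c k₀ k₁ θ := by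
  have := weightK_arc (k₀ := k₀) (k₁ := k₁) c h0 h1 one_pos
  simp only [one_mul] at this
  rw [circK, this]; rfl

theorem circK_arc' (c : ℝ) {θ : ℝ} (h0 : 0 < θ) (h1 : θ < Real.pi / 4) :
    circK c k₀ k₁ (Real.pi / 2 - θ) = kAlpha c k₀ k₁ θ - kGamma c k₀ k₁ θ := by
  obtain ⟨f1, f2, f3, f4, f5, f6⟩ := arc_facts h0 h1
  have hsc : Real.sin θ < Real.cos θ := by
    rwa [Real.tan_eq_sin_div_cos, div_lt_one f1] at f4
  have := chamberK_arc (k₀ := k₀) (k₁ := k₁) c h0 h1 one_pos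
  simp only [one_mul] at this
  rw [circK, Real.cos_pi_div_two_sub, Real.sin_pi_div_two_sub, weightK_zero_zero, abs_of_pos f1,
    abs_of_pos f2, if_neg (by linarith), Real.sign_of_pos f2, this]
  simp

theorem intervalIntegrable_congr_Ioo {f g : ℝ → ℝ} {a b : ℝ} (hab : a ≤ b)
    (hfg : ∀ x ∈ Set.Ioo a b, f x = g x) (hf : IntervalIntegrable f volume a b) :
    IntervalIntegrable g volume a b ∧ ∫ x in a..b, g x = ∫ x in a..b, f x := by
  constructor
  · rw [intervalIntegrable_iff_integrableOn_Ioo_of_le hab] at hf ⊢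
    exact hf.congr_fun hfg measurableSet_Ioo
  · rw [intervalIntegral.integral_of_le hab, intervalIntegral.integral_of_le hab,
      integral_Ioc_eq_integral_Ioo, integral_Ioc_eq_integral_Ioo]
    exact setIntegral_congr_fun measurableSet_Ioo fun x hx => (hfg x hx).symm

/-- The circle splits into eight arcs congruent under the reflection group. They contribute `α + γ`
and `α - γ` equally often, so `γ` cancels. -/
theorem integral_circK (h : Adm k₀ k₁) (c : ℝ) :
    IntervalIntegrable (circK c k₀ k₁) volume (-Real.pi) Real.pi ∧
    ∫ θ in (-Real.pi)..Real.pi, circK c k₀ k₁ θ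
      = 8 * ∫ θ in (0 : ℝ)..(Real.pi / 4), kAlpha c k₀ k₁ θ := by
  have hpi := Real.pi_pos
  obtain ⟨ia, ib, ig⟩ := intervalIntegrable_k h c
  obtain ⟨i1, e1⟩ := intervalIntegrable_congr_Ioo (f := fun θ => kAlpha c k₀ k₁ θ + kGamma c k₀ k₁ θ)
    (g := circK c k₀ k₁) (by positivity) (fun θ hθ => (circK_arc c hθ.1 hθ.2).symm) (ia.add ig)
  have j2 := (ia.sub ig).comp_sub_left (Real.pi / 2)
  rw [sub_zero, show Real.pi / 2 - Real.pi / 4 = Real.pi / 4 by ring] at j2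
  obtain ⟨i2, e2⟩ := intervalIntegrable_congr_Ioo (a := Real.pi / 4) (b := Real.pi / 2)
    (g := circK c k₀ k₁) (by linarith) (fun θ hθ => by
      have := circK_arc' (k₀ := k₀) (k₁ := k₁) c (θ := Real.pi / 2 - θ) (by linarith [hθ.2])
        (by linarith [hθ.1])
      rw [sub_sub_cancel] at this
      exact this.symm) j2.symm
  rw [intervalIntegral.integral_comp_sub_left
    (fun x => kAlpha c k₀ k₁ x - kGamma c k₀ k₁ x)] at e2
  rw [sub_self, show Real.pi / 2 - Real.pi / 4 = Real.pi / 4 by ring] at e2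
  have i12 := i1.trans i2
  have e12 : ∫ θ in (0 : ℝ)..(Real.pi / 2), circK c k₀ k₁ θ
      = 2 * ∫ θ in (0 : ℝ)..(Real.pi / 4), kAlpha c k₀ k₁ θ := by
    rw [← intervalIntegral.integral_add_adjacent_intervals i1 i2, e1, e2,
      intervalIntegral.integral_add ia ig, intervalIntegral.integral_sub ia ig]
    ring
  have i3 : IntervalIntegrable (circK c k₀ k₁) volume (Real.pi / 2) Real.pi := by
    have := i12.comp_sub_left Real.pi
    simp only [circK_pi_sub] at this
    rw [sub_zero, show Real.pi - Real.pi / 2 = Real.pi / 2 by ring] at this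
    exact this.symm
  have e3 : ∫ θ in (Real.pi / 2)..Real.pi, circK c k₀ k₁ θ
      = ∫ θ in (0 : ℝ)..(Real.pi / 2), circK c k₀ k₁ θ := by
    have := intervalIntegral.integral_comp_sub_left (a := Real.pi / 2) (b := Real.pi)
      (circK c k₀ k₁) Real.pi
    simp only [circK_pi_sub] at this
    rw [this, sub_self, show Real.pi - Real.pi / 2 = Real.pi / 2 by ring]
  have i4 := i12.trans i3
  have e4 := intervalIntegral.integral_add_adjacent_intervals i12 i3
  have i5 : IntervalIntegrable (circK c k₀ k₁) volume (-Real.pi) 0 := by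
    have := i4.comp_sub_left 0
    simp only [zero_sub, neg_zero, circK_neg] at this
    exact this.symm
  have e5 : ∫ θ in (-Real.pi)..0, circK c k₀ k₁ θ = ∫ θ in (0 : ℝ)..Real.pi, circK c k₀ k₁ θ := by
    have := intervalIntegral.integral_comp_neg (a := -Real.pi) (b := 0) (circK c k₀ k₁)
    simp only [circK_neg, neg_zero, neg_neg] at this
    exact this
  refine ⟨i5.trans i4, ?_⟩
  rw [← intervalIntegral.integral_add_adjacent_intervals i5 i4, e5, ← e4, e3, e12]
  ring

theorem integral_radial : IntegrableOn (fun r : ℝ => r * Real.exp (-r ^ 2 / 2)) (Set.Ioi 0) ∧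
    ∫ r in Set.Ioi (0 : ℝ), r * Real.exp (-r ^ 2 / 2) = 1 := by
  have e : (fun r : ℝ => r * Real.exp (-r ^ 2 / 2)) = fun r => r * Real.exp (-(1 / 2) * r ^ 2) := by
    ext r; ring_nf
  rw [e]
  refine ⟨(integrable_mul_exp_neg_mul_sq (by norm_num)).integrableOn, ?_⟩
  have := integral_rpow_mul_exp_neg_mul_rpow (p := 2) (q := 1) (b := 1 / 2) (by norm_num)
    (by norm_num) (by norm_num)
  simp only [Real.rpow_one, Real.rpow_two] at this
  rw [this]
  norm_num [Real.rpow_neg_one]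

/-- The weight is homogeneous of degree zero, so polar coordinates separate the integral; the radial
factor `∫ r exp(-r²/2) dr` equals `1`. -/
theorem integral_weight_gaussian (h : Adm k₀ k₁) (c : ℝ) :
    Integrable (fun x : ℝ × ℝ =>
      weightK c k₀ k₁ ![x.1, x.2] 0 0 * Real.exp (-(x.1 ^ 2 + x.2 ^ 2) / 2)) ∧
    ∫ x : ℝ × ℝ, weightK c k₀ k₁ ![x.1, x.2] 0 0 * Real.exp (-(x.1 ^ 2 + x.2 ^ 2) / 2)
      = 8 * ∫ θ in (0 : ℝ)..(Real.pi / 4), kAlpha c k₀ k₁ θ := by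
  have hpi := Real.pi_pos
  obtain ⟨ic, ec⟩ := integral_circK h c
  obtain ⟨ir, er⟩ := integral_radial
  rw [intervalIntegrable_iff_integrableOn_Ioo_of_le (by linarith)] at ic
  rw [intervalIntegral.integral_of_le (by linarith), integral_Ioc_eq_integral_Ioo] at ec
  set g : ℝ × ℝ → ℝ := fun x =>
    weightK c k₀ k₁ ![x.1, x.2] 0 0 * Real.exp (-(x.1 ^ 2 + x.2 ^ 2) / 2) with hg
  have hpt : ∀ p ∈ polarCoord.target, p.1 • g (polarCoord.symm p)
      = (p.1 * Real.exp (-p.1 ^ 2 / 2)) * circK c k₀ k₁ p.2 := by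
    intro p hp
    have hr : 0 < p.1 := hp.1
    have e1 : (p.1 * Real.cos p.2) ^ 2 + (p.1 * Real.sin p.2) ^ 2 = p.1 ^ 2 := by
      linear_combination p.1 ^ 2 * Real.sin_sq_add_cos_sq p.2
    simp only [hg, polarCoord_symm_apply, smul_eq_mul, weightK_smul_zero_zero c _ _ hr, e1, circK]
    ring
  have hprod : IntegrableOn (fun p : ℝ × ℝ => (p.1 * Real.exp (-p.1 ^ 2 / 2)) * circK c k₀ k₁ p.2)
      polarCoord.target := by
    have := Integrable.mul_prod (μ := volume.restrict (Set.Ioi (0 : ℝ)))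
      (ν := volume.restrict (Set.Ioo (-Real.pi) Real.pi)) ir ic
    rw [Measure.prod_restrict] at this
    exact this
  constructor
  · have himg : polarCoord.symm '' polarCoord.target = polarCoord.source :=
      polarCoord.symm_image_target_eq_source
    have h1 : IntegrableOn g (polarCoord.symm '' polarCoord.target) := by
      rw [integrableOn_image_iff_integrableOn_abs_det_fderiv_smul volume
        polarCoord.open_target.measurableSet
        (fun p _ => (hasFDerivAt_polarCoord_symm p).hasFDerivWithinAt) polarCoord.symm.injOn]
      refine hprod.congr_fun (fun p hp => ?_) polarCoord.open_target.measurableSet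
      have hr : 0 < p.1 := hp.1
      simp only [det_fderivPolarCoordSymm, abs_of_pos hr]
      exact (hpt p hp).symm
    rw [himg] at h1
    rw [← integrableOn_univ]
    exact h1.congr_set_ae polarCoord_source_ae_eq_univ.symm
  · rw [← integral_comp_polarCoord_symm,
      setIntegral_congr_fun polarCoord.open_target.measurableSet hpt, polarCoord_target,
      Measure.volume_eq_prod, ← Measure.prod_restrict]
    rw [integral_prod_mul (fun r : ℝ => r * Real.exp (-r ^ 2 / 2)) (circK c k₀ k₁), er, one_mul, ec]

theorem d_pos (h : Adm k₀ k₁) : 0 < d1 1 k₀ k₁ ∧ 0 < d2 1 k₀ k₁ := by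
  obtain ⟨b1, b2, b3, b4, b5, b6, b7, b8⟩ := h.bounds
  have hpi := Real.pi_pos
  have hc : 0 < Real.cos (Real.pi * k₀) :=
    Real.cos_pos_of_mem_Ioo ⟨by nlinarith, by nlinarith⟩
  have g1 := Real.Gamma_pos_of_pos (show 0 < 1 / 2 - k₁ by linarith)
  have g2 := Real.Gamma_pos_of_pos (show 0 < 1 / 2 + k₁ by linarith)
  have g3 := Real.Gamma_pos_of_pos (show 0 < 1 / 2 + k₀ - k₁ by linarith)
  have g4 := Real.Gamma_pos_of_pos (show 0 < 1 / 2 - k₀ - k₁ by linarith)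
  have g5 := Real.Gamma_pos_of_pos (show 0 < 1 / 2 + k₀ + k₁ by linarith)
  have g6 := Real.Gamma_pos_of_pos (show 0 < 1 / 2 - k₀ + k₁ by linarith)
  constructor
  · unfold d1; positivity
  · unfold d2; positivity

theorem kAlpha_eq_mul (c θ : ℝ) : kAlpha c k₀ k₁ θ = c * kAlpha 1 k₀ k₁ θ := by
  simp only [kAlpha, d1, d2]; ring

/-- Positivity makes the inverse defining `normConst` a genuine one and keeps the asymptotic
constant nonzero. -/
theorem integral_kAlpha_pos (h : Adm k₀ k₁) :
    0 < ∫ θ in (0 : ℝ)..(Real.pi / 4), kAlpha 1 k₀ k₁ θ := by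
  refine intervalIntegral.intervalIntegral_pos_of_pos_on (intervalIntegrable_k h 1).1
    (fun θ hθ => ?_) (by positivity)
  obtain ⟨f1, f2, f3, f4, f5, f6⟩ := arc_facts hθ.1 hθ.2
  have hA := rowA_pos h f3 f4
  obtain ⟨p1, p2⟩ := d_pos h
  unfold kAlpha
  positivity

theorem normConst_eq (h : Adm k₀ k₁) :
    normConst k₀ k₁ = (8 * ∫ θ in (0 : ℝ)..(Real.pi / 4), kAlpha 1 k₀ k₁ θ)⁻¹ := by
  rw [normConst, (integral_weight_gaussian h 1).2]

theorem normConst_pos (h : Adm k₀ k₁) : 0 < normConst k₀ k₁ := by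
  rw [normConst_eq h]
  have := integral_kAlpha_pos h
  positivity

theorem integral_kAlpha_normConst (h : Adm k₀ k₁) :
    8 * ∫ θ in (0 : ℝ)..(Real.pi / 4), kAlpha (normConst k₀ k₁) k₀ k₁ θ = 1 := by
  have hp := integral_kAlpha_pos h
  simp only [kAlpha_eq_mul (normConst k₀ k₁)]
  rw [intervalIntegral.integral_const_mul, normConst_eq h]
  field_simp

/-! ## Calculus of the Dunkl operators -/

theorem subst_add (w : Matrix (Fin 2) (Fin 2) ℝ) (p q : Poly) :
    subst w (p + q) = subst w p + subst w q := map_add _ _ _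

theorem subst_mul (w : Matrix (Fin 2) (Fin 2) ℝ) (p q : Poly) :
    subst w (p * q) = subst w p * subst w q := map_mul _ _ _

theorem subst_sub (w : Matrix (Fin 2) (Fin 2) ℝ) (p q : Poly) :
    subst w (p - q) = subst w p - subst w q := map_sub _ _ _

theorem subst_neg (w : Matrix (Fin 2) (Fin 2) ℝ) (p : Poly) :
    subst w (-p) = -subst w p := map_neg _ _

theorem subst_pow (w : Matrix (Fin 2) (Fin 2) ℝ) (p : Poly) (n : ℕ) :
    subst w (p ^ n) = subst w p ^ n := map_pow _ _ _

theorem subst_C (w : Matrix (Fin 2) (Fin 2) ℝ) (a : ℝ) : subst w (C a) = C a := by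
  simp [subst]

theorem linForm_ne_zero (r : Fin 4) : linForm (root r) ≠ 0 := by
  intro h
  -- The point `(2, 1)` lies on none of the four mirrors.
  have h0 := congrArg (eval ![2, 1]) h
  fin_cases r <;> norm_num [linForm, root, Fin.sum_univ_two] at h0

theorem linForm_mul_divDiff (v : Fin 2 → ℝ) (p : Poly) :
    linForm v * divDiff v p = p - subst (refl v) p := (linForm_dvd v p).choose_spec.symm

/-- `divDiff` is a chosen witness of divisibility. Cancelling the nonzero linear form determines it,
and every computation below goes through this characterization. -/
theorem divDiff_eq {r : Fin 4} {p q : Poly}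
    (h : linForm (root r) * q = p - subst (refl (root r)) p) : divDiff (root r) p = q :=
  mul_left_cancel₀ (linForm_ne_zero r) (by rw [linForm_mul_divDiff, h])

theorem divDiff_add (r : Fin 4) (p q : Poly) :
    divDiff (root r) (p + q) = divDiff (root r) p + divDiff (root r) q :=
  divDiff_eq (by rw [mul_add, linForm_mul_divDiff, linForm_mul_divDiff, subst_add]; ring)

theorem divDiff_sub (r : Fin 4) (p q : Poly) :
    divDiff (root r) (p - q) = divDiff (root r) p - divDiff (root r) q :=
  divDiff_eq (by rw [mul_sub, linForm_mul_divDiff, linForm_mul_divDiff, subst_sub]; ring)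

theorem divDiff_neg (r : Fin 4) (p : Poly) : divDiff (root r) (-p) = -divDiff (root r) p :=
  divDiff_eq (by rw [mul_neg, linForm_mul_divDiff, subst_neg]; ring)

theorem divDiff_mul (r : Fin 4) (p q : Poly) : divDiff (root r) (p * q)
    = divDiff (root r) p * q + subst (refl (root r)) p * divDiff (root r) q :=
  divDiff_eq (by
    rw [subst_mul]
    linear_combination q * linForm_mul_divDiff (root r) p
      + subst (refl (root r)) p * linForm_mul_divDiff (root r) q)

theorem divDiff_C (r : Fin 4) (a : ℝ) : divDiff (root r) (C a) = 0 :=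
  divDiff_eq (by rw [subst_C]; ring)

/-! ### The four reflections and the Dunkl operators in coordinates. -/

theorem refl_root_zero : refl (root 0) = !![0, 1; 1, 0] := by
  ext i j; fin_cases i <;> fin_cases j <;>
    norm_num [refl, root, Matrix.vecMulVec_apply, dotProduct, Fin.sum_univ_two]

theorem refl_root_one : refl (root 1) = !![0, -1; -1, 0] := by
  ext i j; fin_cases i <;> fin_cases j <;>
    norm_num [refl, root, Matrix.vecMulVec_apply, dotProduct, Fin.sum_univ_two]

theorem refl_root_two : refl (root 2) = !![-1, 0; 0, 1] := by
  rw [show root 2 = ![1, 0] from rfl]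
  ext i j; fin_cases i <;> fin_cases j <;>
    norm_num [refl, root, Matrix.vecMulVec_apply, dotProduct, Fin.sum_univ_two]

theorem refl_root_three : refl (root 3) = !![1, 0; 0, -1] := by
  rw [show root 3 = ![0, 1] from rfl]
  ext i j; fin_cases i <;> fin_cases j <;>
    norm_num [refl, root, Matrix.vecMulVec_apply, dotProduct, Fin.sum_univ_two]

theorem subst_root_zero_X : subst (refl (root 0)) (X 0) = X 1 ∧
    subst (refl (root 0)) (X 1) = X 0 := by
  rw [refl_root_zero]; constructor <;> simp [subst, Fin.sum_univ_two]

theorem subst_root_one_X : subst (refl (root 1)) (X 0) = -X 1 ∧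
    subst (refl (root 1)) (X 1) = -X 0 := by
  rw [refl_root_one]; constructor <;> simp [subst, Fin.sum_univ_two]

theorem subst_root_two_X : subst (refl (root 2)) (X 0) = -X 0 ∧
    subst (refl (root 2)) (X 1) = X 1 := by
  rw [refl_root_two]; constructor <;> simp [subst, Fin.sum_univ_two]

theorem subst_root_three_X : subst (refl (root 3)) (X 0) = X 0 ∧
    subst (refl (root 3)) (X 1) = -X 1 := by
  rw [refl_root_three]; constructor <;> simp [subst, Fin.sum_univ_two]

theorem linForm_root : linForm (root 0) = X 0 - X 1 ∧ linForm (root 1) = X 0 + X 1 ∧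
    linForm (root 2) = X 0 ∧ linForm (root 3) = X 1 := by
  refine ⟨?_, ?_, ?_, ?_⟩ <;> simp [linForm, root, Fin.sum_univ_two]
  ring

theorem divDiff_root_zero_X : divDiff (root 0) (X 0) = 1 ∧ divDiff (root 0) (X 1) = -1 := by
  constructor <;> apply divDiff_eq <;> simp only [subst_root_zero_X, linForm_root] <;> ring

theorem divDiff_root_one_X : divDiff (root 1) (X 0) = 1 ∧ divDiff (root 1) (X 1) = 1 := by
  constructor <;> apply divDiff_eq <;> simp only [subst_root_one_X, linForm_root] <;> ring

theorem divDiff_root_two_X : divDiff (root 2) (X 0) = 2 ∧ divDiff (root 2) (X 1) = 0 := by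
  constructor <;> apply divDiff_eq <;> simp only [subst_root_two_X, linForm_root] <;> ring

theorem divDiff_root_three_X : divDiff (root 3) (X 0) = 0 ∧ divDiff (root 3) (X 1) = 2 := by
  constructor <;> apply divDiff_eq <;> simp only [subst_root_three_X, linForm_root] <;> ring

theorem dunkl_zero_zero (f : PV) : dunkl k₀ k₁ 0 f 0 = pderiv 0 (f 0) +
    (C k₀ * (divDiff (root 0) (f 1) - divDiff (root 1) (f 1)) - C k₁ * divDiff (root 2) (f 0)) := by
  simp only [dunkl, Fin.sum_univ_four, Fin.sum_univ_two, refl_root_zero, refl_root_one,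
    refl_root_two, refl_root_three]
  simp [mult, root]
  ring

theorem dunkl_zero_one (f : PV) : dunkl k₀ k₁ 0 f 1 = pderiv 0 (f 1) +
    (C k₀ * (divDiff (root 0) (f 0) - divDiff (root 1) (f 0)) + C k₁ * divDiff (root 2) (f 1)) := by
  simp only [dunkl, Fin.sum_univ_four, Fin.sum_univ_two, refl_root_zero, refl_root_one,
    refl_root_two, refl_root_three]
  simp [mult, root]
  ring

theorem dunkl_one_zero (f : PV) : dunkl k₀ k₁ 1 f 0 = pderiv 1 (f 0) +
    (-C k₀ * (divDiff (root 0) (f 1) + divDiff (root 1) (f 1)) + C k₁ * divDiff (root 3) (f 0)) := by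
  simp only [dunkl, Fin.sum_univ_four, Fin.sum_univ_two, refl_root_zero, refl_root_one,
    refl_root_two, refl_root_three]
  simp [mult, root]
  ring

theorem dunkl_one_one (f : PV) : dunkl k₀ k₁ 1 f 1 = pderiv 1 (f 1) +
    (-C k₀ * (divDiff (root 0) (f 0) + divDiff (root 1) (f 0)) - C k₁ * divDiff (root 3) (f 1)) := by
  simp only [dunkl, Fin.sum_univ_four, Fin.sum_univ_two, refl_root_zero, refl_root_one,
    refl_root_two, refl_root_three]
  simp [mult, root]
  ring

theorem dunkl_add (i : Fin 2) (f g : PV) :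
    dunkl k₀ k₁ i (f + g) = dunkl k₀ k₁ i f + dunkl k₀ k₁ i g := by
  ext1 j
  simp only [dunkl, Pi.add_apply, map_add, divDiff_add, mul_add, Finset.sum_add_distrib]
  ring

/-- Polynomials invariant under the reflection group. -/
def Inv (A : Poly) : Prop := ∀ r, subst (refl (root r)) A = A

theorem divDiff_inv_mul {A : Poly} (hA : Inv A) (r : Fin 4) (p : Poly) :
    divDiff (root r) (A * p) = A * divDiff (root r) p := by
  have h : divDiff (root r) A = 0 := divDiff_eq (by rw [hA r]; ring)
  rw [divDiff_mul, h, hA r]; ring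

theorem Inv.mul {A B : Poly} (hA : Inv A) (hB : Inv B) : Inv (A * B) := fun r => by
  rw [subst_mul, hA r, hB r]

theorem Inv.pow {A : Poly} (hA : Inv A) (n : ℕ) : Inv (A ^ n) := fun r => by
  rw [subst_pow, hA r]

theorem inv_C (a : ℝ) : Inv (C a) := fun _ => subst_C _ _

/-- An invariant factor passes through every difference quotient, so only the partial derivative
acts on it. -/
theorem dunkl_inv_smul {A : Poly} (hA : Inv A) (i : Fin 2) (f : PV) :
    dunkl k₀ k₁ i (A • f) = pderiv i A • f + A • dunkl k₀ k₁ i f := by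
  ext1 j
  simp only [dunkl, Pi.add_apply, Pi.smul_apply, smul_eq_mul, Derivation.leibniz,
    divDiff_inv_mul hA, mul_add, Finset.mul_sum]
  have : ∀ x : Fin 4, ∀ l : Fin 2, C (mult k₀ k₁ x * root x i) *
      (C (refl (root x) l j) * (A * divDiff (root x) (f l)))
      = A * (C (mult k₀ k₁ x * root x i) * (C (refl (root x) l j) * divDiff (root x) (f l))) :=
    fun x l => by ring
  simp only [this]
  ring

theorem dunkl_C_smul (a : ℝ) (i : Fin 2) (f : PV) :
    dunkl k₀ k₁ i ((C a : Poly) • f) = (C a : Poly) • dunkl k₀ k₁ i f := by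
  rw [dunkl_inv_smul (inv_C a)]; simp

theorem lap_add (f g : PV) : lap k₀ k₁ (f + g) = lap k₀ k₁ f + lap k₀ k₁ g := by
  simp only [lap, dunkl_add, Finset.sum_add_distrib]

theorem lap_C_smul (a : ℝ) (f : PV) :
    lap k₀ k₁ ((C a : Poly) • f) = (C a : Poly) • lap k₀ k₁ f := by
  simp only [lap, dunkl_C_smul, Finset.smul_sum]

/-- `|x|²`. -/
def rsq : Poly := X 0 * X 0 + X 1 * X 1

theorem inv_rsq : Inv rsq := by
  intro r
  fin_cases r <;> simp only [rsq, subst_add, subst_mul, Fin.zero_eta, Fin.mk_one,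
    Fin.reduceFinMk, subst_root_zero_X, subst_root_one_X, subst_root_two_X, subst_root_three_X] <;>
    ring

theorem inv_phi_sq : Inv (phi * phi) := by
  intro r
  fin_cases r <;> simp only [phi, subst_sub, subst_mul, subst_pow, Fin.zero_eta, Fin.mk_one,
    Fin.reduceFinMk, subst_root_zero_X, subst_root_one_X, subst_root_two_X, subst_root_three_X] <;>
    ring

/-- The symmetrized Euler operator. -/
theorem dunkl_euler (g : PV) : (X 0 : Poly) • dunkl k₀ k₁ 0 g + (X 1 : Poly) • dunkl k₀ k₁ 1 g +
    (dunkl k₀ k₁ 0 ((X 0 : Poly) • g) + dunkl k₀ k₁ 1 ((X 1 : Poly) • g)) =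
    fun j => 2 * g j + 2 * (X 0 * pderiv 0 (g j) + X 1 * pderiv 1 (g j)) := by
  have s0 := subst_root_zero_X
  have s1 := subst_root_one_X
  have s2 := subst_root_two_X
  have s3 := subst_root_three_X
  ext1 j
  have L := fun r l => linForm_mul_divDiff (root r) (g l)
  fin_cases j
  · simp only [Fin.zero_eta, Pi.add_apply, Pi.smul_apply, smul_eq_mul, dunkl_zero_zero,
      dunkl_one_zero, divDiff_mul, Derivation.leibniz, s0, s1, s2, s3, divDiff_root_zero_X,
      divDiff_root_one_X, divDiff_root_two_X, divDiff_root_three_X, pderiv_X_self]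
    ring
  · simp only [Fin.mk_one, Pi.add_apply, Pi.smul_apply, smul_eq_mul, dunkl_zero_one,
      dunkl_one_one, divDiff_mul, Derivation.leibniz, s0, s1, s2, s3, divDiff_root_zero_X,
      divDiff_root_one_X, divDiff_root_two_X, divDiff_root_three_X, pderiv_X_self]
    ring

/-- Multiplication by `|x|²` and the Laplacian span an `sl₂` with the Euler operator. -/
theorem lap_rsq_smul (g : PV) {N : ℕ} (hg : ∀ j, (g j).IsHomogeneous N) :
    lap k₀ k₁ (rsq • g) = rsq • lap k₀ k₁ g + (C (4 * (N + 1)) : Poly) • g := by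
  have d0 : pderiv 0 rsq = 2 * X 0 := by
    simp [rsq, Derivation.leibniz]; ring
  have d1 : pderiv 1 rsq = 2 * X 1 := by
    simp [rsq, Derivation.leibniz]; ring
  have two : ((2 : Poly)) = C 2 := (map_ofNat C 2).symm
  have hE := dunkl_euler (k₀ := k₀) (k₁ := k₁) g
  -- Euler's identity for homogeneous polynomials turns the right side of `dunkl_euler` into the
  -- scalar `2(N + 1)`.
  have hH : (fun j => 2 * g j + 2 * (X 0 * pderiv 0 (g j) + X 1 * pderiv 1 (g j)))
      = (C (2 * (N + 1)) : Poly) • g := by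
    ext1 j
    have := (hg j).sum_X_mul_pderiv
    rw [Fin.sum_univ_two] at this
    rw [this]
    simp only [Pi.smul_apply, smul_eq_mul, C_mul, C_add, ← two, nsmul_eq_mul, map_natCast, map_one]
    ring
  rw [hH] at hE
  have h4 : (C (4 * ((N : ℝ) + 1)) : Poly) • g = (2 : Poly) • ((C (2 * ((N : ℝ) + 1)) : Poly) • g) := by
    rw [smul_smul, two, ← C_mul]; ring_nf
  rw [h4, ← hE]
  simp only [lap, Fin.sum_univ_two, dunkl_inv_smul inv_rsq, dunkl_add, d0, d1]
  have hs : ∀ i (p : Poly) (f : PV), dunkl k₀ k₁ i ((2 * p) • f) = (2 : Poly) • dunkl k₀ k₁ i (p • f) := by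
    intro i p f
    rw [mul_smul, two, dunkl_C_smul]
  rw [hs, hs]
  ext1 j
  simp only [Pi.add_apply, Pi.smul_apply, smul_eq_mul]
  ring

/-! ## The form on the polynomials `φ²ⁿ p₁₂` -/

theorem C_smul_eq (a : ℝ) (f : PV) : (C a : Poly) • f = a • f := by
  ext1 j; simp [smul_eq_C_mul]

theorem lap_smul (a : ℝ) (f : PV) : lap k₀ k₁ (a • f) = a • lap k₀ k₁ f := by
  rw [← C_smul_eq, lap_C_smul, C_smul_eq]

/-- `Δ_κ` as a linear map. -/
def lapL (k₀ k₁ : ℝ) : PV →ₗ[ℝ] PV where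
  toFun := lap k₀ k₁
  map_add' := lap_add
  map_smul' := lap_smul

theorem iterate_lap (j : ℕ) (f : PV) : (lap k₀ k₁)^[j] f = (lapL k₀ k₁ ^ j) f := by
  rw [Module.End.pow_apply]; rfl

/-- `(x₂, x₁)`, times `φ`. -/
def phiq : PV := phi • ![X 1, X 0]

theorem pderiv_phi_sq : pderiv 0 (phi * phi) = C 4 * (phi * X 0) ∧
    pderiv 1 (phi * phi) = C (-4) * (phi * X 1) := by
  have c4 : (C (-4) : Poly) = -4 := by rw [map_neg]; exact congrArg Neg.neg (map_ofNat C 4)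
  have c5 : (C 4 : Poly) = 4 := map_ofNat C 4
  constructor
  · simp only [phi, map_sub, Derivation.leibniz, pderiv_pow, pderiv_X_self, smul_eq_mul,
      pderiv_X_of_ne (show (1 : Fin 2) ≠ 0 by decide), c5]
    push_cast; ring
  · simp only [phi, map_sub, Derivation.leibniz, pderiv_pow, pderiv_X_self, smul_eq_mul,
      pderiv_X_of_ne (show (0 : Fin 2) ≠ 1 by decide), c4]
    push_cast; ring

/-- With `B = φ²` invariant, `Δ_κ` behaves as a second-order operator in `B`: the case of a general
power follows from the first power and `|∇B|² = 16 |x|² B`, whence the constant `16 m`. -/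
theorem lap_phi_sq_pow_smul (m : ℕ) (f : PV) : lap k₀ k₁ ((phi * phi) ^ (m + 1) • f) =
    (phi * phi) ^ m • (((m : ℝ) + 1) • (((16 * m : ℝ)) • (rsq • f) + lap k₀ k₁ ((phi * phi) • f)
      - (phi * phi) • lap k₀ k₁ f) + (phi * phi) • lap k₀ k₁ f) := by
  have key : ∀ i, pderiv i ((phi * phi) ^ (m + 1)) =
      (C ((m : ℝ) + 1)) * (phi * phi) ^ m * pderiv i (phi * phi) := by
    intro i; rw [pderiv_pow]; simp
  have hB : pderiv 0 ((phi * phi) ^ m) * pderiv 0 (phi * phi) +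
      pderiv 1 ((phi * phi) ^ m) * pderiv 1 (phi * phi)
      = C (16 * m : ℝ) * rsq * (phi * phi) ^ m := by
    cases m with
    | zero => simp
    | succ m =>
      have c4 : (C 4 : Poly) = 4 := map_ofNat C 4
      have c4' : (C (-4) : Poly) = - C 4 := map_neg C 4
      have c16 : (C 16 : Poly) = 16 := map_ofNat C 16
      rw [pderiv_pow, pderiv_pow, pderiv_phi_sq.1, pderiv_phi_sq.2, Nat.add_sub_cancel]
      simp only [rsq, C_mul, map_natCast, c16, c4', c4]
      push_cast
      ring
  have hD : ∀ i, dunkl k₀ k₁ i (pderiv i ((phi * phi) ^ (m + 1)) • f) =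
      (C ((m : ℝ) + 1) * (pderiv i ((phi * phi) ^ m) * pderiv i (phi * phi))) • f +
      (C ((m : ℝ) + 1) * (phi * phi) ^ m) • dunkl k₀ k₁ i (pderiv i (phi * phi) • f) := by
    intro i
    rw [key, mul_smul, dunkl_inv_smul ((inv_C _).mul (inv_phi_sq.pow m))]
    simp only [Derivation.leibniz, pderiv_C, smul_eq_mul, mul_zero, add_zero, smul_smul, mul_assoc]
  simp only [← C_smul_eq]
  simp only [lap, Fin.sum_univ_two, dunkl_inv_smul (inv_phi_sq.pow _), dunkl_inv_smul inv_phi_sq,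
    dunkl_add, hD]
  simp only [key]
  ext1 j
  simp only [Pi.add_apply, Pi.sub_apply, Pi.smul_apply, smul_eq_mul]
  linear_combination (C ((m : ℝ) + 1) * f j) * hB

theorem dunkl_p12 : dunkl k₀ k₁ 0 p12 = ![0, C (1 + 2 * k₀ + 2 * k₁)] ∧
    dunkl k₀ k₁ 1 p12 = ![-C (1 + 2 * k₀ + 2 * k₁), 0] := by
  have c2 : (C 2 : Poly) = 2 := map_ofNat C 2
  constructor <;> ext1 j <;> fin_cases j <;>
  simp [dunkl_zero_zero, dunkl_zero_one, dunkl_one_zero, dunkl_one_one, p12, divDiff_neg,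
    divDiff_root_zero_X, divDiff_root_one_X, divDiff_root_two_X, divDiff_root_three_X, c2] <;>
  ring

theorem dunkl_const (i : Fin 2) (a b : ℝ) : dunkl k₀ k₁ i ![C a, C b] = 0 := by
  ext1 j
  fin_cases i <;> fin_cases j <;>
  simp [dunkl_zero_zero, dunkl_zero_one, dunkl_one_zero, dunkl_one_one, divDiff_C]

theorem dunkl_dunkl_p12 (i j : Fin 2) : dunkl k₀ k₁ i (dunkl k₀ k₁ j p12) = 0 := by
  fin_cases j
  · simpa [dunkl_p12] using dunkl_const (k₀ := k₀) (k₁ := k₁) i 0 (1 + 2 * k₀ + 2 * k₁)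
  · simpa [dunkl_p12] using dunkl_const (k₀ := k₀) (k₁ := k₁) i (-(1 + 2 * k₀ + 2 * k₁)) 0

theorem lap_p12 : lap k₀ k₁ p12 = 0 := by
  simp [lap, dunkl_dunkl_p12]

theorem dunkl_phiq :
    dunkl k₀ k₁ 0 phiq = ![C (2 + 4 * k₀) * (X 0 * X 1),
      C (3 + 2 * k₀ + 2 * k₁) * (X 0 * X 0) + C (2 * k₀ - 1 - 2 * k₁) * (X 1 * X 1)] ∧
    dunkl k₀ k₁ 1 phiq = ![C (1 + 2 * k₁ - 2 * k₀) * (X 0 * X 0) -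
      C (3 + 2 * k₀ + 2 * k₁) * (X 1 * X 1), -C (2 + 4 * k₀) * (X 0 * X 1)] := by
  have c2 : (C 2 : Poly) = 2 := map_ofNat C 2
  have c3 : (C 3 : Poly) = 3 := map_ofNat C 3
  have c4 : (C 4 : Poly) = 4 := map_ofNat C 4
  constructor <;> ext1 j <;> fin_cases j <;>
  simp [dunkl_zero_zero, dunkl_zero_one, dunkl_one_zero, dunkl_one_one, phiq, phi, pow_two,
    divDiff_sub, divDiff_mul, subst_sub,
    subst_mul, subst_root_zero_X, subst_root_one_X, subst_root_two_X, subst_root_three_X,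
    divDiff_root_zero_X, divDiff_root_one_X, divDiff_root_two_X, divDiff_root_three_X, c2, c3, c4,
    Derivation.leibniz] <;>
  ring

theorem lap_phiq : lap k₀ k₁ phiq = (4 * (1 + 2 * k₁ - 2 * k₀)) • p12 := by
  have c2 : (C 2 : Poly) = 2 := map_ofNat C 2
  have c3 : (C 3 : Poly) = 3 := map_ofNat C 3
  have c4 : (C 4 : Poly) = 4 := map_ofNat C 4
  rw [lap, Fin.sum_univ_two, dunkl_phiq.1, dunkl_phiq.2, ← C_smul_eq]
  generalize h1 : 2 + 4 * k₀ = a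
  generalize h2 : 3 + 2 * k₀ + 2 * k₁ = b
  generalize h3 : 2 * k₀ - 1 - 2 * k₁ = c
  generalize h4 : 1 + 2 * k₁ - 2 * k₀ = d
  ext1 j
  fin_cases j <;>
  simp [dunkl_zero_zero, dunkl_zero_one, dunkl_one_zero, dunkl_one_one, p12,
    divDiff_sub, divDiff_add, divDiff_neg, divDiff_mul, divDiff_C, subst_C,
    subst_root_zero_X, subst_root_one_X, subst_root_two_X, subst_root_three_X,
    divDiff_root_zero_X, divDiff_root_one_X, divDiff_root_two_X, divDiff_root_three_X, c4,
    Derivation.leibniz] <;>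
  simp [← h1, ← h2, ← h3, ← h4, c2, c3, c4] <;>
  ring

theorem lap_phi_sq_smul (f : PV) : lap k₀ k₁ ((phi * phi) • f) =
    (C 4 : Poly) • (dunkl k₀ k₁ 0 ((phi * X 0) • f) - dunkl k₀ k₁ 1 ((phi * X 1) • f)
      + ((phi * X 0) • dunkl k₀ k₁ 0 f - (phi * X 1) • dunkl k₀ k₁ 1 f))
      + (phi * phi) • lap k₀ k₁ f := by
  simp only [lap, Fin.sum_univ_two, dunkl_inv_smul inv_phi_sq, dunkl_add, pderiv_phi_sq]
  simp only [mul_smul (C _ : Poly), dunkl_C_smul]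
  ext1 j
  have c4 : (C (-4) : Poly) = - C 4 := map_neg C 4
  simp only [Pi.add_apply, Pi.sub_apply, Pi.smul_apply, smul_eq_mul, c4]
  ring

theorem lap_phi_sq_smul_p12 : lap k₀ k₁ ((phi * phi) • p12) =
    (8 * (1 - 2 * k₀)) • (rsq • p12) + (8 * (1 + 2 * k₀ + 2 * k₁)) • phiq := by
  have c2 : (C 2 : Poly) = 2 := map_ofNat C 2
  have c4 : (C 4 : Poly) = 4 := map_ofNat C 4
  have c8 : (C 8 : Poly) = 8 := map_ofNat C 8
  rw [lap_phi_sq_smul, lap_p12, dunkl_p12.1, dunkl_p12.2]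
  simp only [← C_smul_eq]
  ext1 j
  fin_cases j <;>
  simp only [Fin.zero_eta, Fin.mk_one, Pi.add_apply, Pi.sub_apply, Pi.smul_apply, smul_eq_mul,
    dunkl_zero_zero, dunkl_zero_one, dunkl_one_zero, dunkl_one_one] <;>
  simp [p12, phiq, phi, pow_two,
    divDiff_sub, divDiff_neg, divDiff_mul, subst_mul, subst_sub, rsq,
    subst_root_zero_X, subst_root_one_X, subst_root_two_X, subst_root_three_X,
    divDiff_root_zero_X, divDiff_root_one_X, divDiff_root_two_X, divDiff_root_three_X, c2, c4, c8,
    Derivation.leibniz] <;>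
  ring

theorem lap_phi_sq_smul_phiq : lap k₀ k₁ ((phi * phi) • phiq) =
    (8 * (3 + 2 * k₀)) • (rsq • phiq) +
      (12 * (1 + 2 * k₁ - 2 * k₀)) • ((phi * phi) • p12) := by
  have c2 : (C 2 : Poly) = 2 := map_ofNat C 2
  have c3 : (C 3 : Poly) = 3 := map_ofNat C 3
  have c4 : (C 4 : Poly) = 4 := map_ofNat C 4
  have c8 : (C 8 : Poly) = 8 := map_ofNat C 8
  have c12 : (C 12 : Poly) = 12 := map_ofNat C 12
  -- Since `phiq` contains one factor `φ`, a second one completes the invariant `φ²`, which can be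
  -- pulled out before differentiating.
  have e0 : (phi * X 0) • phiq = (phi * phi) • ![X 0 * X 1, X 0 * X 0] := by
    ext1 j; fin_cases j <;> simp [phiq] <;> ring
  have e1 : (phi * X 1) • phiq = (phi * phi) • ![X 1 * X 1, X 0 * X 1] := by
    ext1 j; fin_cases j <;> simp [phiq] <;> ring
  rw [lap_phi_sq_smul, lap_phiq, dunkl_phiq.1, dunkl_phiq.2, e0, e1, dunkl_inv_smul inv_phi_sq,
    dunkl_inv_smul inv_phi_sq, pderiv_phi_sq.1, pderiv_phi_sq.2]
  simp only [← C_smul_eq]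
  ext1 j
  fin_cases j <;>
  simp only [Fin.zero_eta, Fin.mk_one, Pi.add_apply, Pi.sub_apply, Pi.smul_apply, smul_eq_mul,
    dunkl_zero_zero, dunkl_zero_one, dunkl_one_zero, dunkl_one_one] <;>
  simp [p12, phiq, phi, pow_two,
    divDiff_mul, rsq,
    subst_root_zero_X, subst_root_one_X, subst_root_two_X, subst_root_three_X,
    divDiff_root_zero_X, divDiff_root_one_X, divDiff_root_two_X, divDiff_root_three_X, c2, c3, c4,
    c8, c12, Derivation.leibniz] <;>
  ring

theorem lap_rsq_pow_smul (g : PV) {N : ℕ} (hg : ∀ j, (g j).IsHomogeneous N) (j : ℕ) :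
    lap k₀ k₁ (rsq ^ (j + 1) • g) = rsq ^ (j + 1) • lap k₀ k₁ g +
      (4 * (j + 1) * (N + j + 1) : ℝ) • (rsq ^ j • g) := by
  have hr : rsq.IsHomogeneous 2 :=
    ((isHomogeneous_X _ _).mul (isHomogeneous_X _ _)).add
      ((isHomogeneous_X _ _).mul (isHomogeneous_X _ _))
  induction j with
  | zero => simp [lap_rsq_smul g hg, ← C_smul_eq]
  | succ j ih =>
    have h : ∀ i, ((rsq ^ (j + 1) • g) i).IsHomogeneous (2 * (j + 1) + N) := fun i =>
      (hr.pow (j + 1)).mul (hg i)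
    rw [pow_succ', mul_smul, lap_rsq_smul _ h, ih]
    simp only [← C_smul_eq]
    ext1 i
    simp only [Pi.add_apply, Pi.smul_apply, smul_eq_mul]
    have c2 : (C 2 : Poly) = 2 := map_ofNat C 2
    push_cast
    simp only [C_mul, C_add, C_1, c2]
    ring

/-- `|x|²ʲ φ²ᵐ p₁₂`. -/
def vPoly (j m : ℕ) : PV := rsq ^ j • ((phi * phi) ^ m • p12)

/-- `|x|²ʲ φ²ᵐ⁺¹ (x₂, x₁)`. -/
def uPoly (j m : ℕ) : PV := rsq ^ j • ((phi * phi) ^ m • phiq)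

theorem isHomogeneous_rsq : rsq.IsHomogeneous 2 :=
  ((isHomogeneous_X _ _).mul (isHomogeneous_X _ _)).add
    ((isHomogeneous_X _ _).mul (isHomogeneous_X _ _))

theorem isHomogeneous_phi : phi.IsHomogeneous 2 :=
  ((isHomogeneous_X _ _).pow 2).sub ((isHomogeneous_X _ _).pow 2)

theorem isHomogeneous_p12 (i : Fin 2) : (p12 i).IsHomogeneous 1 := by
  fin_cases i
  · exact (isHomogeneous_X _ _).neg
  · exact isHomogeneous_X _ _

theorem isHomogeneous_phiq (i : Fin 2) : (phiq i).IsHomogeneous 3 := by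
  fin_cases i
  · exact isHomogeneous_phi.mul (isHomogeneous_X _ _)
  · exact isHomogeneous_phi.mul (isHomogeneous_X _ _)

theorem isHomogeneous_phi_sq_pow_smul {f : PV} {N : ℕ} (hf : ∀ i, (f i).IsHomogeneous N) (m : ℕ)
    (i : Fin 2) : (((phi * phi) ^ m • f) i).IsHomogeneous (4 * m + N) :=
  ((isHomogeneous_phi.mul isHomogeneous_phi).pow m).mul (hf i)

theorem isHomogeneous_rsq_pow_smul {f : PV} {N : ℕ} (hf : ∀ i, (f i).IsHomogeneous N) (j : ℕ)
    (i : Fin 2) : ((rsq ^ j • f) i).IsHomogeneous (2 * j + N) :=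
  (isHomogeneous_rsq.pow j).mul (hf i)

theorem lap_phi_sq_pow_smul_p12 (m : ℕ) : lap k₀ k₁ ((phi * phi) ^ (m + 1) • p12) =
    (8 * (m + 1) * (2 * m + 1 - 2 * k₀)) • (rsq • ((phi * phi) ^ m • p12)) +
    (8 * (m + 1) * (1 + 2 * k₀ + 2 * k₁)) • ((phi * phi) ^ m • phiq) := by
  rw [lap_phi_sq_pow_smul, lap_phi_sq_smul_p12, lap_p12]
  ext1 i
  simp only [smul_zero, sub_zero, add_zero, Pi.add_apply, Pi.smul_apply, smul_eq_mul,
    smul_eq_C_mul, C_mul, C_add, C_sub]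
  have c2 : (C 2 : Poly) = 2 := map_ofNat C 2
  have c8 : (C 8 : Poly) = 8 := map_ofNat C 8
  have c16 : (C 16 : Poly) = 16 := map_ofNat C 16
  rw [C_1, c2, c8, c16]
  ring

theorem lap_phi_sq_pow_smul_phiq (m : ℕ) : lap k₀ k₁ ((phi * phi) ^ m • phiq) =
    (8 * m * (2 * m + 1 + 2 * k₀)) • (rsq • ((phi * phi) ^ (m - 1) • phiq)) +
    (4 * (2 * m + 1) * (1 + 2 * k₁ - 2 * k₀)) • ((phi * phi) ^ m • p12) := by
  cases m with
  | zero => simp [lap_phiq]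
  | succ m =>
  rw [lap_phi_sq_pow_smul, lap_phi_sq_smul_phiq, lap_phiq, Nat.add_sub_cancel]
  ext1 i
  push_cast
  simp only [Pi.add_apply, Pi.sub_apply, Pi.smul_apply, smul_eq_mul,
    smul_eq_C_mul, C_mul, C_add, C_sub]
  have c2 : (C 2 : Poly) = 2 := map_ofNat C 2
  have c3 : (C 3 : Poly) = 3 := map_ofNat C 3
  have c4 : (C 4 : Poly) = 4 := map_ofNat C 4
  have c8 : (C 8 : Poly) = 8 := map_ofNat C 8
  have c12 : (C 12 : Poly) = 12 := map_ofNat C 12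
  have c16 : (C 16 : Poly) = 16 := map_ofNat C 16
  rw [C_1, c2, c3, c4, c8, c12, c16]
  ring

theorem lap_rsq_pow_smul' (g : PV) {N : ℕ} (hg : ∀ j, (g j).IsHomogeneous N) (j : ℕ) :
    lap k₀ k₁ (rsq ^ j • g) = rsq ^ j • lap k₀ k₁ g +
      (4 * j * (N + j) : ℝ) • (rsq ^ (j - 1) • g) := by
  cases j with
  | zero => simp
  | succ j => rw [lap_rsq_pow_smul g hg, Nat.add_sub_cancel]; push_cast; ring_nf

theorem smul_smul_PV (A : Poly) (a : ℝ) (f : PV) : A • (a • f) = a • (A • f) := smul_comm _ _ _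

theorem lap_vPoly_zero (j : ℕ) :
    lap k₀ k₁ (vPoly j 0) = (4 * j * (j + 1) : ℝ) • vPoly (j - 1) 0 := by
  simp only [vPoly, pow_zero, one_smul]
  rw [lap_rsq_pow_smul' p12 isHomogeneous_p12, lap_p12]
  push_cast
  rw [smul_zero, zero_add, add_comm (1 : ℝ)]

/-- With `lap_vPoly_zero` and `lap_uPoly` this shows that the two families span a space stable under
`Δ_κ`. The truncated index `j - 1` at `j = 0` occurs with coefficient `0`. -/
theorem lap_vPoly_succ (j m : ℕ) : lap k₀ k₁ (vPoly j (m + 1)) =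
    (8 * (m + 1) * (2 * m + 1 - 2 * k₀)) • vPoly (j + 1) m +
    (8 * (m + 1) * (1 + 2 * k₀ + 2 * k₁)) • uPoly j m +
    (4 * j * (j + 4 * m + 5) : ℝ) • vPoly (j - 1) (m + 1) := by
  simp only [vPoly, uPoly]
  rw [lap_rsq_pow_smul' _ (isHomogeneous_phi_sq_pow_smul isHomogeneous_p12 (m + 1)),
    lap_phi_sq_pow_smul_p12, smul_add, smul_smul_PV, smul_smul_PV, smul_smul (rsq ^ j) rsq,
    ← pow_succ]
  push_cast
  ring_nf

theorem lap_uPoly (j m : ℕ) : lap k₀ k₁ (uPoly j m) =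
    (8 * m * (2 * m + 1 + 2 * k₀)) • uPoly (j + 1) (m - 1) +
    (4 * (2 * m + 1) * (1 + 2 * k₁ - 2 * k₀)) • vPoly j m +
    (4 * j * (j + 4 * m + 3) : ℝ) • uPoly (j - 1) m := by
  simp only [vPoly, uPoly]
  rw [lap_rsq_pow_smul' _ (isHomogeneous_phi_sq_pow_smul isHomogeneous_phiq m),
    lap_phi_sq_pow_smul_phiq, smul_add, smul_smul_PV, smul_smul_PV, smul_smul (rsq ^ j) rsq,
    ← pow_succ]
  push_cast
  ring_nf

/-- The functional `∂₁ f₂ - ∂₂ f₁` at the origin. -/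
def curl : PV →ₗ[ℝ] ℝ where
  toFun f := coeff (Finsupp.single 0 1) (f 1) - coeff (Finsupp.single 1 1) (f 0)
  map_add' f g := by simp; ring
  map_smul' a f := by simp; ring

theorem curl_eq_zero {f : PV} {N : ℕ} (hf : ∀ i, (f i).IsHomogeneous N) (hN : N ≠ 1) :
    curl f = 0 := by
  have h : ∀ i l : Fin 2, coeff (Finsupp.single l 1) (f i) = 0 := fun i l =>
    (hf i).coeff_eq_zero (by simpa using hN.symm)
  change coeff (Finsupp.single 0 1) (f 1) - coeff (Finsupp.single 1 1) (f 0) = 0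
  rw [h, h, sub_zero]

theorem curl_p12 : curl p12 = 2 := by
  change coeff (Finsupp.single 0 1) (X 0 : Poly) - coeff (Finsupp.single 1 1) (-X 1 : Poly) = 2
  simp
  norm_num

/-- By induction on `i`, peeling off one Laplacian at a time. By degree only one power of `Δ_κ`
reaches degree one, where the curl is supported. The weight `4^i i! (i+1)!` is what `i` Laplacians
produce on `|x|^(2i) p₁₂`, so dividing by it leaves numbers independent of `j`, and these obey the
recurrence of `s` and `t`. -/
theorem curl_lapL_pow (s t : ℕ → ℝ) (h0 : s 0 = 1 + 2 * k₀ + 2 * k₁)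
    (ht0 : 2 * t 0 = (1 + 2 * k₁ - 2 * k₀) * s 0)
    (hs : ∀ n : ℕ, (2 * n + 3) * s (n + 1) =
      (2 * n + 1 - 2 * k₀) * s n + (1 + 2 * k₀ + 2 * k₁) * t n)
    (ht : ∀ n : ℕ, (2 * n + 3) * (2 * n + 4) * t (n + 1) =
      (2 * n + 2) * (2 * n + 3 + 2 * k₀) * t n + (2 * n + 3) * (1 + 2 * k₁ - 2 * k₀) * s (n + 1))
    (i : ℕ) : ∀ j m : ℕ,
    (1 + 2 * k₀ + 2 * k₁) * curl ((lapL k₀ k₁ ^ i) (vPoly j m)) =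
      (if i = j + 2 * m then 2 * (4 ^ i * i.factorial * (i + 1).factorial) * s m else 0) ∧
    (1 + 2 * k₀ + 2 * k₁) * curl ((lapL k₀ k₁ ^ i) (uPoly j m)) =
      (if i = j + 2 * m + 1 then 2 * (4 ^ i * i.factorial * (i + 1).factorial) * t m else 0) := by
  induction i with
  | zero =>
    intro j m
    constructor
    · split_ifs with h
      · obtain ⟨rfl, rfl⟩ : j = 0 ∧ m = 0 := by omega
        simp [vPoly, curl_p12, h0]; ring
      · have := curl_eq_zero (isHomogeneous_rsq_pow_smul
          (isHomogeneous_phi_sq_pow_smul isHomogeneous_p12 m) j) (by omega)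
        simp [vPoly, this]
    · rw [if_neg (by omega)]
      have := curl_eq_zero (isHomogeneous_rsq_pow_smul
          (isHomogeneous_phi_sq_pow_smul isHomogeneous_phiq m) j) (by omega)
      simp [uPoly, this]
  | succ i ih =>
    have step : ∀ f, (lapL k₀ k₁ ^ (i + 1)) f = (lapL k₀ k₁ ^ i) (lap k₀ k₁ f) := fun f => by
      rw [pow_succ]; rfl
    set κ := 1 + 2 * k₀ + 2 * k₁ with hκ
    set w : ℝ := 2 * (4 ^ i * i.factorial * (i + 1).factorial) with hw
    have hw1 : 2 * (4 ^ (i + 1) * ((i + 1).factorial : ℝ) * (i + 1 + 1).factorial) =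
        4 * (i + 1) * (i + 2) * w := by
      rw [hw, Nat.factorial_succ (i + 1), Nat.factorial_succ i]; push_cast; ring
    have ihv := fun j m => (ih j m).1
    have ihu := fun j m => (ih j m).2
    have ha : ∀ f g : PV, κ * curl ((lapL k₀ k₁ ^ i) (f + g)) =
        κ * curl ((lapL k₀ k₁ ^ i) f) + κ * curl ((lapL k₀ k₁ ^ i) g) := fun f g => by
      rw [map_add, map_add, mul_add]
    have hc : ∀ (a : ℝ) (f : PV), κ * curl ((lapL k₀ k₁ ^ i) (a • f)) =
        a * (κ * curl ((lapL k₀ k₁ ^ i) f)) := fun a f => by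
      rw [map_smul, map_smul, smul_eq_mul, mul_left_comm]
    have cut : ∀ (j l : ℕ) (b x : ℝ), (4 * j * b : ℝ) * (if i = j - 1 + l then x else 0) =
        (4 * j * b : ℝ) * (if i + 1 = j + l then x else 0) := fun j l b x => by
      cases j with
      | zero => simp
      | succ j =>
        by_cases h : i = j + l
        · rw [if_pos (by omega), if_pos (by omega)]
        · rw [if_neg (by omega), if_neg (by omega)]
    simp only [hw1, step]
    intro j m
    constructor
    · cases m with
      | zero =>
        rw [lap_vPoly_zero, hc, ihv, cut]
        by_cases h : i + 1 = j + 2 * 0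
        · have hj : (j : ℝ) = i + 1 := by exact_mod_cast (by omega : j = i + 1)
          rw [if_pos h, if_pos h, hj]; ring
        · rw [if_neg h, if_neg h, mul_zero]
      | succ m =>
        simp only [lap_vPoly_succ, ha, hc, ihv, ihu, cut]
        by_cases h : i + 1 = j + 2 * (m + 1)
        · have hi : (i : ℝ) = j + 2 * m + 1 := by exact_mod_cast (by omega : i = j + 2 * m + 1)
          rw [if_pos (by omega), if_pos (by omega), if_pos h, if_pos h, hi]
          -- With `i = j + 2m + 1`, the difference of `(i+1)(i+2)` and `j(j+4m+5)` is
          -- `(2m+2)(2m+3)`. The dependence on `j` disappears and the recurrence for `s` remains.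
          linear_combination (-(4 * (2 * m + 2)) * w) * hs m
        · rw [if_neg (by omega), if_neg (by omega), if_neg h, if_neg h]; ring
    · simp only [lap_uPoly, ha, hc, ihv, ihu, add_assoc (_ - 1), cut]
      by_cases h : i = j + 2 * m
      · have hi : (i : ℝ) = j + 2 * m := by exact_mod_cast h
        rw [if_pos (show i = j + 2 * m from h), if_pos (show i + 1 = j + (2 * m + 1) by omega),
          if_pos (show i + 1 = j + 2 * m + 1 by omega), hi]
        cases m with
        | zero =>
          push_cast
          linear_combination (-4 * w) * ht0
        | succ m =>
          rw [if_pos (by omega)]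
          push_cast
          linear_combination (-4 * w) * ht m
      · rw [if_neg (show ¬ i = j + 2 * m from h), if_neg (show ¬ i + 1 = j + (2 * m + 1) by omega),
          if_neg (show ¬ i + 1 = j + 2 * m + 1 by omega)]
        cases m with
        | zero => simp
        | succ m => rw [if_neg (by omega)]; ring

/-! ### Evaluation of the form against `p₁₂`. -/

theorem dunkl_zero (i : Fin 2) : dunkl k₀ k₁ i 0 = 0 := by
  simpa using dunkl_C_smul (k₀ := k₀) (k₁ := k₁) 0 i 0

theorem iterate_dunkl_zero (i : Fin 2) (n : ℕ) : (dunkl k₀ k₁ i)^[n] 0 = 0 :=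
  Function.iterate_fixed (dunkl_zero i) n

theorem iterate_dunkl_p12 (a b : ℕ) (hab : 1 < a + b) :
    (dunkl k₀ k₁ 0)^[a] ((dunkl k₀ k₁ 1)^[b] p12) = 0 := by
  rcases b with _ | _ | b
  · obtain ⟨a, rfl⟩ : ∃ c, a = c + 2 := ⟨a - 2, by omega⟩
    simp only [Function.iterate_zero, id_eq, Function.iterate_add_apply]
    rw [show (dunkl k₀ k₁ 0)^[2] p12 = 0 from dunkl_dunkl_p12 0 0, iterate_dunkl_zero]
  · obtain ⟨a, rfl⟩ : ∃ c, a = c + 1 := ⟨a - 1, by omega⟩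
    simp only [Function.iterate_add_apply, Function.iterate_one, zero_add, Function.iterate_one]
    rw [dunkl_dunkl_p12 0 1, iterate_dunkl_zero]
  · rw [Function.iterate_add_apply (dunkl k₀ k₁ 1) b 2 p12,
      show (dunkl k₀ k₁ 1)^[2] p12 = 0 from dunkl_dunkl_p12 1 1, iterate_dunkl_zero,
      iterate_dunkl_zero]

/-- Two Dunkl operators annihilate `p₁₂`, and `p₁₂` itself vanishes at the origin. Only the linear
coefficients of `p` can contribute. -/
theorem eval_polyDunkl_p12 (p : Poly) :
    eval 0 (polyDunkl k₀ k₁ p p12 0) = -(1 + 2 * k₀ + 2 * k₁) * coeff (Finsupp.single 1 1) p ∧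
    eval 0 (polyDunkl k₀ k₁ p p12 1) = (1 + 2 * k₀ + 2 * k₁) * coeff (Finsupp.single 0 1) p := by
  have key : ∀ m : Fin 2 →₀ ℕ, (m ≠ Finsupp.single 1 1 → eval 0
      (((dunkl k₀ k₁ 0)^[m 0] ((dunkl k₀ k₁ 1)^[m 1] p12)) 0) = 0) ∧
      (m ≠ Finsupp.single 0 1 → eval 0
      (((dunkl k₀ k₁ 0)^[m 0] ((dunkl k₀ k₁ 1)^[m 1] p12)) 1) = 0) := by
    intro m
    by_cases h : 1 < m 0 + m 1
    · rw [iterate_dunkl_p12 _ _ h]; simp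
    · obtain ⟨h0, h1⟩ | ⟨h0, h1⟩ | ⟨h0, h1⟩ : (m 0 = 0 ∧ m 1 = 0) ∨ (m 0 = 1 ∧ m 1 = 0) ∨
          (m 0 = 0 ∧ m 1 = 1) := by omega
      · rw [h0, h1]; simp [p12]
      · have : m = Finsupp.single 0 1 := by ext i; fin_cases i <;> simp [h0, h1]
        rw [h0, h1]; simp [dunkl_p12, this]
      · have : m = Finsupp.single 1 1 := by ext i; fin_cases i <;> simp [h0, h1]
        rw [h0, h1]; simp [dunkl_p12, this]
  constructor
  · rw [polyDunkl, Finset.sum_apply, map_sum, Finset.sum_eq_single (Finsupp.single 1 1)]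
    · simp [dunkl_p12]; ring
    · intro m _ hm
      rw [Pi.smul_apply, smul_eval, (key m).1 hm, mul_zero]
    · intro hm
      simp [notMem_support_iff.1 hm]
  · rw [polyDunkl, Finset.sum_apply, map_sum, Finset.sum_eq_single (Finsupp.single 0 1)]
    · simp [dunkl_p12]; ring
    · intro m _ hm
      rw [Pi.smul_apply, smul_eval, (key m).2 hm, mul_zero]
    · intro hm
      simp [notMem_support_iff.1 hm]

theorem formTau_p12 (f : PV) : formTau k₀ k₁ f p12 = (1 + 2 * k₀ + 2 * k₁) * curl f := by
  rw [formTau, Fin.sum_univ_two, (eval_polyDunkl_p12 (f 0)).1, (eval_polyDunkl_p12 (f 1)).2]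
  change _ = _ * (coeff (Finsupp.single 0 1) (f 1) - coeff (Finsupp.single 1 1) (f 0))
  ring

theorem polyDunkl_zero_right (p : Poly) : polyDunkl k₀ k₁ p 0 = 0 := by
  simp [polyDunkl, iterate_dunkl_zero]

theorem expLap_zero : expLap k₀ k₁ 0 = 0 := by
  simp [expLap, iterate_lap]

theorem formG_zero_left (g : PV) : formG k₀ k₁ 0 g = 0 := by
  simp [formG, expLap_zero, formTau, polyDunkl]

theorem formG_zero_right (f : PV) : formG k₀ k₁ f 0 = 0 := by
  simp [formG, expLap_zero, formTau, polyDunkl_zero_right]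

theorem deg_of_isHomogeneous {f : PV} {N : ℕ} (hf : ∀ i, (f i).IsHomogeneous N)
    (h : ∃ i, f i ≠ 0) : deg f = N := by
  apply le_antisymm
  · exact Finset.sup_le fun i _ => (hf i).totalDegree_le
  · obtain ⟨i, hi⟩ := h
    rw [← (hf i).totalDegree hi]
    exact Finset.le_sup (f := fun i => (f i).totalDegree) (Finset.mem_univ i)

theorem hcomp_of_isHomogeneous {f : PV} {N : ℕ} (hf : ∀ i, (f i).IsHomogeneous N) (m : ℕ) :
    hcomp m f = if m = N then f else 0 := by
  ext1 i
  rw [hcomp, homogeneousComponent_of_mem (hf i)]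
  split_ifs <;> simp

theorem formS_of_isHomogeneous {f g : PV} {M N : ℕ} (hf : ∀ i, (f i).IsHomogeneous M)
    (hg : ∀ i, (g i).IsHomogeneous N) (hf0 : ∃ i, f i ≠ 0) (hg0 : ∃ i, g i ≠ 0)
    (hMN : M % 2 = N % 2) : formS k₀ k₁ f g =
      1 / (2 ^ ((M + N) / 2) * (((M + N) / 2).factorial : ℝ)) * formG k₀ k₁ f g := by
  rw [formS, deg_of_isHomogeneous hf hf0, deg_of_isHomogeneous hg hg0,
    Finset.sum_eq_single M, Finset.sum_eq_single N, if_pos hMN, hcomp_of_isHomogeneous hf,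
    hcomp_of_isHomogeneous hg, if_pos rfl, if_pos rfl]
  · intro b _ hb
    rw [hcomp_of_isHomogeneous hg, if_neg hb, formG_zero_right]; simp
  · simp
  · intro a _ ha
    rw [hcomp_of_isHomogeneous hf, if_neg ha]
    simp [formG_zero_left]
  · simp

theorem phi_ne_zero : phi ≠ 0 := by
  intro h
  have := congrArg (eval ![1, 0]) h
  simp [phi] at this

theorem p12_ne_zero : p12 1 ≠ 0 := X_ne_zero (R := ℝ) (0 : Fin 2)

theorem expLap_p12 : expLap k₀ k₁ p12 = p12 := by
  rw [expLap, deg_of_isHomogeneous isHomogeneous_p12 ⟨1, p12_ne_zero⟩]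
  simp [Finset.sum_range_succ, lap_p12]

theorem formS_phi_pow_smul_p12 (s t : ℕ → ℝ) (h0 : s 0 = 1 + 2 * k₀ + 2 * k₁)
    (ht0 : 2 * t 0 = (1 + 2 * k₁ - 2 * k₀) * s 0)
    (hs : ∀ n : ℕ, (2 * n + 3) * s (n + 1) =
      (2 * n + 1 - 2 * k₀) * s n + (1 + 2 * k₀ + 2 * k₁) * t n)
    (ht : ∀ n : ℕ, (2 * n + 3) * (2 * n + 4) * t (n + 1) =
      (2 * n + 2) * (2 * n + 3 + 2 * k₀) * t n + (2 * n + 3) * (1 + 2 * k₁ - 2 * k₀) * s (n + 1))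
    (n : ℕ) : formS k₀ k₁ (phi ^ (2 * n) • p12) p12 = s n := by
  have hv : phi ^ (2 * n) • p12 = vPoly 0 n := by
    rw [vPoly, pow_zero, one_smul, pow_mul, pow_two]
  have hne : ∃ i, (vPoly 0 n) i ≠ 0 := by
    refine ⟨1, ?_⟩
    rw [← hv]
    exact mul_ne_zero (pow_ne_zero _ phi_ne_zero) p12_ne_zero
  have hom : ∀ i, (vPoly 0 n i).IsHomogeneous (4 * n + 1) := by
    have := isHomogeneous_phi_sq_pow_smul isHomogeneous_p12 n
    simpa [vPoly] using this
  rw [hv, formS_of_isHomogeneous hom isHomogeneous_p12 hne ⟨1, p12_ne_zero⟩ (by omega), formG,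
    expLap_p12, formTau_p12, expLap, deg_of_isHomogeneous hom hne, map_sum, Finset.mul_sum,
    Finset.sum_eq_single (2 * n)]
  -- The single surviving term is `j = 2n`. Its weight `2 · 4^(2n) (2n)! (2n+1)!` equals the product
  -- of the denominators `2^(2n) (2n)!` of the exponential and `2^(2n+1) (2n+1)!` of the
  -- normalization of the form.
  · have := (curl_lapL_pow s t h0 ht0 hs ht (2 * n) 0 n).1
    rw [if_pos (by omega)] at this
    rw [iterate_lap, map_smul, smul_eq_mul, mul_left_comm (1 + 2 * k₀ + 2 * k₁), this,
      show (4 * n + 1 + 1) / 2 = 2 * n + 1 by omega,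
      show (4 : ℝ) ^ (2 * n) = 2 ^ (2 * n) * 2 ^ (2 * n) by rw [← mul_pow]; norm_num]
    have := Nat.factorial_ne_zero (2 * n)
    have := Nat.factorial_ne_zero (2 * n + 1)
    field_simp
    ring
  · intro i _ hi
    have := (curl_lapL_pow s t h0 ht0 hs ht i 0 n).1
    rw [if_neg (by omega)] at this
    rw [iterate_lap, map_smul, smul_eq_mul, mul_left_comm (1 + 2 * k₀ + 2 * k₁), this, mul_zero]
  · intro h
    simp at h
    omega

theorem formS_eq_sInt (h : Adm k₀ k₁) (n : ℕ) :
    formS k₀ k₁ (phi ^ (2 * n) • p12) p12 = sInt (normConst k₀ k₁) k₀ k₁ n := by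
  refine formS_phi_pow_smul_p12 _ (tInt (normConst k₀ k₁) k₀ k₁) ?_ ?_ ?_ ?_ n
  · rw [sInt_zero h, integral_kAlpha_normConst h, mul_one]
  · exact tInt_zero h _
  · exact fun n => sInt_succ h _ n
  · exact fun n => tInt_succ h _ n

/-! ## Asymptotics -/

theorem tendsto_div_sqrt (y : ℝ) : Tendsto (fun n : ℕ => y / √(n : ℝ)) atTop (𝓝 0) :=
  (Real.tendsto_sqrt_atTop.comp tendsto_natCast_atTop_atTop).const_div_atTop y

/-- Write `cos^(2n)` as `(1 - sin²)^n`; here `n sin²(2y/√n)` tends to `4y²`. -/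
theorem tendsto_cos_div_sqrt_pow (y : ℝ) :
    Tendsto (fun n : ℕ => Real.cos (2 * (y / √(n : ℝ))) ^ (2 * n)) atTop
      (𝓝 (Real.exp (-4 * y ^ 2))) := by
  have hs : Tendsto (fun n : ℕ => -(2 * y * Real.sinc (2 * (y / √(n : ℝ)))) ^ 2) atTop
      (𝓝 (-4 * y ^ 2)) := by
    have h0 : Tendsto (fun n : ℕ => 2 * (y / √(n : ℝ))) atTop (𝓝 0) := by
      simpa using (tendsto_div_sqrt y).const_mul 2
    have h1 := (Real.continuous_sinc.tendsto 0).comp h0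
    rw [Real.sinc_zero] at h1
    have h2 := ((h1.const_mul (2 * y)).pow 2).neg
    convert! h2 using 2
    ring
  have key : Tendsto (fun n : ℕ => (n : ℝ) * (-Real.sin (2 * (y / √(n : ℝ))) ^ 2)) atTop
      (𝓝 (-4 * y ^ 2)) := by
    refine hs.congr' ?_
    filter_upwards [eventually_gt_atTop 0] with n hn
    have hn' : (0 : ℝ) < n := by exact_mod_cast hn
    have hr : √(n : ℝ) ≠ 0 := (Real.sqrt_pos.2 hn').ne'
    have hx : Real.sin (2 * (y / √(n : ℝ))) =
        2 * (y / √(n : ℝ)) * Real.sinc (2 * (y / √(n : ℝ))) := by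
      rcases eq_or_ne (2 * (y / √(n : ℝ))) 0 with h | h
      · simp [h]
      · rw [Real.sinc_of_ne_zero h]
        generalize 2 * (y / √(n : ℝ)) = z at h ⊢
        field_simp
    rw [hx]
    generalize Real.sinc (2 * (y / √(n : ℝ))) = z
    have : (n : ℝ) = √(n : ℝ) ^ 2 := (Real.sq_sqrt hn'.le).symm
    rw [this, Real.sqrt_sq (Real.sqrt_nonneg _)]
    field_simp
  refine (Real.tendsto_one_add_pow_exp_of_tendsto key).congr fun n => ?_
  rw [pow_mul, Real.cos_sq']; ring

/-- Two cosines are held back to absorb the singularity of the weight at `π/4`; the remaining ones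
give a Gaussian majorant. The constant `8/π²` is that of `cos x ≤ 1 - 2x²/π²` at `x = 2θ`. -/
theorem cos_pow_le_exp {n : ℕ} (hn : 2 ≤ n) {θ : ℝ} (h0 : 0 < θ) (h1 : θ < Real.pi / 4) :
    Real.cos (2 * θ) ^ (2 * n) ≤
      Real.cos (2 * θ) ^ 2 * Real.exp (-(8 / Real.pi ^ 2) * (n * θ ^ 2)) := by
  have hpi := Real.pi_pos
  obtain ⟨-, -, -, -, hc, -⟩ := arc_facts h0 h1
  have h2 : Real.cos (2 * θ) ≤ Real.exp (-(8 / Real.pi ^ 2) * θ ^ 2) := by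
    have e1 := Real.cos_le_one_sub_mul_cos_sq (x := 2 * θ)
      (abs_le.2 ⟨by linarith, by linarith⟩)
    have e2 := Real.add_one_le_exp (-(8 / Real.pi ^ 2) * θ ^ 2)
    refine (e1.trans (le_of_eq ?_)).trans e2
    ring
  have h3 : Real.cos (2 * θ) ^ n ≤ Real.exp (-(8 / Real.pi ^ 2) * (n * θ ^ 2)) := by
    calc Real.cos (2 * θ) ^ n ≤ Real.exp (-(8 / Real.pi ^ 2) * θ ^ 2) ^ n := by gcongr
      _ = _ := by rw [← Real.exp_nat_mul]; ring_nf
  calc Real.cos (2 * θ) ^ (2 * n) ≤ Real.cos (2 * θ) ^ (2 + n) :=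
        pow_le_pow_of_le_one hc.le (Real.cos_le_one _) (by omega)
    _ = Real.cos (2 * θ) ^ 2 * Real.cos (2 * θ) ^ n := pow_add _ _ _
    _ ≤ _ := by gcongr

/-- Laplace's method at the endpoint `0`, for a weight with a power singularity there. -/
theorem tendsto_laplace {R : ℝ → ℝ} {p d M : ℝ} (hp : -1 < p)
    (hR : ContinuousOn R (Set.Ioo 0 (Real.pi / 4))) (hd : Tendsto R (𝓝[>] 0) (𝓝 d))
    (hM : ∀ θ, 0 < θ → θ < Real.pi / 4 → Real.cos (2 * θ) ^ 2 * |R θ| ≤ M) :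
    Tendsto (fun n : ℕ => (n : ℝ) ^ ((p + 1) / 2) *
      ∫ θ in (0 : ℝ)..(Real.pi / 4), Real.cos (2 * θ) ^ (2 * n) * (θ ^ p * R θ)) atTop
      (𝓝 (∫ y in Set.Ioi (0 : ℝ), Real.exp (-4 * y ^ 2) * (y ^ p * d))) := by
  have hpi := Real.pi_pos
  -- The integrand after the substitution `θ = y/√n`, extended by zero so that all `n` share the
  -- half-line as domain.
  set F : ℕ → ℝ → ℝ := fun n => (Set.Ioo 0 (√(n : ℝ) * (Real.pi / 4))).indicator fun y =>
    Real.cos (2 * (y / √(n : ℝ))) ^ (2 * n) * (y ^ p * R (y / √(n : ℝ))) with hF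
  have hmem : ∀ {n : ℕ} {y : ℝ}, y ∈ Set.Ioo 0 (√(n : ℝ) * (Real.pi / 4)) →
      0 < √(n : ℝ) ∧ y / √(n : ℝ) ∈ Set.Ioo 0 (Real.pi / 4) := by
    intro n y hy
    have hr : 0 < √(n : ℝ) := by
      rcases (Real.sqrt_nonneg (n : ℝ)).eq_or_lt with h | h
      · rw [← h, zero_mul] at hy; exact absurd hy.2 (not_lt.2 hy.1.le)
      · exact h
    exact ⟨hr, div_pos hy.1 hr, (div_lt_iff₀' hr).2 hy.2⟩
  have hlim : Tendsto (fun n => ∫ y in Set.Ioi (0 : ℝ), F n y) atTop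
      (𝓝 (∫ y in Set.Ioi (0 : ℝ), Real.exp (-4 * y ^ 2) * (y ^ p * d))) := by
    refine tendsto_integral_filter_of_dominated_convergence
      (fun y => M * (y ^ p * Real.exp (-(8 / Real.pi ^ 2) * y ^ 2))) ?_ ?_ ?_ ?_
    · refine Eventually.of_forall fun n => ?_
      refine ((aestronglyMeasurable_indicator_iff measurableSet_Ioo).2
        (ContinuousOn.aestronglyMeasurable ?_ measurableSet_Ioo)).restrict
      refine ContinuousOn.mul (by fun_prop) (ContinuousOn.mul (fun y hy => ?_)
        (hR.comp (by fun_prop) fun y hy => (hmem hy).2))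
      exact (Real.continuousAt_rpow_const _ _ (Or.inl hy.1.ne')).continuousWithinAt
    · filter_upwards [eventually_ge_atTop 2] with n hn
      filter_upwards [ae_restrict_mem measurableSet_Ioi] with y hy
      have hy0 : (0 : ℝ) < y := hy
      have hMn : 0 ≤ M := (by positivity : (0 : ℝ) ≤ Real.cos (2 * (Real.pi / 8)) ^ 2 *
        |R (Real.pi / 8)|).trans (hM _ (by positivity) (by linarith))
      by_cases hy' : y ∈ Set.Ioo 0 (√(n : ℝ) * (Real.pi / 4))
      · obtain ⟨hr, hθ⟩ := hmem hy'
        have hyp := Real.rpow_nonneg hy0.le p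
        rw [hF]
        simp only [Set.indicator_of_mem hy', Real.norm_eq_abs, abs_mul, abs_pow, abs_of_nonneg hyp,
          abs_of_pos (arc_facts hθ.1 hθ.2).2.2.2.2.1]
        have e1 := cos_pow_le_exp hn hθ.1 hθ.2
        have e2 := hM _ hθ.1 hθ.2
        have e3 : (n : ℝ) * (y / √(n : ℝ)) ^ 2 = y ^ 2 := by
          rw [div_pow, Real.sq_sqrt (Nat.cast_nonneg n)]
          have : (n : ℝ) ≠ 0 := by positivity
          field_simp
        rw [e3] at e1
        have hE := (Real.exp_pos (-(8 / Real.pi ^ 2) * y ^ 2)).le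
        generalize Real.exp (-(8 / Real.pi ^ 2) * y ^ 2) = E at *
        calc _ ≤ (Real.cos (2 * (y / √(n : ℝ))) ^ 2 * E) * (y ^ p * |R (y / √(n : ℝ))|) := by
              gcongr
          _ = (Real.cos (2 * (y / √(n : ℝ))) ^ 2 * |R (y / √(n : ℝ))|) * (y ^ p * E) := by ring
          _ ≤ _ := by gcongr
      · rw [hF]
        simp only [Set.indicator_of_notMem hy', norm_zero]
        have := Real.rpow_nonneg hy0.le p
        positivity
    · exact (integrableOn_rpow_mul_exp_neg_mul_sq (by positivity) hp).const_mul M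
    · filter_upwards [ae_restrict_mem measurableSet_Ioi] with y hy
      have hy0 : (0 : ℝ) < y := hy
      have e1 : Tendsto (fun n : ℕ => y / √(n : ℝ)) atTop (𝓝[>] 0) := by
        refine tendsto_nhdsWithin_iff.2 ⟨tendsto_div_sqrt y, ?_⟩
        filter_upwards [eventually_gt_atTop 0] with n hn
        have hn' : (0 : ℝ) < n := by exact_mod_cast hn
        exact div_pos hy0 (Real.sqrt_pos.2 hn')
      refine ((tendsto_cos_div_sqrt_pow y).mul ((hd.comp e1).const_mul (y ^ p))).congr' ?_
      have e2 := (Real.tendsto_sqrt_atTop.comp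
        (tendsto_natCast_atTop_atTop (R := ℝ))).eventually_gt_atTop
        (y / (Real.pi / 4))
      filter_upwards [e2] with n hn
      have hn' : y / (Real.pi / 4) < √(n : ℝ) := hn
      rw [div_lt_iff₀ (by positivity)] at hn'
      have hy' : y ∈ Set.Ioo 0 (√(n : ℝ) * (Real.pi / 4)) := ⟨hy0, hn'⟩
      rw [hF]
      simp only [Set.indicator_of_mem hy', Function.comp_apply]
  refine hlim.congr' ?_
  filter_upwards [eventually_gt_atTop 0] with n hn
  have hn' : (0 : ℝ) < n := by exact_mod_cast hn
  have hr := Real.sqrt_pos.2 hn'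
  rw [hF, setIntegral_indicator measurableSet_Ioo, Set.inter_eq_right.2 (Set.Ioo_subset_Ioi_self)]
  have sub := intervalIntegral.integral_comp_div (a := 0) (b := √(n : ℝ) * (Real.pi / 4))
    (fun θ => Real.cos (2 * θ) ^ (2 * n) * (θ ^ p * R θ)) hr.ne'
  rw [zero_div, mul_div_cancel_left₀ _ hr.ne', smul_eq_mul] at sub
  have e1 : (n : ℝ) ^ ((p + 1) / 2) = √(n : ℝ) ^ p * √(n : ℝ) := by
    rw [← Real.rpow_add_one hr.ne', Real.sqrt_eq_rpow, ← Real.rpow_mul hn'.le]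
    ring_nf
  rw [e1, mul_assoc, ← sub, intervalIntegral.integral_of_le (by positivity),
    integral_Ioc_eq_integral_Ioo, ← integral_const_mul]
  refine setIntegral_congr_fun measurableSet_Ioo fun y hy => ?_
  have := (Real.rpow_pos_of_pos hr p).ne'
  rw [Real.div_rpow hy.1.le hr.le]
  field_simp

/-- The quadratic form of the weight at `(-sin θ, cos θ)`. -/
def kQuad (c k₀ k₁ θ : ℝ) : ℝ :=
  kAlpha c k₀ k₁ θ - Real.sin (2 * θ) * kBeta c k₀ k₁ θ - Real.cos (2 * θ) * kGamma c k₀ k₁ θ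

/-- This is `LᵀDL` evaluated at `(-sin θ, cos θ)`. At `θ = 0` the first square is of order
`θ^(2+2k₁)` and the second behaves like `θ^(-2k₁)`, so `d₂` alone governs the asymptotics. -/
theorem kQuad_eq (c k₀ k₁ θ : ℝ) : kQuad c k₀ k₁ θ =
    d1 c k₀ k₁ * (Real.sin θ * rowA k₀ k₁ (Real.tan θ) -
      Real.cos θ * rowB k₀ k₁ (Real.tan θ)) ^ 2 +
    d2 c k₀ k₁ * (Real.cos θ * rowA k₀ (-k₁) (Real.tan θ) -
      Real.sin θ * rowB k₀ (-k₁) (Real.tan θ)) ^ 2 := by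
  rw [kQuad, kAlpha, kBeta, kGamma, Real.cos_two_mul', Real.sin_two_mul]
  generalize rowA k₀ k₁ (Real.tan θ) = A
  generalize rowB k₀ k₁ (Real.tan θ) = B
  generalize rowA k₀ (-k₁) (Real.tan θ) = A'
  generalize rowB k₀ (-k₁) (Real.tan θ) = B'
  linear_combination (-(d1 c k₀ k₁ * (A ^ 2 + B ^ 2) + d2 c k₀ k₁ * (A' ^ 2 + B' ^ 2)) / 2) *
    Real.sin_sq_add_cos_sq θ

/-! ### The singularity of the quadratic form at `θ = 0`. -/

theorem tan_le_two_mul {θ : ℝ} (h0 : 0 < θ) (h1 : θ < Real.pi / 4) : Real.tan θ ≤ 2 * θ := by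
  obtain ⟨f1, f2, f3, f4, f5, f6⟩ := arc_facts h0 h1
  have hs := (Real.sin_lt h0).le
  have hc : 1 / 2 ≤ Real.cos θ := by
    have h2 : Real.cos (2 * θ) = 2 * Real.cos θ ^ 2 - 1 := Real.cos_two_mul θ
    nlinarith
  rw [Real.tan_eq_sin_div_cos, div_le_iff₀ f1]
  nlinarith

theorem rpow_mul_tan_rpow_le {q : ℝ} (hq : |q| ≤ 1) {θ : ℝ} (h0 : 0 < θ) (h1 : θ < Real.pi / 4) :
    θ ^ q * Real.tan θ ^ (-q) ≤ 2 := by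
  obtain ⟨f1, f2, f3, f4, f5, f6⟩ := arc_facts h0 h1
  have hle : θ ≤ Real.tan θ := Real.le_tan h0.le (by linarith [Real.pi_pos])
  have e : θ ^ q * Real.tan θ ^ (-q) = (Real.tan θ / θ) ^ (-q) := by
    rw [Real.div_rpow f3.le h0.le, Real.rpow_neg h0.le q, div_inv_eq_mul, mul_comm]
  have x1 : 1 ≤ Real.tan θ / θ := (one_le_div h0).2 hle
  have x2 : Real.tan θ / θ ≤ 2 := (div_le_iff₀ h0).2 (tan_le_two_mul h0 h1)
  rw [e]
  calc (Real.tan θ / θ) ^ (-q) ≤ (Real.tan θ / θ) ^ (1 : ℝ) :=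
        Real.rpow_le_rpow_of_exponent_le x1 (by linarith [neg_abs_le q])
    _ ≤ 2 := by rwa [Real.rpow_one]

theorem cos_sq_mul_one_sub_tan_sq_rpow_le {q : ℝ} (hq : 0 ≤ q) (hq1 : q ≤ 1) {θ : ℝ}
    (h0 : 0 < θ) (h1 : θ < Real.pi / 4) :
    Real.cos (2 * θ) ^ 2 * (1 - Real.tan θ ^ 2) ^ (-q) ≤ 1 := by
  obtain ⟨f1, f2, f3, f4, f5, f6⟩ := arc_facts h0 h1
  have e1 : Real.cos (2 * θ) ≤ 1 - Real.tan θ ^ 2 := by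
    rw [one_sub_tan_sq f1.ne', le_div_iff₀ (by positivity)]
    exact mul_le_of_le_one_right f5.le (pow_le_one₀ f1.le (Real.cos_le_one θ))
  calc Real.cos (2 * θ) ^ 2 * (1 - Real.tan θ ^ 2) ^ (-q)
      ≤ Real.cos (2 * θ) ^ 2 * Real.cos (2 * θ) ^ (-(1 : ℝ)) := by
        gcongr
        calc (1 - Real.tan θ ^ 2) ^ (-q) ≤ Real.cos (2 * θ) ^ (-q) :=
              Real.rpow_le_rpow_of_nonpos f5 e1 (by linarith)
          _ ≤ _ := Real.rpow_le_rpow_of_exponent_ge f5 (Real.cos_le_one _) (by linarith)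
    _ = Real.cos (2 * θ) := by
        rw [Real.rpow_neg_one]; field_simp
    _ ≤ 1 := Real.cos_le_one _

theorem kQuad_bound (h : Adm k₀ k₁) (c : ℝ) : ∃ M, ∀ θ, 0 < θ → θ < Real.pi / 4 →
    Real.cos (2 * θ) ^ 2 * |θ ^ (2 * k₁) * kQuad c k₀ k₁ θ| ≤ M := by
  obtain ⟨b1, b2, b3, b4, b5, b6, b7, b8⟩ := h.bounds
  obtain ⟨C₁, hC₁, hb₁⟩ := row_products_bound h
  obtain ⟨C₂, hC₂, hb₂⟩ := row_products_bound h.neg_right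
  refine ⟨(|d1 c k₀ k₁| * (4 * C₁) + |d2 c k₀ k₁| * (4 * C₂)) * 2, fun θ h0 h1 => ?_⟩
  obtain ⟨f1, f2, f3, f4, f5, f6⟩ := arc_facts h0 h1
  obtain ⟨a1, -, g1⟩ := hb₁ _ f3 f4
  obtain ⟨a2, -, g2⟩ := hb₂ _ f3 f4
  have hE := (Real.rpow_pos_of_pos (sq_mem f3 f4).2.1 (-(2 * |k₀|))).le
  have hce := cos_sq_mul_one_sub_tan_sq_rpow_le (q := 2 * |k₀|) (by positivity)
    (by linarith [abs_le.2 ⟨b5.le, b6.le⟩]) h0 h1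
  have hth := rpow_mul_tan_rpow_le (q := 2 * k₁)
    (abs_le.2 ⟨by linarith, by linarith⟩) h0 h1
  have hθ := Real.rpow_nonneg h0.le (2 * k₁)
  have hu := Real.rpow_nonneg f3.le (-(2 * k₁))
  have hs : Real.sin θ ≤ Real.tan θ := (Real.sin_lt h0).le.trans
    (Real.le_tan h0.le (by linarith [Real.pi_pos]))
  have hc1 := Real.cos_le_one θ
  have hs1 := Real.sin_le_one θ
  -- Since `k₁ > -1/2`, the exponent `2 + 2k₁` exceeds `-2k₁`: the first row is no more singular
  -- than the second.
  have hp : Real.tan θ ^ (2 * k₁) * Real.tan θ ^ 2 ≤ Real.tan θ ^ (-(2 * k₁)) := by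
    rw [← Real.rpow_natCast, ← Real.rpow_add f3]
    exact Real.rpow_le_rpow_of_exponent_ge f3 f4.le (by push_cast; linarith)
  rw [show 2 * -k₁ = -(2 * k₁) by ring] at a2 g2
  rw [abs_mul, abs_of_nonneg hθ, kQuad_eq]
  set P := Real.tan θ ^ (-(2 * k₁)) with hP
  set E := (1 - Real.tan θ ^ 2) ^ (-(2 * |k₀|)) with hEdef
  set P₁ := Real.tan θ ^ (2 * k₁) with hP1
  have hP1n : 0 ≤ P₁ := Real.rpow_nonneg f3.le _
  generalize rowA k₀ k₁ (Real.tan θ) = A at *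
  generalize rowB k₀ k₁ (Real.tan θ) = B at *
  generalize rowA k₀ (-k₁) (Real.tan θ) = A' at *
  generalize rowB k₀ (-k₁) (Real.tan θ) = B' at *
  have q1 : (Real.sin θ * A - Real.cos θ * B) ^ 2 ≤ 4 * C₁ * (P * E) := by
    have m1 : Real.sin θ ^ 2 * A ^ 2 ≤ Real.tan θ ^ 2 * (C₁ * (P₁ * E)) := by gcongr
    have m2 : Real.cos θ ^ 2 * B ^ 2 ≤ 1 ^ 2 * (C₁ * (P₁ * E) * Real.tan θ ^ 2) := by gcongr
    have m3 : C₁ * E * (P₁ * Real.tan θ ^ 2) ≤ C₁ * E * P := by gcongr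
    have e : (Real.sin θ * A - Real.cos θ * B) ^ 2 = 2 * (Real.sin θ ^ 2 * A ^ 2) +
        2 * (Real.cos θ ^ 2 * B ^ 2) - (Real.sin θ * A + Real.cos θ * B) ^ 2 := by ring
    linarith [sq_nonneg (Real.sin θ * A + Real.cos θ * B)]
  have q2 : (Real.cos θ * A' - Real.sin θ * B') ^ 2 ≤ 4 * C₂ * (P * E) := by
    have m1 : Real.cos θ ^ 2 * A' ^ 2 ≤ 1 ^ 2 * (C₂ * (P * E)) := by gcongr
    have m2 : Real.sin θ ^ 2 * B' ^ 2 ≤ 1 ^ 2 * (C₂ * (P * E) * 1 ^ 2) := by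
      gcongr
      exact g2.trans (by gcongr)
    have e : (Real.cos θ * A' - Real.sin θ * B') ^ 2 = 2 * (Real.cos θ ^ 2 * A' ^ 2) +
        2 * (Real.sin θ ^ 2 * B' ^ 2) - (Real.cos θ * A' + Real.sin θ * B') ^ 2 := by ring
    linarith [sq_nonneg (Real.cos θ * A' + Real.sin θ * B')]
  have hX : |d1 c k₀ k₁ * (Real.sin θ * A - Real.cos θ * B) ^ 2 +
      d2 c k₀ k₁ * (Real.cos θ * A' - Real.sin θ * B') ^ 2| ≤
      (|d1 c k₀ k₁| * (4 * C₁) + |d2 c k₀ k₁| * (4 * C₂)) * (P * E) := by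
    refine (abs_add_le _ _).trans ?_
    rw [abs_mul, abs_mul, abs_sq, abs_sq]
    have := mul_le_mul_of_nonneg_left q1 (abs_nonneg (d1 c k₀ k₁))
    have := mul_le_mul_of_nonneg_left q2 (abs_nonneg (d2 c k₀ k₁))
    linarith
  set D := |d1 c k₀ k₁| * (4 * C₁) + |d2 c k₀ k₁| * (4 * C₂) with hD
  have hDn : 0 ≤ D := by positivity
  calc _ ≤ Real.cos (2 * θ) ^ 2 * (θ ^ (2 * k₁) * (D * (P * E))) := by gcongr
    _ = D * ((θ ^ (2 * k₁) * P) * (Real.cos (2 * θ) ^ 2 * E)) := by ring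
    _ ≤ D * (2 * 1) := by gcongr
    _ = _ := by ring

theorem tendsto_div_tan : Tendsto (fun θ : ℝ => θ / Real.tan θ) (𝓝[>] 0) (𝓝 1) := by
  have h1 : Tendsto (fun θ : ℝ => Real.cos θ / Real.sinc θ) (𝓝[>] 0) (𝓝 1) := by
    have := (Real.continuous_cos.tendsto 0).div (Real.continuous_sinc.tendsto 0) (by simp)
    rw [Real.cos_zero, Real.sinc_zero, div_one] at this
    exact this.mono_left nhdsWithin_le_nhds
  refine h1.congr' ?_
  filter_upwards [eventually_arc_zero] with θ hθ
  obtain ⟨f1, f2, f3, f4, f5, f6⟩ := arc_facts hθ.1 hθ.2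
  rw [Real.sinc_of_ne_zero hθ.1.ne', Real.tan_eq_sin_div_cos]
  field_simp

theorem tendsto_kQuad (h : Adm k₀ k₁) (c : ℝ) :
    Tendsto (fun θ => θ ^ (2 * k₁) * kQuad c k₀ k₁ θ) (𝓝[>] 0) (𝓝 (d2 c k₀ k₁)) := by
  obtain ⟨b1, b2, b3, b4, b5, b6, b7, b8⟩ := h.bounds
  have t0 : Tendsto Real.tan (𝓝[>] 0) (𝓝 0) := tendsto_nhds_of_tendsto_nhdsWithin tendsto_tan_zero
  have ts : Tendsto Real.sin (𝓝[>] 0) (𝓝 0) := by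
    simpa using (Real.continuous_sin.tendsto 0).mono_left nhdsWithin_le_nhds
  have tc : Tendsto Real.cos (𝓝[>] 0) (𝓝 1) := by
    simpa using (Real.continuous_cos.tendsto 0).mono_left nhdsWithin_le_nhds
  have tr : Tendsto (fun θ : ℝ => (θ / Real.tan θ) ^ (2 * k₁)) (𝓝[>] 0) (𝓝 1) := by
    simpa using tendsto_div_tan.rpow_const (p := 2 * k₁) (Or.inl one_ne_zero)
  -- The order of the first square after multiplication by `θ^(2k₁)`; it is positive because `k₁ >
  -- -1/2`.
  have tu : Tendsto (fun θ : ℝ => Real.tan θ ^ (2 + 4 * k₁)) (𝓝[>] 0) (𝓝 0) := by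
    simpa [Real.zero_rpow (show 2 + 4 * k₁ ≠ 0 by linarith)] using
      t0.rpow_const (p := 2 + 4 * k₁) (Or.inr (by linarith))
  have a1 := (tendsto_rowA_mul_rpow h).comp tendsto_tan_zero
  have r1 := (tendsto_rowB_mul_rpow h).comp tendsto_tan_zero
  have a2 := (tendsto_rowA_mul_rpow h.neg_right).comp tendsto_tan_zero
  have r2 := ((tendsto_rowB_mul_rpow h.neg_right).comp tendsto_tan_zero).mul t0
  have e1 := (((tc.mul a1).sub (tc.mul r1)).pow 2).mul tu
  have e2 := ((tc.mul a2).sub (ts.mul r2)).pow 2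
  have e3 := tr.mul ((e1.const_mul (d1 c k₀ k₁)).add (e2.const_mul (d2 c k₀ k₁)))
  have hd : 1 * (d1 c k₀ k₁ * ((1 * 1 - 1 * -(k₀ / (k₁ + 1 / 2))) ^ 2 * 0) +
      d2 c k₀ k₁ * (1 * 1 - 0 * (-(k₀ / (-k₁ + 1 / 2)) * 0)) ^ 2) = d2 c k₀ k₁ := by ring
  rw [hd] at e3
  refine e3.congr' ?_
  filter_upwards [eventually_arc_zero] with θ hθ
  obtain ⟨f1, f2, f3, f4, f5, f6⟩ := arc_facts hθ.1 hθ.2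
  have hsin : Real.sin θ = Real.tan θ * Real.cos θ := (Real.tan_mul_cos f1.ne').symm
  rw [kQuad_eq, Real.div_rpow hθ.1.le f3.le]
  simp only [Function.comp_apply, neg_neg]
  rw [hsin]
  have x1 : Real.tan θ ^ (2 * k₁) = (Real.tan θ ^ k₁) ^ 2 := by
    rw [← Real.rpow_natCast, ← Real.rpow_mul f3.le]; ring_nf
  have x2 : Real.tan θ ^ (2 + 4 * k₁) = Real.tan θ ^ 2 * (Real.tan θ ^ k₁) ^ 4 := by
    rw [Real.rpow_add f3, Real.rpow_two, show 4 * k₁ = k₁ * (4 : ℕ) by push_cast; ring,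
      Real.rpow_mul_natCast f3.le]
  have x3 : Real.tan θ ^ (-k₁) = (Real.tan θ ^ k₁)⁻¹ := Real.rpow_neg f3.le _
  have x4 := (Real.rpow_pos_of_pos f3 k₁).ne'
  rw [x1, x2, x3]
  generalize Real.tan θ ^ k₁ = v at *
  field_simp

/-- Laplace's method with `p = -2k₁`. The limit integral is `(1/2) 4^(k₁ - 1/2) Γ(1/2 - k₁)`, and
the factor `8` for the eight arcs leaves the constant `2`. -/
theorem tendsto_sInt (h : Adm k₀ k₁) (c : ℝ) :
    Tendsto (fun n : ℕ => (n : ℝ) ^ (1 / 2 - k₁) * sInt c k₀ k₁ n) atTop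
      (𝓝 (2 * d2 c k₀ k₁ * 4 ^ k₁ * Real.Gamma (1 / 2 - k₁))) := by
  obtain ⟨b1, b2, b3, b4, b5, b6, b7, b8⟩ := h.bounds
  obtain ⟨M, hM⟩ := kQuad_bound h c
  obtain ⟨ca, cb, cg⟩ := continuousOn_k h c
  have hcont : ContinuousOn (fun θ => θ ^ (2 * k₁) * kQuad c k₀ k₁ θ)
      (Set.Ioo 0 (Real.pi / 4)) := by
    refine ContinuousOn.mul (fun θ hθ =>
      (Real.continuousAt_rpow_const _ _ (Or.inl hθ.1.ne')).continuousWithinAt) ?_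
    have hs : Continuous fun θ : ℝ => Real.sin (2 * θ) := by fun_prop
    have hc : Continuous fun θ : ℝ => Real.cos (2 * θ) := by fun_prop
    exact (ca.sub (hs.continuousOn.mul cb)).sub (hc.continuousOn.mul cg)
  have main := (tendsto_laplace (p := -(2 * k₁)) (by linarith) hcont (tendsto_kQuad h c)
    hM).const_mul 8
  have hG : ∫ y in Set.Ioi (0 : ℝ), Real.exp (-4 * y ^ 2) * (y ^ (-(2 * k₁)) * d2 c k₀ k₁) =
      d2 c k₀ k₁ * (4 ^ (k₁ - 1 / 2) * (1 / 2) * Real.Gamma (1 / 2 - k₁)) := by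
    have := integral_rpow_mul_exp_neg_mul_rpow (p := 2) (q := -(2 * k₁)) (b := 4) (by norm_num)
      (by linarith) (by norm_num)
    rw [show -(-(2 * k₁) + 1) / 2 = k₁ - 1 / 2 by ring,
      show (-(2 * k₁) + 1) / 2 = 1 / 2 - k₁ by ring] at this
    rw [← this, ← integral_const_mul]
    refine integral_congr_ae (Eventually.of_forall fun y => ?_)
    simp only [Real.rpow_two]
    ring
  have h4 : (4 : ℝ) ^ (k₁ - 1 / 2) = 4 ^ k₁ / 2 := by
    rw [Real.rpow_sub (by norm_num), ← Real.sqrt_eq_rpow, show (4 : ℝ) = 2 ^ 2 by norm_num,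
      Real.sqrt_sq (by norm_num)]
  rw [hG, h4] at main
  convert! main using 1
  · ext n
    rw [sInt, show (-(2 * k₁) + 1) / 2 = 1 / 2 - k₁ by ring, mul_left_comm]
    refine congrArg (fun z => 8 * ((n : ℝ) ^ (1 / 2 - k₁) * z)) ?_
    have hpi : (0 : ℝ) ≤ Real.pi / 4 := by positivity
    rw [intervalIntegral.integral_of_le hpi, intervalIntegral.integral_of_le hpi,
      integral_Ioc_eq_integral_Ioo, integral_Ioc_eq_integral_Ioo]
    refine setIntegral_congr_fun measurableSet_Ioo fun θ hθ => ?_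
    have := (Real.rpow_pos_of_pos hθ.1 (2 * k₁)).ne'
    simp only [kQuad, Real.rpow_neg hθ.1.le]
    field_simp
  · congr 1; ring

/-- Of the two factors `Γ(1/2 + k₁)` in `d₂`, one combines with `Γ(1/2 - k₁)` from the Laplace
integral to give `π / cos(πk₁)` by the reflection formula. -/
theorem tendsto_sInt_div (h : Adm k₀ k₁) {c : ℝ} (hc : c ≠ 0) :
    Tendsto (fun n : ℕ => sInt c k₀ k₁ n /
        (2 * Real.pi * c / (Real.cos (Real.pi * k₀) * Real.cos (Real.pi * k₁)) *
          ((2 : ℝ) ^ (2 * k₁) * (n : ℝ) ^ (k₁ - 1 / 2) * Real.Gamma (1 / 2 + k₁) /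
            (Real.Gamma (1 / 2 + k₀ + k₁) * Real.Gamma (1 / 2 - k₀ + k₁))))) atTop (𝓝 1) := by
  obtain ⟨b1, b2, b3, b4, b5, b6, b7, b8⟩ := h.bounds
  have hpi := Real.pi_pos
  have hc0 : 0 < Real.cos (Real.pi * k₀) :=
    Real.cos_pos_of_mem_Ioo ⟨by nlinarith, by nlinarith⟩
  have hc1 : 0 < Real.cos (Real.pi * k₁) :=
    Real.cos_pos_of_mem_Ioo ⟨by nlinarith, by nlinarith⟩
  have g2 := Real.Gamma_pos_of_pos (show 0 < 1 / 2 + k₁ by linarith)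
  have g5 := Real.Gamma_pos_of_pos (show 0 < 1 / 2 + k₀ + k₁ by linarith)
  have g6 := Real.Gamma_pos_of_pos (show 0 < 1 / 2 - k₀ + k₁ by linarith)
  have hrefl : Real.Gamma (1 / 2 + k₁) * Real.Gamma (1 / 2 - k₁) =
      Real.pi / Real.cos (Real.pi * k₁) := by
    have := Real.Gamma_mul_Gamma_one_sub (1 / 2 + k₁)
    rw [show 1 - (1 / 2 + k₁) = 1 / 2 - k₁ by ring,
      show Real.pi * (1 / 2 + k₁) = Real.pi * k₁ + Real.pi / 2 by ring,
      Real.sin_add_pi_div_two] at this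
    exact this
  have h4 : (4 : ℝ) ^ k₁ = 2 ^ (2 * k₁) := by
    rw [Real.rpow_mul (by norm_num)]; norm_num
  have p2 : (0 : ℝ) < 2 ^ (2 * k₁) := by positivity
  have hL : 2 * d2 c k₀ k₁ * 4 ^ k₁ * Real.Gamma (1 / 2 - k₁) =
      2 * Real.pi * c / (Real.cos (Real.pi * k₀) * Real.cos (Real.pi * k₁)) *
          ((2 : ℝ) ^ (2 * k₁) * Real.Gamma (1 / 2 + k₁) /
            (Real.Gamma (1 / 2 + k₀ + k₁) * Real.Gamma (1 / 2 - k₀ + k₁))) := by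
    have : 2 * d2 c k₀ k₁ * 4 ^ k₁ * Real.Gamma (1 / 2 - k₁) =
      2 * c * 2 ^ (2 * k₁) * Real.Gamma (1 / 2 + k₁) / (Real.cos (Real.pi * k₀) *
        Real.Gamma (1 / 2 + k₀ + k₁) * Real.Gamma (1 / 2 - k₀ + k₁)) *
        (Real.Gamma (1 / 2 + k₁) * Real.Gamma (1 / 2 - k₁)) := by
      rw [h4, d2]; ring
    rw [this, hrefl]
    field_simp
  have main := (tendsto_sInt h c).div_const (2 * d2 c k₀ k₁ * 4 ^ k₁ * Real.Gamma (1 / 2 - k₁))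
  rw [div_self (by rw [hL]; positivity), hL] at main
  refine main.congr' ?_
  filter_upwards [eventually_gt_atTop (0 : ℕ)] with n hn
  have hn' : (0 : ℝ) < n := by exact_mod_cast hn
  have pn := (Real.rpow_pos_of_pos hn' (k₁ - 1 / 2)).ne'
  rw [show 1 / 2 - k₁ = -(k₁ - 1 / 2) by ring, Real.rpow_neg hn'.le]
  field_simp

end

end B2

/-! ### Assembly: normalization, integral formula and asymptotics. -/

theorem mainTheorem6 (k₀ k₁ : ℝ)
    (h₁ : -(1 / 2) < k₀ + k₁) (h₂ : k₀ + k₁ < 1 / 2)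
    (h₃ : -(1 / 2) < k₀ - k₁) (h₄ : k₀ - k₁ < 1 / 2) :
    (MeasureTheory.Integrable (fun x : ℝ × ℝ =>
        B2.K k₀ k₁ ![x.1, x.2] 0 0 * Real.exp (-(x.1 ^ 2 + x.2 ^ 2) / 2)) ∧
      ∫ x : ℝ × ℝ, B2.K k₀ k₁ ![x.1, x.2] 0 0 * Real.exp (-(x.1 ^ 2 + x.2 ^ 2) / 2) = 1) ∧
    (∀ n : ℕ,
      IntervalIntegrable (B2.integrand k₀ k₁ n) MeasureTheory.volume 0 (Real.pi / 4) ∧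
      B2.formS k₀ k₁ (B2.phi ^ (2 * n) • B2.p12) B2.p12 =
        8 * ∫ θ in (0 : ℝ)..(Real.pi / 4), B2.integrand k₀ k₁ n θ) ∧
    Filter.Tendsto (fun n : ℕ =>
      B2.formS k₀ k₁ (B2.phi ^ (2 * n) • B2.p12) B2.p12 /
        (2 * Real.pi * B2.normConst k₀ k₁ /
            (Real.cos (Real.pi * k₀) * Real.cos (Real.pi * k₁)) *
          ((2 : ℝ) ^ (2 * k₁) * (n : ℝ) ^ (k₁ - 1 / 2) * Real.Gamma (1 / 2 + k₁) /
            (Real.Gamma (1 / 2 + k₀ + k₁) * Real.Gamma (1 / 2 - k₀ + k₁)))))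
      Filter.atTop (nhds 1) := by
  have h := B2.adm_of_bounds h₁ h₂ h₃ h₄
  obtain ⟨hint, hval⟩ := B2.integral_weight_gaussian h (B2.normConst k₀ k₁)
  refine ⟨⟨hint, hval.trans (B2.integral_kAlpha_normConst h)⟩, fun n =>
    ⟨B2.intervalIntegrable_integrand h n, ?_⟩, ?_⟩
  · rw [B2.formS_eq_sInt h, B2.integral_integrand]
  · simp only [B2.formS_eq_sInt h]
    exact B2.tendsto_sInt_div h (B2.normConst_pos h).ne'
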